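/- All graphs are finite and simple, and $|G|$ denotes the number of vertices of $G$. A graph $H$ has branch-length at least $\ell$ if every cycle of $H$ has length at least $\ell$ and every two distinct vertices of $H$ of degree at least three have distance at least $\ell$ in $H$ (the distance between vertices in different components is infinite). A graph $G$ is $\varepsilon$-sparse if every vertex of $G$ has degree less than $\varepsilon|G|$, and $(\alpha,\beta)$-coherent if there do not exist disjoint sets $A,B\subseteq V(G)$ with no edge of $G$ between $A$ and $B$ such that $|A|\ge\alpha$ and $|B|\ge\beta$. Let $c>0$ be a real number such that $1/c$ is an integer, and let $H$ be a graph with branch-length at least $4/c+5$. Then there exists $\varepsilon>0$ such that every $\varepsilon$-sparse, $(\varepsilon|G|^{1-c},\varepsilon|G|)$-coherent graph $G$ with $|G|>1$ contains $H$; that is, some induced subgraph of $G$ is isomorphic to $H$. -/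

import Mathlib

namespace PurePairs

/-- A finite graph `H` has branch-length at least `ℓ`: every cycle has length at least `ℓ`, and every
two distinct vertices of degree at least three have distance at least `ℓ` (vertices in different
components have infinite distance, so they are not constrained). -/
def HasBranchLengthAtLeast {W : Type*} [Fintype W] (H : SimpleGraph W) [DecidableRel H.Adj]
    (ℓ : ℝ) : Prop :=
  (∀ (w : W) (p : H.Walk w w), p.IsCycle → ℓ ≤ (p.length : ℝ)) ∧
  (∀ u v : W, u ≠ v → 3 ≤ H.degree u → 3 ≤ H.degree v → H.Reachable u v → ℓ ≤ (H.dist u v : ℝ))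

/-- `G` is `ε`-sparse: every vertex has degree less than `ε|G|`. -/
def IsSparse {V : Type*} [Fintype V] (G : SimpleGraph V) [DecidableRel G.Adj] (ε : ℝ) : Prop :=
  ∀ v : V, (G.degree v : ℝ) < ε * (Fintype.card V : ℝ)

/-- Disjoint vertex sets with no edge between them. -/
def IsAnticompletePair {V : Type*} (G : SimpleGraph V) (A B : Finset V) : Prop :=
  Disjoint A B ∧ ∀ a ∈ A, ∀ b ∈ B, ¬ G.Adj a b

/-- `G` is `(α, β)`-coherent: there is no anticomplete pair `A, B` with `|A| ≥ α`, `|B| ≥ β`. -/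
def IsCoherent {V : Type*} (G : SimpleGraph V) (α β : ℝ) : Prop :=
  ¬ ∃ A B : Finset V, IsAnticompletePair G A B ∧ α ≤ (A.card : ℝ) ∧ β ≤ (B.card : ℝ)

end PurePairs

/-!
Write `k = 1 / c`. Passing to a linearly large set `U` of vertices, one may assume that `G` is
nearly regular: the degrees are at most `Δ`, and every linearly large subset has a vertex of
degree at least `Δ / |G| ^ (c / 2)` within it. Coherence makes small sets expand, so linearly
large sets contain connected sets of radius less than `k` that have many neighbors. A potential
argument on blocks of vertices combines these into a *hub*: linearly large sets `W` and `R`, and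
any prescribed number of pairwise anticomplete connected sets of radius less than `k`, each of
which is anticomplete to `R` and has a neighbor of every vertex of `W`.

Near-regularity allows any two linearly large subsets of `W` to be joined through `R` by an
induced path of any prescribed length at least `3`. Hence two vertices of `W` can be joined by an
induced path of any prescribed length at least `4 * k + 5`: from each of them walk through a
covering set of its own to one of linearly many vertices of `W`, at a cost of at most `2 * k + 1`
edges, and link the two sets of endpoints through `R`.

A graph of branch-length at least `4 * k + 5` can be built from isolated vertices, the centers, by
repeatedly adding paths of length at least `4 * k + 5` between centers and pendant paths at
centers. It is embedded step by step with the centers in `W`, each new path using up covering sets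
not used before.
-/

namespace PurePairs

open Finset
open scoped Classical

/-! ### Expansion and rooted sets -/

section

variable {V : Type*} {G : SimpleGraph V} {α β t : ℝ}

/-- `N_Y(X)`: the vertices of `Y` with a neighbor in `X`. -/
noncomputable def neighborsIn (G : SimpleGraph V) (X Y : Finset V) : Finset V :=
  {y ∈ Y | ∃ x ∈ X, G.Adj x y}

/-- The degree of `v` into the vertex set `Y`. -/
noncomputable def degreeIn (G : SimpleGraph V) (v : V) (Y : Finset V) : ℕ :=
  #{y ∈ Y | G.Adj v y}

@[simp] lemma mem_neighborsIn {X Y : Finset V} {y : V} :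
    y ∈ neighborsIn G X Y ↔ y ∈ Y ∧ ∃ x ∈ X, G.Adj x y :=
  mem_filter

lemma neighborsIn_subset (X Y : Finset V) : neighborsIn G X Y ⊆ Y := filter_subset _ _

@[simp] lemma neighborsIn_empty_left (Y : Finset V) : neighborsIn G ∅ Y = ∅ := by
  simp [neighborsIn]

lemma neighborsIn_mono_right (X : Finset V) {Y Z : Finset V} (h : Y ⊆ Z) :
    neighborsIn G X Y ⊆ neighborsIn G X Z :=
  filter_subset_filter _ h

lemma neighborsIn_union_left (X X' Y : Finset V) :
    neighborsIn G (X ∪ X') Y = neighborsIn G X Y ∪ neighborsIn G X' Y := by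
  ext y
  simp only [mem_neighborsIn, mem_union, or_and_right, exists_or, and_or_left]

lemma card_neighborsIn_singleton (x : V) (Y : Finset V) :
    #(neighborsIn G {x} Y) = degreeIn G x Y := by
  simp [neighborsIn, degreeIn]

lemma degreeIn_mono (v : V) {Y Z : Finset V} (h : Y ⊆ Z) : degreeIn G v Y ≤ degreeIn G v Z :=
  card_le_card (filter_subset_filter _ h)

lemma card_neighborsIn_le (X Y : Finset V) {d : ℝ} (h : ∀ x ∈ X, (degreeIn G x Y : ℝ) ≤ d) :
    (#(neighborsIn G X Y) : ℝ) ≤ #X * d := by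
  have hsub : neighborsIn G X Y ⊆ X.biUnion fun x ↦ {y ∈ Y | G.Adj x y} := fun y hy ↦ by
    obtain ⟨hyY, x, hx, hxy⟩ := mem_neighborsIn.1 hy
    exact mem_biUnion.2 ⟨x, hx, mem_filter.2 ⟨hyY, hxy⟩⟩
  calc (#(neighborsIn G X Y) : ℝ)
      ≤ ∑ x ∈ X, (degreeIn G x Y : ℝ) := by
        exact_mod_cast (card_le_card hsub).trans card_biUnion_le
    _ ≤ #X * d := by simpa using sum_le_sum h

lemma cast_card_union_le (A B : Finset V) : (#(A ∪ B) : ℝ) ≤ #A + #B := by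
  exact_mod_cast card_union_le A B

lemma card_sub_card_le_card_sdiff (A B : Finset V) : (#A : ℝ) - #B ≤ #(A \ B) := by
  have : #A ≤ #(A \ B) + #B := by have := le_card_sdiff B A; omega
  have : (#A : ℝ) ≤ #(A \ B) + #B := by exact_mod_cast this
  linarith

lemma card_neighborsIn_le_erase_add (X Y : Finset V) (x : V) :
    (#(neighborsIn G X Y) : ℝ) ≤ #(neighborsIn G (X.erase x) Y) + degreeIn G x Y := by
  have hsub : neighborsIn G X Y ⊆ neighborsIn G (X.erase x) Y ∪ neighborsIn G {x} Y := by
    rw [← neighborsIn_union_left]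
    intro y
    simp only [mem_neighborsIn, mem_union, mem_erase, mem_singleton]
    rintro ⟨hy, z, hz, hzy⟩
    exact ⟨hy, z, by tauto, hzy⟩
  rw [← card_neighborsIn_singleton]
  exact (Nat.cast_le.2 (card_le_card hsub)).trans (cast_card_union_le _ _)

namespace IsAnticompletePair

variable {X Y X' Y' : Finset V}

lemma symm (h : IsAnticompletePair G X Y) : IsAnticompletePair G Y X :=
  ⟨h.1.symm, fun y hy x hx hxy ↦ h.2 x hx y hy hxy.symm⟩

lemma mono (h : IsAnticompletePair G X Y) (hX : X' ⊆ X) (hY : Y' ⊆ Y) :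
    IsAnticompletePair G X' Y' :=
  ⟨h.1.mono hX hY, fun x hx _ hy ↦ h.2 x (hX hx) _ (hY hy)⟩

lemma sdiff_neighborsIn (h : Disjoint X Y) : IsAnticompletePair G X (Y \ neighborsIn G X Y) :=
  ⟨h.mono_right sdiff_subset, fun x hx _ hy hxy ↦
    (mem_sdiff.1 hy).2 (mem_neighborsIn.2 ⟨(mem_sdiff.1 hy).1, x, hx, hxy⟩)⟩

end IsAnticompletePair

lemma IsCoherent.card_lt (h : IsCoherent G α β) {A B : Finset V} (hAB : IsAnticompletePair G A B)
    (hA : α ≤ #A) : (#B : ℝ) < β := by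
  by_contra! hB
  exact h ⟨A, B, hAB, hA, hB⟩

lemma IsCoherent.sub_lt_card_neighborsIn (h : IsCoherent G α β) {A B : Finset V}
    (hAB : Disjoint A B) (hA : α ≤ #A) : (#B : ℝ) - β < #(neighborsIn G A B) := by
  have := h.card_lt (IsAnticompletePair.sdiff_neighborsIn hAB) hA
  have := card_sub_card_le_card_sdiff B (neighborsIn G A B)
  linarith

lemma IsCoherent.exists_expanding_core (h : IsCoherent G α β) (hα : 0 < α) (ht : 0 ≤ t)
    (A : Finset V) {B : Finset V} (hB : β + 2 * α * (t + 1) ≤ #B) :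
    ∃ K ⊆ A, (#K : ℝ) < α ∧
      ∀ X ⊆ A \ K, (#X : ℝ) ≤ α → t * #X ≤ #(neighborsIn G X (B \ (K ∪ X))) := by
  -- `K` is a largest set of size less than `α` that fails to expand by the factor `t`.
  let small : Finset (Finset V) := {K ∈ A.powerset |
    (#K : ℝ) < α ∧ (#(neighborsIn G K (B \ K)) : ℝ) ≤ t * #K}
  have hsmall : small.Nonempty := ⟨∅, by simpa [small] using hα⟩
  obtain ⟨K, hK, hmax⟩ := exists_max_image small card hsmall
  simp only [small, mem_filter, mem_powerset] at hK hmax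
  obtain ⟨hKA, hKα, hKt⟩ := hK
  refine ⟨K, hKA, hKα, fun X hX hXα ↦ ?_⟩
  by_contra! hfail
  have hdisj : Disjoint K X := disjoint_sdiff.mono_right hX
  have hcard : (#(K ∪ X) : ℝ) = #K + #X := by exact_mod_cast card_union_of_disjoint hdisj
  have hunion : (#(neighborsIn G (K ∪ X) (B \ (K ∪ X))) : ℝ) ≤ t * #(K ∪ X) := by
    have hKmono := card_le_card (neighborsIn_mono_right (G := G) K
      (sdiff_subset_sdiff (Subset.refl B) (subset_union_left (s₁ := K) (s₂ := X))))
    rw [neighborsIn_union_left, hcard]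
    refine (cast_card_union_le _ _).trans ?_
    have : (#(neighborsIn G K (B \ (K ∪ X))) : ℝ) ≤ #(neighborsIn G K (B \ K)) := by
      exact_mod_cast hKmono
    linarith
  by_cases hlt : (#(K ∪ X) : ℝ) < α
  · have hXpos : 0 < #X := by
      rw [card_pos, nonempty_iff_ne_empty]
      rintro rfl
      simp at hfail
    have := hmax (K ∪ X) ⟨union_subset hKA (hX.trans sdiff_subset), hlt, hunion⟩
    rw [card_union_of_disjoint hdisj] at this
    omega
  · have := h.sub_lt_card_neighborsIn (disjoint_sdiff (s := K ∪ X) (t := B)) (not_lt.1 hlt)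
    have := card_sub_card_le_card_sdiff B (K ∪ X)
    have : t * #(K ∪ X) ≤ t * (2 * α) := mul_le_mul_of_nonneg_left (by linarith) ht
    nlinarith

/-- `D` is connected with radius at most `r`: every vertex of `D` other than the root `w` has a
neighbor in `D` of smaller rank, and ranks are at most `r`. As `D` is nonempty, this forces
`w ∈ D`. -/
def IsRooted (G : SimpleGraph V) (r : ℕ) (D : Finset V) : Prop :=
  D.Nonempty ∧ ∃ (w : V) (rank : V → ℕ),
    ∀ x ∈ D, rank x ≤ r ∧ (x = w ∨ ∃ y ∈ D, G.Adj y x ∧ rank y < rank x)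

namespace IsRooted

variable {r r' : ℕ} {D : Finset V}

lemma mono (h : IsRooted G r D) (hr : r ≤ r') : IsRooted G r' D := by
  obtain ⟨hne, w, rank, hrank⟩ := h
  exact ⟨hne, w, rank, fun x hx ↦ ⟨(hrank x hx).1.trans hr, (hrank x hx).2⟩⟩

lemma singleton (w : V) : IsRooted G 0 {w} :=
  ⟨singleton_nonempty w, w, 0, fun _ hx ↦ ⟨le_rfl, .inl (mem_singleton.1 hx)⟩⟩

lemma union_neighborsIn (h : IsRooted G r D) (Y : Finset V) :
    IsRooted G (r + 1) (D ∪ neighborsIn G D Y) := by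
  obtain ⟨hne, w, rank, hrank⟩ := h
  refine ⟨hne.mono subset_union_left, w, fun x ↦ if x ∈ D then rank x else r + 1, fun x hx ↦ ?_⟩
  by_cases hxD : x ∈ D
  · simp only [hxD, if_true]
    refine ⟨(hrank x hxD).1.trans r.le_succ, (hrank x hxD).2.imp_right ?_⟩
    rintro ⟨y, hy, hyx, hlt⟩
    exact ⟨y, mem_union_left _ hy, hyx, by simpa [hy] using hlt⟩
  · obtain ⟨-, y, hy, hyx⟩ := mem_neighborsIn.1 ((mem_union.1 hx).resolve_left hxD)
    simp only [hxD, if_false]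
    exact ⟨le_rfl, .inr ⟨y, mem_union_left _ hy, hyx,
      by simpa [hy] using Nat.lt_succ_of_le (hrank y hy).1⟩⟩

lemma exists_erase (h : IsRooted G r D) :
    ∃ x ∈ D, D.erase x = ∅ ∨ IsRooted G r (D.erase x) := by
  obtain ⟨hne, w, rank, hrank⟩ := h
  -- A vertex of maximum rank is nobody's parent.
  obtain ⟨x, hx, hmax⟩ := exists_max_image D rank hne
  refine ⟨x, hx, (D.erase x).eq_empty_or_nonempty.imp_right fun hne' ↦
    ⟨hne', w, rank, fun z hz ↦ ?_⟩⟩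
  have hzD := mem_of_mem_erase hz
  refine ⟨(hrank z hzD).1, (hrank z hzD).2.imp_right ?_⟩
  rintro ⟨y, hy, hyz, hlt⟩
  refine ⟨y, mem_erase.2 ⟨?_, hy⟩, hyz, hlt⟩
  rintro rfl
  exact (hmax z hzD).not_gt hlt

end IsRooted

lemma le_of_mul_le_of_one_le (hα : 0 < α) (ht : 1 ≤ t) (hαβ : α * t ≤ β) : α ≤ β :=
  (le_mul_of_one_le_right hα.le ht).trans hαβ

lemma IsCoherent.exists_isRooted_of_le_pow (h : IsCoherent G α β) (hα : 0 < α) (ht : 1 ≤ t)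
    (hαβ : α * t ≤ β) {r : ℕ} (hr : α ≤ t ^ r) {W : Finset V} (hW : 5 * β ≤ #W) :
    ∃ D ⊆ W, IsRooted G r D ∧ α ≤ #D := by
  have hαβ' := le_of_mul_le_of_one_le hα ht hαβ
  obtain ⟨K, -, hK, hexp⟩ := h.exists_expanding_core hα (zero_le_one.trans ht) W (by linarith)
  obtain ⟨w, hw⟩ : (W \ K).Nonempty := by
    have := card_sub_card_le_card_sdiff W K
    have : (0 : ℝ) < #(W \ K) := by linarith
    exact card_pos.1 (by exact_mod_cast this)
  have grow (i : ℕ) : ∃ D ⊆ W \ K, IsRooted G i D ∧ (α ≤ #D ∨ t ^ i ≤ #D) := by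
    induction i with
    | zero => exact ⟨{w}, by simpa using hw, .singleton w, .inr (by simp)⟩
    | succ i ih =>
      obtain ⟨D, hD, hroot, hcard⟩ := ih
      by_cases hDα : α ≤ #D
      · exact ⟨D, hD, hroot.mono i.le_succ, .inl hDα⟩
      have hDexp := hexp D hD (not_le.1 hDα).le
      refine ⟨D ∪ neighborsIn G D (W \ (K ∪ D)), union_subset hD ((neighborsIn_subset _ _).trans
        (sdiff_subset_sdiff Subset.rfl subset_union_left)), hroot.union_neighborsIn _, .inr ?_⟩
      calc t ^ (i + 1) = t * t ^ i := pow_succ' t i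
        _ ≤ t * #D := mul_le_mul_of_nonneg_left (hcard.resolve_left hDα) (by linarith)
        _ ≤ #(neighborsIn G D (W \ (K ∪ D))) := hDexp
        _ ≤ #(D ∪ neighborsIn G D (W \ (K ∪ D))) := by
          exact_mod_cast card_le_card subset_union_right
  obtain ⟨D, hD, hroot, hcard⟩ := grow r
  exact ⟨D, hD.trans sdiff_subset, hroot, hcard.elim id hr.trans⟩

lemma IsCoherent.exists_isRooted_covering (h : IsCoherent G α β) (hα : 0 < α) (ht : 1 ≤ t)
    (hαβ : α * t ≤ β) {r : ℕ} (hr : α ≤ t ^ r) {W : Finset V} (hW : 5 * β ≤ #W)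
    {ι : Type*} {J : Finset ι} (hJ : J.Nonempty) {B : ι → Finset V}
    (hdisj : ∀ j ∈ J, Disjoint W (B j)) (hB : ∀ j ∈ J, 5 * β ≤ #(B j))
    (hdeg : ∀ v, ∀ j ∈ J, (degreeIn G v (B j) : ℝ) ≤ β) :
    ∃ D ⊆ W, IsRooted G r D ∧ (∃ j ∈ J, (#(B j) : ℝ) ≤ 4 * #(neighborsIn G D (B j))) ∧
      ∀ j ∈ J, 2 * (#(neighborsIn G D (B j)) : ℝ) ≤ #(B j) := by
  have hβ : 0 < β := hα.trans_le (le_of_mul_le_of_one_le hα ht hαβ)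
  -- For a minimal such `D`, erasing a suitable vertex leaves less than a quarter of every block
  -- covered, and that vertex covers at most `β` more.
  let covering : Finset (Finset V) := {D ∈ W.powerset |
    IsRooted G r D ∧ ∃ j ∈ J, (#(B j) : ℝ) ≤ 4 * #(neighborsIn G D (B j))}
  have hcovering : covering.Nonempty := by
    obtain ⟨D, hDW, hroot, hDα⟩ := h.exists_isRooted_of_le_pow hα ht hαβ hr hW
    obtain ⟨j, hj⟩ := hJ
    refine ⟨D, mem_filter.2 ⟨mem_powerset.2 hDW, hroot, j, hj, ?_⟩⟩
    linarith [h.sub_lt_card_neighborsIn ((hdisj j hj).mono_left hDW) hDα, hB j hj]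
  obtain ⟨D, hD, hmin⟩ := exists_min_image covering card hcovering
  simp only [covering, mem_filter, mem_powerset] at hD hmin
  obtain ⟨hDW, hroot, hcov⟩ := hD
  refine ⟨D, hDW, hroot, hcov, fun j hj ↦ ?_⟩
  obtain ⟨x, hx, herase⟩ := hroot.exists_erase
  have hquarter : 4 * (#(neighborsIn G (D.erase x) (B j)) : ℝ) ≤ #(B j) := by
    rcases herase with hempty | hroot'
    · simp [hempty]
    · by_contra! hlt
      exact (hmin _ ⟨(erase_subset _ _).trans hDW, hroot', j, hj, hlt.le⟩).not_gt
        (card_erase_lt_of_mem hx)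
  linarith [card_neighborsIn_le_erase_add (G := G) D (B j) x, hdeg x j hj, hB j hj]

end

/-! ### Rooted covers -/

section

variable {V : Type*} {G : SimpleGraph V} {α β t σ : ℝ} {r : ℕ} {U : Finset V}

/-- A family `𝒟` of pairwise anticomplete rooted subsets of `U`, each disjoint from `W` and
covering it, that is, every vertex of `W` has a neighbor in every member of `𝒟`. -/
structure IsRootedCover (G : SimpleGraph V) (r : ℕ) (U W : Finset V) (𝒟 : Finset (Finset V)) :
    Prop where
  rooted : ∀ D ∈ 𝒟, IsRooted G r D
  subset : ∀ D ∈ 𝒟, D ⊆ U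
  disjoint : ∀ D ∈ 𝒟, Disjoint D W
  covers : ∀ D ∈ 𝒟, ∀ z ∈ W, ∃ x ∈ D, G.Adj x z
  anticomplete : (𝒟 : Set (Finset V)).Pairwise (IsAnticompletePair G)

namespace IsRootedCover

variable {W W' D : Finset V} {𝒟 𝒟' : Finset (Finset V)}

lemma empty (W : Finset V) : IsRootedCover G r U W ∅ := by
  constructor <;> simp

lemma mono (h : IsRootedCover G r U W 𝒟) (hW : W' ⊆ W) (h𝒟 : 𝒟' ⊆ 𝒟) :
    IsRootedCover G r U W' 𝒟' where
  rooted D hD := h.rooted D (h𝒟 hD)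
  subset D hD := h.subset D (h𝒟 hD)
  disjoint D hD := (h.disjoint D (h𝒟 hD)).mono_right hW
  covers D hD z hz := h.covers D (h𝒟 hD) z (hW hz)
  anticomplete := h.anticomplete.mono (coe_subset.2 h𝒟)

lemma insert (h : IsRootedCover G r U W 𝒟) (hroot : IsRooted G r D) (hDU : D ⊆ U)
    (hdisj : Disjoint D W) (hcov : ∀ z ∈ W, ∃ x ∈ D, G.Adj x z)
    (hanti : ∀ D' ∈ 𝒟, IsAnticompletePair G D D') :
    IsRootedCover G r U W (insert D 𝒟) where
  rooted := forall_mem_insert _ _ _ |>.2 ⟨hroot, h.rooted⟩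
  subset := forall_mem_insert _ _ _ |>.2 ⟨hDU, h.subset⟩
  disjoint := forall_mem_insert _ _ _ |>.2 ⟨hdisj, h.disjoint⟩
  covers := forall_mem_insert _ _ _ |>.2 ⟨hcov, h.covers⟩
  anticomplete := by
    rw [coe_insert]
    exact h.anticomplete.insert fun D' hD' _ ↦ ⟨hanti D' hD', (hanti D' hD').symm⟩

end IsRootedCover

section Blocks

variable {ι : Type*} {I : Finset ι} {W : ι → Finset V} {S : ι → Finset (Finset V)}

/-- Disjoint blocks `W i ⊆ U` of size at least `σ`, each with a rooted cover `S i` whose members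
are anticomplete to all other blocks. -/
structure IsBlockSystem (G : SimpleGraph V) (r : ℕ) (U : Finset V) (σ : ℝ) (I : Finset ι)
    (W : ι → Finset V) (S : ι → Finset (Finset V)) : Prop where
  le_card : ∀ i ∈ I, σ ≤ #(W i)
  subset : ∀ i ∈ I, W i ⊆ U
  disjoint : (I : Set ι).PairwiseDisjoint W
  cover : ∀ i ∈ I, IsRootedCover G r U (W i) (S i)
  anticomplete : ∀ i ∈ I, ∀ D ∈ S i, ∀ j ∈ I, j ≠ i → IsAnticompletePair G D (W j)

/-- The blocks after a set `D` has been chosen to cover block `j`: that block is cut down to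
the part covered by `D`, all others to the part anticomplete to `D`. -/
noncomputable def cutBlocks (G : SimpleGraph V) (W : ι → Finset V) (D : Finset V) (j : ι) :
    ι → Finset V :=
  Function.update (fun i ↦ W i \ neighborsIn G D (W i)) j (neighborsIn G D (W j))

lemma cutBlocks_self (W : ι → Finset V) (D : Finset V) (j : ι) :
    cutBlocks G W D j j = neighborsIn G D (W j) :=
  Function.update_self ..

lemma cutBlocks_of_ne (W : ι → Finset V) (D : Finset V) {i j : ι} (hij : i ≠ j) :
    cutBlocks G W D j i = W i \ neighborsIn G D (W i) :=
  Function.update_of_ne hij ..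

lemma cutBlocks_subset (W : ι → Finset V) (D : Finset V) (i j : ι) :
    cutBlocks G W D j i ⊆ W i := by
  by_cases hij : i = j
  · subst hij
    exact cutBlocks_self (G := G) W D i ▸ neighborsIn_subset _ _
  · exact cutBlocks_of_ne (G := G) W D hij ▸ sdiff_subset

namespace IsBlockSystem

variable {i₀ j : ι} {D : Finset V}

lemma anticomplete_of_subset (hb : IsBlockSystem G r U σ I W S) (hi₀ : i₀ ∈ I) (hDW : D ⊆ W i₀)
    (hj : j ∈ I.erase i₀) {D' : Finset V} (hD' : D' ∈ S j) : IsAnticompletePair G D D' :=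
  ((hb.anticomplete j (mem_of_mem_erase hj) D' hD' i₀ hi₀ (ne_of_mem_erase hj).symm).mono
    Subset.rfl hDW).symm

lemma cut (hb : IsBlockSystem G r U σ I W S) (hi₀ : i₀ ∈ I) (hDW : D ⊆ W i₀)
    (hroot : IsRooted G r D) (hj : j ∈ I.erase i₀)
    (hcov : (#(W j) : ℝ) ≤ 4 * #(neighborsIn G D (W j)))
    (hhalf : ∀ i ∈ I.erase i₀, 2 * (#(neighborsIn G D (W i)) : ℝ) ≤ #(W i)) :
    IsBlockSystem G r U (σ / 4) (I.erase i₀) (cutBlocks G W D j)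
      (Function.update S j (insert D (S j))) := by
  have hsub (i : ι) : cutBlocks G W D j i ⊆ W i := cutBlocks_subset W D i j
  have hDdisj {i : ι} (hi : i ∈ I.erase i₀) : Disjoint D (W i) :=
    (hb.disjoint hi₀ (mem_of_mem_erase hi) (ne_of_mem_erase hi).symm).mono_left hDW
  refine ⟨fun i hi ↦ ?_, fun i hi ↦ (hsub i).trans (hb.subset i (mem_of_mem_erase hi)),
    fun i hi i' hi' hne ↦ ?_, fun i hi ↦ ?_, fun i hi D' hD' l hl hli ↦ ?_⟩
  · have hσ := hb.le_card i (mem_of_mem_erase hi)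
    by_cases hij : i = j
    · subst hij
      rw [cutBlocks_self]
      linarith
    · rw [cutBlocks_of_ne W D hij]
      linarith [hhalf i hi, card_sub_card_le_card_sdiff (W i) (neighborsIn G D (W i))]
  · exact (hb.disjoint (mem_of_mem_erase hi) (mem_of_mem_erase hi') hne).mono (hsub i) (hsub i')
  · have hold := (hb.cover i (mem_of_mem_erase hi)).mono (hsub i) Subset.rfl
    by_cases hij : i = j
    · subst hij
      rw [Function.update_self]
      refine hold.insert hroot (hDW.trans (hb.subset i₀ hi₀)) ((hDdisj hi).mono_right (hsub i))
        (fun z hz ↦ ?_) fun D' hD' ↦ hb.anticomplete_of_subset hi₀ hDW hi hD'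
      exact (mem_neighborsIn.1 (cutBlocks_self (G := G) W D i ▸ hz)).2
    · rwa [Function.update_of_ne hij]
  · have hold : D' ∈ S i → IsAnticompletePair G D' (cutBlocks G W D j l) := fun h ↦
      (hb.anticomplete i (mem_of_mem_erase hi) D' h l (mem_of_mem_erase hl) hli).mono
        Subset.rfl (hsub l)
    by_cases hij : i = j
    · subst hij
      rw [Function.update_self, mem_insert] at hD'
      rcases hD' with rfl | hD'
      · exact cutBlocks_of_ne (G := G) W D' hli ▸ .sdiff_neighborsIn (hDdisj hl)
      · exact hold hD'
    · exact hold (by rwa [Function.update_of_ne hij] at hD')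

end IsBlockSystem

lemma sum_two_pow_card_le_sum_update {i₀ j : ι} {D : Finset V} (hi₀ : i₀ ∈ I)
    (hmin : ∀ i ∈ I, #(S i₀) ≤ #(S i)) (hj : j ∈ I.erase i₀) (hD : D ∉ S j) :
    ∑ i ∈ I, 2 ^ #(S i) ≤
      ∑ i ∈ I.erase i₀, 2 ^ #(Function.update S j (insert D (S j)) i) := by
  have hrest : ∑ i ∈ (I.erase i₀).erase j, 2 ^ #(Function.update S j (insert D (S j)) i) =
      ∑ i ∈ (I.erase i₀).erase j, 2 ^ #(S i) :=
    sum_congr rfl fun i hi ↦ by rw [Function.update_of_ne (ne_of_mem_erase hi)]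
  have hle : 2 ^ #(S i₀) ≤ 2 ^ #(S j) :=
    Nat.pow_le_pow_right two_pos (hmin j (mem_of_mem_erase hj))
  rw [← add_sum_erase I _ hi₀, ← add_sum_erase _ _ hj,
    ← add_sum_erase _ (fun i ↦ 2 ^ #(Function.update S j _ i)) hj, hrest, Function.update_self,
    card_insert_of_notMem hD, pow_succ]
  omega

lemma IsBlockSystem.exists_erase (h : IsCoherent G α β) (hα : 0 < α) (ht : 1 ≤ t)
    (hαβ : α * t ≤ β) (hr : α ≤ t ^ r) (hdeg : ∀ v, (degreeIn G v U : ℝ) ≤ β)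
    (hb : IsBlockSystem G r U σ I W S) (hI : 2 ≤ #I) (hσ : 5 * β ≤ σ) :
    ∃ i₀ ∈ I, ∃ W' S', IsBlockSystem G r U (σ / 4) (I.erase i₀) W' S' ∧
      ∑ i ∈ I, 2 ^ #(S i) ≤ ∑ i ∈ I.erase i₀, 2 ^ #(S' i) := by
  -- Removing the block with the smallest family while enlarging another one keeps the potential
  -- `∑ 2 ^ #(S i)` from decreasing.
  obtain ⟨i₀, hi₀, hmin⟩ := exists_min_image I (fun i ↦ #(S i)) (card_pos.1 (by omega))
  have hne : (I.erase i₀).Nonempty := card_pos.1 (by rw [card_erase_of_mem hi₀]; omega)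
  have hlarge (i : ι) (hi : i ∈ I.erase i₀) : 5 * β ≤ #(W i) :=
    hσ.trans (hb.le_card i (mem_of_mem_erase hi))
  have hdeg' (v : V) (i : ι) (hi : i ∈ I.erase i₀) : (degreeIn G v (W i) : ℝ) ≤ β :=
    (Nat.cast_le.2 (degreeIn_mono v (hb.subset i (mem_of_mem_erase hi)))).trans (hdeg v)
  obtain ⟨D, hDW, hroot, ⟨j, hj, hcov⟩, hhalf⟩ := h.exists_isRooted_covering hα ht hαβ hr
    (hσ.trans (hb.le_card i₀ hi₀)) hne
    (fun j hj ↦ hb.disjoint hi₀ (mem_of_mem_erase hj) (ne_of_mem_erase hj).symm) hlarge hdeg'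
  have hD : D ∉ S j := fun hD ↦ hroot.1.ne_empty <| disjoint_self_iff_empty D |>.1
    (hb.anticomplete_of_subset hi₀ hDW hj hD).1
  exact ⟨i₀, hi₀, _, _, hb.cut hi₀ hDW hroot hj hcov hhalf,
    sum_two_pow_card_le_sum_update hi₀ hmin hj hD⟩

lemma IsBlockSystem.exists_card_eq_two (h : IsCoherent G α β) (hα : 0 < α) (ht : 1 ≤ t)
    (hαβ : α * t ≤ β) (hr : α ≤ t ^ r) (hdeg : ∀ v, (degreeIn G v U : ℝ) ≤ β) {m : ℕ}
    (hb : IsBlockSystem G r U σ I W S) (hI : #I = m + 2) (hσ : 5 * β * 4 ^ m ≤ σ) :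
    ∃ I' : Finset ι, #I' = 2 ∧ ∃ W' S', IsBlockSystem G r U (σ / 4 ^ m) I' W' S' ∧
      ∑ i ∈ I, 2 ^ #(S i) ≤ ∑ i ∈ I', 2 ^ #(S' i) := by
  have hβ : 0 < β := hα.trans_le (le_of_mul_le_of_one_le hα ht hαβ)
  induction m generalizing I W S σ with
  | zero => exact ⟨I, hI, W, S, by simpa using hb, le_rfl⟩
  | succ m ih =>
    have hone : (1 : ℝ) ≤ 4 ^ (m + 1) := one_le_pow₀ (by norm_num)
    obtain ⟨i₀, hi₀, W₁, S₁, hb₁, hsum₁⟩ :=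
      hb.exists_erase h hα ht hαβ hr hdeg (by omega) (le_trans (by nlinarith) hσ)
    obtain ⟨I', hI', W', S', hb', hsum'⟩ := ih hb₁ (by rw [card_erase_of_mem hi₀]; omega)
      (by rw [le_div_iff₀ (by norm_num), mul_assoc, ← pow_succ]; exact hσ)
    refine ⟨I', hI', W', S', ?_, hsum₁.trans hsum'⟩
    rwa [div_div, ← pow_succ'] at hb'

end Blocks

lemma exists_pairwise_disjoint_subsets_card_eq (q m : ℕ) (U : Finset V) (hU : m * q ≤ #U) :
    ∃ W : Fin m → Finset V, (∀ i, W i ⊆ U ∧ #(W i) = q) ∧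
      Pairwise fun i j ↦ Disjoint (W i) (W j) := by
  induction m generalizing U with
  | zero => exact ⟨Fin.elim0, Fin.rec0, Fin.rec0⟩
  | succ m ih =>
    obtain ⟨T, hTU, hT⟩ := exists_subset_card_eq (show q ≤ #U by nlinarith)
    obtain ⟨W, hW, hdisj⟩ := ih (U \ T) (by
      rw [card_sdiff_of_subset hTU, hT]; rw [Nat.succ_mul] at hU; omega)
    have hTW (i : Fin m) : Disjoint T (W i) := disjoint_sdiff.mono_right (hW i).1
    refine ⟨Fin.cons T W, Fin.cases ⟨hTU, hT⟩ fun i ↦ ⟨(hW i).1.trans sdiff_subset, (hW i).2⟩, ?_⟩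
    refine Fin.cases (Fin.cases (absurd rfl) fun j _ ↦ hTW j) fun i ↦
      Fin.cases (fun _ ↦ (hTW i).symm) fun j hij ↦ hdisj fun h ↦ hij (congrArg _ h)

lemma IsCoherent.exists_isRootedCover (h : IsCoherent G α β) (hα : 0 < α) (ht : 1 ≤ t)
    (hαβ : α * t ≤ β) (hr : α ≤ t ^ r) (hdeg : ∀ v, (degreeIn G v U : ℝ) ≤ β) (N : ℕ)
    {q : ℕ} (hU : 2 ^ (N + 1) * q ≤ #U) (hq : 5 * β * 4 ^ 2 ^ (N + 1) ≤ q) :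
    ∃ (W R : Finset V) (𝒟 : Finset (Finset V)), W ⊆ U ∧ R ⊆ U ∧ Disjoint W R ∧
      (q : ℝ) / 4 ^ 2 ^ (N + 1) ≤ #W ∧ (q : ℝ) / 4 ^ 2 ^ (N + 1) ≤ #R ∧ #𝒟 = N ∧
      IsRootedCover G r U W 𝒟 ∧ ∀ D ∈ 𝒟, IsAnticompletePair G D R := by
  have hβ : 0 < β := hα.trans_le (le_of_mul_le_of_one_le hα ht hαβ)
  obtain ⟨W₀, hW₀, hdisj₀⟩ := exists_pairwise_disjoint_subsets_card_eq q (2 ^ (N + 1)) U hU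
  have hb₀ : IsBlockSystem G r U q (univ : Finset (Fin (2 ^ (N + 1)))) W₀ fun _ ↦ ∅ :=
    ⟨fun i _ ↦ by rw [(hW₀ i).2], fun i _ ↦ (hW₀ i).1, hdisj₀.set_pairwise _,
      fun i _ ↦ .empty _, by simp⟩
  obtain ⟨m, hm⟩ : ∃ m, 2 ^ (N + 1) = m + 2 :=
    Nat.exists_eq_add_of_le' (Nat.le_self_pow N.succ_ne_zero 2)
  have h4m : (4 : ℝ) ^ m ≤ 4 ^ 2 ^ (N + 1) := pow_le_pow_right₀ (by norm_num) (by omega)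
  obtain ⟨I, hI, W, S, hb, hsum⟩ := hb₀.exists_card_eq_two h hα ht hαβ hr hdeg (m := m)
    (by simp [hm]) ((mul_le_mul_of_nonneg_left h4m (by positivity)).trans hq)
  have hσ : (q : ℝ) / 4 ^ 2 ^ (N + 1) ≤ q / 4 ^ m :=
    div_le_div_of_nonneg_left (by positivity) (by positivity) h4m
  -- By the potential `∑ 2 ^ #(S i) ≥ 2 ^ (N + 1)`, one of the two families has `N` members.
  obtain ⟨a, ha, hN⟩ : ∃ a ∈ I, N ≤ #(S a) := by
    by_contra! hlt
    have := sum_lt_sum_of_nonempty (card_pos.1 (by omega))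
      fun i hi ↦ Nat.pow_lt_pow_right one_lt_two (hlt i hi)
    simp only [card_empty, pow_zero, sum_const, card_univ, Fintype.card_fin, smul_eq_mul, mul_one,
      hI, ← pow_succ'] at hsum this
    omega
  obtain ⟨b, hbI, hne⟩ := exists_mem_ne (by omega : 1 < #I) a
  obtain ⟨𝒟, h𝒟, hcard⟩ := exists_subset_card_eq hN
  exact ⟨W a, W b, 𝒟, hb.subset a ha, hb.subset b hbI, hb.disjoint ha hbI hne.symm,
    hσ.trans (hb.le_card a ha), hσ.trans (hb.le_card b hbI), hcard,
    (hb.cover a ha).mono Subset.rfl h𝒟, fun D hD ↦ hb.anticomplete a ha D (h𝒟 hD) b hbI hne⟩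

end

/-! ### Near-regular sets and induced paths -/

section

variable {V : Type*} {G : SimpleGraph V} {α β : ℝ}

/-- All degrees within `U` are at most `Δ`, and every subset of `U` of size at least `ζ` has a
vertex whose degree within that subset is at least `Δ / s`. -/
structure IsNearRegular (G : SimpleGraph V) (U : Finset V) (Δ s ζ : ℝ) : Prop where
  degreeIn_le : ∀ u ∈ U, (degreeIn G u U : ℝ) ≤ Δ
  exists_le_degreeIn : ∀ Y ⊆ U, ζ ≤ #Y → ∃ y ∈ Y, Δ ≤ s * degreeIn G y Y

lemma IsCoherent.exists_one_le_degreeIn (h : IsCoherent G α β) (hα : 0 < α) (hαβ : α ≤ β)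
    (hβ : 1 ≤ β) {Y : Finset V} (hY : 3 * β ≤ #Y) : ∃ y ∈ Y, 1 ≤ degreeIn G y Y := by
  by_contra! hlt
  have hceil : (⌈α⌉₊ : ℝ) < α + 1 := Nat.ceil_lt_add_one hα.le
  obtain ⟨A, hAY, hA⟩ := exists_subset_card_eq (n := ⌈α⌉₊) (s := Y) (Nat.cast_le (α := ℝ).1
    (by linarith))
  have hanti : IsAnticompletePair G A (Y \ A) := ⟨disjoint_sdiff, fun a ha b hb hab ↦
    (hlt a (hAY ha)).not_ge (card_pos.2 ⟨b, mem_filter.2 ⟨(mem_sdiff.1 hb).1, hab⟩⟩)⟩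
  have hsmall := h.card_lt hanti (by rw [hA]; exact Nat.le_ceil α)
  have hlarge := card_sub_card_le_card_sdiff Y A
  rw [hA] at hlarge
  linarith

lemma IsCoherent.exists_isNearRegular (h : IsCoherent G α β) (hα : 0 < α) (hαβ : α ≤ β)
    (hβ : 1 ≤ β) {s κ d : ℝ} (hs : 1 ≤ s) (hκ : 0 < κ) (hκ1 : κ ≤ 1) (I : ℕ) (hI : d < s ^ I)
    {U₀ : Finset V} (hdeg : ∀ u ∈ U₀, (degreeIn G u U₀ : ℝ) ≤ d) (hU₀ : 3 * β ≤ κ ^ I * #U₀) :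
    ∃ U ⊆ U₀, ∃ Δ : ℝ, κ ^ I * #U₀ ≤ #U ∧ 1 ≤ Δ ∧ Δ ≤ d ∧ IsNearRegular G U Δ s (κ * #U) := by
  have hpow (i : ℕ) (U : Finset V) : κ ^ i * #U ≤ #U :=
    mul_le_of_le_one_left (Nat.cast_nonneg _) (pow_le_one₀ hκ.le hκ1)
  obtain ⟨u, hu, hdegu⟩ := h.exists_one_le_degreeIn hα hαβ hβ (hU₀.trans (hpow I U₀))
  have hd : 1 ≤ d := le_trans (by exact_mod_cast hdegu) (hdeg u hu)
  -- While regularity fails, pass to a subset of proportion `κ` in which all degrees drop by a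
  -- factor `s`. This happens fewer than `I` times, as a large set spans an edge.
  induction I generalizing U₀ d u with
  | zero => exact absurd hI (by simpa using hd)
  | succ I ih =>
    by_cases hreg : ∀ Y ⊆ U₀, κ * #U₀ ≤ #Y → ∃ y ∈ Y, d ≤ s * degreeIn G y Y
    · exact ⟨U₀, Subset.rfl, d, hpow _ U₀, hd, le_rfl, hdeg, hreg⟩
    push Not at hreg
    obtain ⟨Y, hY, hYcard, hYdeg⟩ := hreg
    have hspos : 0 < s := one_pos.trans_le hs
    have hdegY (y : V) (hy : y ∈ Y) : (degreeIn G y Y : ℝ) ≤ d / s :=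
      (le_div_iff₀' hspos).2 (hYdeg y hy).le
    have hle : κ ^ (I + 1) * #U₀ ≤ κ ^ I * #Y := by
      rw [pow_succ, mul_assoc]
      exact mul_le_mul_of_nonneg_left hYcard (by positivity)
    obtain ⟨y, hy, hone⟩ := h.exists_one_le_degreeIn hα hαβ hβ (hU₀.trans (hle.trans (hpow I Y)))
    obtain ⟨U, hU, Δ, hcard, hΔ, hΔd, hUreg⟩ := ih ((div_lt_iff₀ hspos).2 (by rwa [← pow_succ]))
      hdegY (hU₀.trans hle) y hy hone (le_trans (by exact_mod_cast hone) (hdegY y hy))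
    exact ⟨U, hU.trans hY, Δ, hle.trans hcard, hΔ,
      hΔd.trans (div_le_self (zero_le_one.trans hd) hs), hUreg⟩

/-- `p 0, …, p L` is an induced path. Later values of `p` are irrelevant. -/
structure IsInducedPath (G : SimpleGraph V) (p : ℕ → V) (L : ℕ) : Prop where
  injOn : Set.InjOn p (Set.Iic L)
  adj_iff : ∀ i j, i < j → j ≤ L → (G.Adj (p i) (p j) ↔ j = i + 1)

/-- The sequence `p 0, …, p a = q 0, q 1, …`. -/
def gluePath (p q : ℕ → V) (a i : ℕ) : V := if i ≤ a then p i else q (i - a)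

section Glue

variable {p q : ℕ → V} {a i : ℕ}

lemma gluePath_of_le (hi : i ≤ a) : gluePath p q a i = p i := if_pos hi

lemma gluePath_of_ge (h : p a = q 0) (hi : a ≤ i) : gluePath p q a i = q (i - a) := by
  obtain rfl | hlt := hi.eq_or_lt
  · simpa [gluePath] using h
  · exact if_neg hlt.not_ge

end Glue

namespace IsInducedPath

variable {p q : ℕ → V} {L L' a b : ℕ}

lemma of_lt (hne : ∀ i j, i < j → j ≤ L → p i ≠ p j)
    (hadj : ∀ i j, i < j → j ≤ L → (G.Adj (p i) (p j) ↔ j = i + 1)) : IsInducedPath G p L where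
  injOn i hi j hj hij := by
    rcases lt_trichotomy i j with hlt | heq | hgt
    · exact absurd hij (hne i j hlt hj)
    · exact heq
    · exact absurd hij.symm (hne j i hgt hi)
  adj_iff := hadj

lemma zero (p : ℕ → V) : IsInducedPath G p 0 := of_lt (by omega) (by omega)

lemma ne (h : IsInducedPath G p L) {i j : ℕ} (hi : i ≤ L) (hj : j ≤ L) (hij : i ≠ j) :
    p i ≠ p j :=
  h.injOn.ne hi hj hij

lemma reverse (h : IsInducedPath G p L) : IsInducedPath G (fun i ↦ p (L - i)) L :=
  of_lt (fun i j hij hj ↦ h.ne (by omega) (by omega) (by omega)) fun i j hij hj ↦ by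
    rw [G.adj_comm, h.adj_iff (L - j) (L - i) (by omega) (Nat.sub_le L i)]
    omega

lemma shift (h : IsInducedPath G p (a + L)) : IsInducedPath G (fun i ↦ p (a + i)) L :=
  of_lt (fun i j hij hj ↦ h.ne (by omega) (by omega) (by omega)) fun i j hij hj ↦ by
    rw [h.adj_iff (a + i) (a + j) (by omega) (by omega)]
    omega

lemma take (h : IsInducedPath G p L) (hL : L' ≤ L) : IsInducedPath G p L' :=
  ⟨h.injOn.mono (Set.Iic_subset_Iic.2 hL), fun i j hij hj ↦ h.adj_iff i j hij (hj.trans hL)⟩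

lemma glue (hp : IsInducedPath G p a) (hq : IsInducedPath G q b) (hpq : p a = q 0)
    (hfar : ∀ i j, i < a → 0 < j → j ≤ b → Gᶜ.Adj (p i) (q j)) :
    IsInducedPath G (gluePath p q a) (a + b) := by
  refine of_lt (fun i j hij hj ↦ ?_) fun i j hij hj ↦ ?_
  · obtain hja | haj := le_or_gt j a
    · rw [gluePath_of_le (hij.le.trans hja), gluePath_of_le hja]
      exact hp.ne (by omega) hja hij.ne
    rw [gluePath_of_ge hpq haj.le]
    obtain hia | hai := lt_or_ge i a
    · rw [gluePath_of_le hia.le]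
      exact (hfar i (j - a) hia (by omega) (by omega)).ne
    · rw [gluePath_of_ge hpq hai]
      exact hq.ne (by omega) (by omega) (by omega)
  · obtain hja | haj := le_or_gt j a
    · rw [gluePath_of_le (hij.le.trans hja), gluePath_of_le hja]
      exact hp.adj_iff i j hij hja
    rw [gluePath_of_ge hpq haj.le]
    obtain hia | hai := lt_or_ge i a
    · rw [gluePath_of_le hia.le]
      exact iff_of_false
        ((G.compl_adj _ _).1 (hfar i (j - a) hia (by omega) (by omega))).2 (by omega)
    · rw [gluePath_of_ge hpq hai, hq.adj_iff _ _ (by omega) (by omega)]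
      omega

lemma exists_snoc (h : IsInducedPath G p L) {v : V} (hne : ∀ i ≤ L, p i ≠ v)
    (hadj : G.Adj (p L) v) (hnadj : ∀ i < L, ¬ G.Adj (p i) v) :
    ∃ q, IsInducedPath G q (L + 1) ∧ (∀ i ≤ L, q i = p i) ∧ q (L + 1) = v := by
  let edge : ℕ → V := fun i ↦ if i = 0 then p L else v
  have hedge : IsInducedPath G edge 1 := of_lt
    (fun i j hij hj ↦ by
      obtain ⟨rfl, rfl⟩ : i = 0 ∧ j = 1 := by omega
      exact hadj.ne)
    (fun i j hij hj ↦ by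
      obtain ⟨rfl, rfl⟩ : i = 0 ∧ j = 1 := by omega
      simpa [edge] using hadj)
  have hv {j : ℕ} (hj : 0 < j) : edge j = v := if_neg hj.ne'
  refine ⟨gluePath p edge L, h.glue hedge rfl fun i j hi hj _ ↦ ?_, fun i hi ↦ gluePath_of_le hi,
    by rw [gluePath_of_ge (p := p) (a := L) rfl L.le_succ]; simp [edge]⟩
  rw [hv hj]
  exact (G.compl_adj _ _).2 ⟨hne i hi.le, hnadj i hi⟩

end IsInducedPath

end

/-! ### Linking -/

section

variable {V : Type*} {G : SimpleGraph V} {α β : ℝ} {A B R S L U P Rest Rest' : Finset V} {j : ℕ}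
  {p : ℕ → V}

lemma mul_card_filter_lt_le {ι κ : Type*} {L : Finset ι} {B : Finset κ} {N : ι → κ → Prop}
    {c d n : ℝ} (hN : ∀ r ∈ L, (#{b ∈ B | N r b} : ℝ) ≤ c) (hd : 0 < d) (hn : 0 ≤ n)
    (h : n * (c * #L) ≤ d * #B) : n * (#{b ∈ B | d < #{r ∈ L | N r b}} : ℝ) ≤ #B := by
  have hcount : ∑ r ∈ L, (#{b ∈ B | N r b} : ℝ) = ∑ b ∈ B, (#{r ∈ L | N r b} : ℝ) := by
    exact_mod_cast sum_card_bipartiteAbove_eq_sum_card_bipartiteBelow N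
  have hmarkov : d * #{b ∈ B | d < #{r ∈ L | N r b}} ≤ c * #L :=
    calc d * #{b ∈ B | d < #{r ∈ L | N r b}}
        = ∑ b ∈ B with d < #{r ∈ L | N r b}, d := by rw [sum_const, nsmul_eq_mul, mul_comm]
      _ ≤ ∑ b ∈ B with d < #{r ∈ L | N r b}, (#{r ∈ L | N r b} : ℝ) :=
        sum_le_sum fun b hb ↦ (mem_filter.1 hb).2.le
      _ ≤ ∑ b ∈ B, (#{r ∈ L | N r b} : ℝ) :=
        sum_le_sum_of_subset_of_nonneg (filter_subset _ _) fun _ _ _ ↦ by positivity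
      _ ≤ ∑ _r ∈ L, c := hcount ▸ sum_le_sum hN
      _ = c * #L := by rw [sum_const, nsmul_eq_mul, mul_comm]
  refine le_of_mul_le_mul_left ?_ hd
  rw [mul_left_comm]
  exact (mul_le_mul_of_nonneg_left hmarkov hn).trans h

lemma IsCoherent.exists_adj_notMem (h : IsCoherent G α β) (hPB : Disjoint P B) (hP : α ≤ #P)
    (hB : 2 * β ≤ #B) {X Y : Finset V} (hX : 4 * (#X : ℝ) ≤ #B) (hY : 4 * (#Y : ℝ) ≤ #B) :
    ∃ b ∈ B, b ∉ X ∧ b ∉ Y ∧ ∃ r ∈ P, G.Adj r b := by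
  have hpos : (0 : ℝ) < #(neighborsIn G P B \ (X ∪ Y)) := by
    linarith [h.sub_lt_card_neighborsIn hPB hP, cast_card_union_le X Y,
      card_sub_card_le_card_sdiff (neighborsIn G P B) (X ∪ Y)]
  obtain ⟨b, hb⟩ := card_pos.1 (Nat.cast_pos.1 hpos)
  simp only [mem_sdiff, mem_neighborsIn, mem_union, not_or] at hb
  exact ⟨b, hb.1.1, hb.2.1, hb.2.2, hb.1.2⟩

lemma IsNearRegular.card_sub_le_card_filter {Δ s ζ : ℝ} (h : IsNearRegular G U Δ s ζ)
    (hs : 0 ≤ s) (hP : P ⊆ U) : #P - ζ ≤ #{r ∈ P | Δ ≤ s * degreeIn G r P} := by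
  by_contra! hlt
  set T := {r ∈ P | Δ ≤ s * degreeIn G r P}
  obtain ⟨r, hr, hrdeg⟩ := h.exists_le_degreeIn (P \ T) (sdiff_subset.trans hP)
    (by linarith [card_sub_card_le_card_sdiff P T])
  have hmono : (degreeIn G r (P \ T) : ℝ) ≤ degreeIn G r P :=
    Nat.cast_le.2 (degreeIn_mono r sdiff_subset)
  exact (mem_sdiff.1 hr).2 (mem_filter.2
    ⟨(mem_sdiff.1 hr).1, hrdeg.trans (mul_le_mul_of_nonneg_left hmono hs)⟩)

/-- `p 0, …, p j` is an induced path from `A` through `R` avoiding `Rest`, and only its last vertex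
may have neighbors in `Rest`. -/
structure IsRoute (G : SimpleGraph V) (A R Rest : Finset V) (j : ℕ) (p : ℕ → V) : Prop where
  isInducedPath : IsInducedPath G p j
  zero_mem : p 0 ∈ A
  mem : ∀ i, 0 < i → i ≤ j → p i ∈ R
  notMem : ∀ i ≤ j, p i ∉ Rest
  not_adj : ∀ i < j, ∀ v ∈ Rest, ¬ G.Adj (p i) v

namespace IsRoute

lemma mono (h : IsRoute G A R Rest j p) (hRest : Rest' ⊆ Rest) : IsRoute G A R Rest' j p :=
  { h with
    notMem := fun i hi hm ↦ h.notMem i hi (hRest hm)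
    not_adj := fun i hi v hv ↦ h.not_adj i hi v (hRest hv) }

lemma insert_target {b : V} (h : IsRoute G A R Rest j p) (hne : ∀ i ≤ j, p i ≠ b)
    (hadj : ∀ i < j, ¬ G.Adj (p i) b) : IsRoute G A (insert b R) (insert b Rest) j p :=
  { h with
    mem := fun i h0 hi ↦ mem_insert_of_mem (h.mem i h0 hi)
    notMem := fun i hi ↦ by simpa using ⟨hne i hi, h.notMem i hi⟩
    not_adj := fun i hi ↦ forall_mem_insert _ _ _ |>.2 ⟨hadj i hi, h.not_adj i hi⟩ }

lemma exists_snoc {v : V} (h : IsRoute G A R Rest j p) (hv : v ∈ Rest) (hvR : v ∈ R)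
    (hadj : G.Adj (p j) v) (hRest : Rest' ⊆ Rest) (hvRest : v ∉ Rest')
    (hend : ∀ u ∈ Rest', ¬ G.Adj (p j) u) :
    ∃ q, IsRoute G A R Rest' (j + 1) q ∧ q 0 = p 0 ∧ q (j + 1) = v := by
  obtain ⟨q, hq, hqp, hqv⟩ := h.isInducedPath.exists_snoc
    (fun i hi hiv ↦ h.notMem i hi (hiv ▸ hv)) hadj fun i hi ↦ h.not_adj i hi v hv
  have hq0 : q 0 = p 0 := hqp 0 j.zero_le
  refine ⟨q, ⟨hq, hq0 ▸ h.zero_mem, fun i h0 hi ↦ ?_, fun i hi ↦ ?_, fun i hi u hu ↦ ?_⟩, hq0, hqv⟩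
  · obtain hij | rfl := Nat.le_succ_iff.1 hi
    · exact hqp i hij ▸ h.mem i h0 hij
    · exact hqv ▸ hvR
  · obtain hij | rfl := Nat.le_succ_iff.1 hi
    · exact hqp i hij ▸ fun hm ↦ h.notMem i hij (hRest hm)
    · exact hqv ▸ hvRest
  · rw [hqp i (Nat.lt_succ_iff.1 hi)]
    obtain hij | rfl := (Nat.lt_succ_iff.1 hi).lt_or_eq
    · exact h.not_adj i hij u (hRest hu)
    · exact hend u hu

end IsRoute

/-- Every vertex of `L` is the end of a route of length `j`. -/
def Reaches (G : SimpleGraph V) (A R Rest : Finset V) (j : ℕ) (L : Finset V) : Prop :=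
  ∀ r ∈ L, ∃ p, IsRoute G A R Rest j p ∧ p j = r

lemma Reaches.disjoint (h : Reaches G A R Rest j L) : Disjoint L Rest :=
  disjoint_left.2 fun r hr hrRest ↦ by
    obtain ⟨p, hp, rfl⟩ := h r hr
    exact hp.notMem j le_rfl hrRest

lemma Reaches.mono (h : Reaches G A R Rest j L) (hRest : Rest' ⊆ Rest) :
    Reaches G A R Rest' j L := fun r hr ↦ by
  obtain ⟨p, hp, hpr⟩ := h r hr
  exact ⟨p, hp.mono hRest, hpr⟩

lemma Reaches.succ {X : Finset V} (h : Reaches G A R Rest j L) (hX : X ⊆ L)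
    (hRest : Rest ⊆ R) :
    Reaches G A R (Rest \ neighborsIn G X Rest) (j + 1) (neighborsIn G X Rest) := fun r hr ↦ by
  obtain ⟨hrRest, z, hz, hzr⟩ := mem_neighborsIn.1 hr
  obtain ⟨p, hp, rfl⟩ := h z (hX hz)
  obtain ⟨q, hq, -, hqr⟩ := hp.exists_snoc hrRest (hRest hrRest) hzr sdiff_subset
    (fun hm ↦ (mem_sdiff.1 hm).2 hr) fun u hu hadj ↦
      (mem_sdiff.1 hu).2 (mem_neighborsIn.2 ⟨(mem_sdiff.1 hu).1, _, hz, hadj⟩)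
  exact ⟨q, hq, hqr⟩

lemma IsCoherent.exists_subset_balanced_neighborsIn (h : IsCoherent G α β) (hβ : 0 < β)
    (hdisj : Disjoint L Rest) (hL : α ≤ #L) (hRest : 6 * β ≤ #Rest)
    (hdeg : ∀ x ∈ L, (degreeIn G x Rest : ℝ) ≤ β) :
    ∃ X ⊆ L, (#Rest : ℝ) ≤ 3 * #(neighborsIn G X Rest) ∧
      (#Rest : ℝ) ≤ 3 * #(Rest \ neighborsIn G X Rest) := by
  let covering : Finset (Finset V) := {X ∈ L.powerset | (#Rest : ℝ) ≤ 3 * #(neighborsIn G X Rest)}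
  have hcovering : covering.Nonempty := ⟨L, by
    simpa [covering] using by linarith [h.sub_lt_card_neighborsIn hdisj hL]⟩
  obtain ⟨X, hX, hmin⟩ := exists_min_image covering card hcovering
  simp only [covering, mem_filter, mem_powerset] at hX hmin
  obtain ⟨hXL, hXcard⟩ := hX
  obtain ⟨x, hx⟩ : X.Nonempty := by
    rw [nonempty_iff_ne_empty]
    rintro rfl
    rw [neighborsIn_empty_left, card_empty] at hXcard
    norm_num at hXcard
    simp only [hXcard, card_empty, CharP.cast_eq_zero] at hRest
    linarith
  have herase : 3 * (#(neighborsIn G (X.erase x) Rest) : ℝ) ≤ #Rest := by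
    by_contra! hlt
    exact (hmin _ ⟨(erase_subset _ _).trans hXL, hlt.le⟩).not_gt (card_erase_lt_of_mem hx)
  refine ⟨X, hXL, hXcard, ?_⟩
  linarith [card_sub_card_le_card_sdiff Rest (neighborsIn G X Rest), hdeg x (hXL hx),
    card_neighborsIn_le_erase_add (G := G) X Rest x]

lemma IsCoherent.exists_reaches (h : IsCoherent G α β) (hβ : 0 < β) (hαβ : α ≤ β) (hA : A ⊆ U)
    (hR : R ⊆ U) (hAR : Disjoint A R) (hdeg : ∀ x ∈ U, (degreeIn G x U : ℝ) ≤ β) {y : ℝ}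
    (hy : 6 * β ≤ y) (hyA : y ≤ #A) (j : ℕ) (hyR : y * 3 ^ j ≤ #R) :
    ∃ L Rest, L ⊆ U ∧ Rest ⊆ R ∧ y ≤ #L ∧ (#R : ℝ) ≤ 3 ^ j * #Rest ∧ Reaches G A R Rest j L := by
  induction j with
  | zero =>
    exact ⟨A, R, hA, Subset.rfl, hyA, by simp, fun r hr ↦ ⟨fun _ ↦ r, ⟨.zero _, hr,
      fun i h0 h1 ↦ by omega, fun _ _ ↦ disjoint_left.1 hAR hr, fun i hi ↦ by omega⟩, rfl⟩⟩
  | succ j ih =>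
    have h3 : (0 : ℝ) < 3 ^ j := by positivity
    obtain ⟨L, Rest, hLU, hRest, hyL, hRcard, hreach⟩ :=
      ih (le_trans (by rw [pow_succ]; nlinarith) hyR)
    have hyRest : 3 * y ≤ #Rest := le_of_mul_le_mul_left
      (by linarith [show 3 ^ j * (3 * y) = y * 3 ^ (j + 1) by ring]) h3
    obtain ⟨X, hXL, hcov, hrest⟩ := h.exists_subset_balanced_neighborsIn hβ hreach.disjoint
      (by linarith) (by linarith) fun x hx ↦
        (Nat.cast_le.2 (degreeIn_mono x (hRest.trans hR))).trans (hdeg x (hLU hx))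
    refine ⟨_, _, (neighborsIn_subset X Rest).trans (hRest.trans hR), sdiff_subset.trans hRest,
      by linarith, ?_, hreach.succ hXL hRest⟩
    calc (#R : ℝ) ≤ 3 ^ j * #Rest := hRcard
      _ ≤ 3 ^ j * (3 * #(Rest \ neighborsIn G X Rest)) :=
        mul_le_mul_of_nonneg_left hrest h3.le
      _ = 3 ^ (j + 1) * #(Rest \ neighborsIn G X Rest) := by ring

lemma Reaches.exists_conflict {Δ C : ℝ} (hr : Reaches G A R Rest j L) (hΔ : 0 ≤ Δ) (hA : A ⊆ U)
    (hR : R ⊆ U) (hB : B ⊆ U) (hBR : Disjoint B R) (hdeg : ∀ x ∈ U, (degreeIn G x U : ℝ) ≤ Δ)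
    {conf : V → V → Prop} (hrefl : ∀ a, conf a a)
    (hconf : ∀ a ∈ A, (#{b ∈ B | conf a b} : ℝ) ≤ C * Δ) :
    ∃ N : V → V → Prop, (∀ r ∈ L, (#{b ∈ B | N r b} : ℝ) ≤ (C + j) * Δ) ∧
      ∀ r ∈ L, ∀ b ∈ B, ¬ N r b →
        ∃ p, IsRoute G A (insert b R) (insert b Rest) j p ∧ p j = r ∧ ¬ conf (p 0) b := by
  choose! p hp hpr using hr
  let T (r : V) : Finset V := (range j).image (p r)
  have hTU (r : V) (hrL : r ∈ L) : T r ⊆ U := image_subset_iff.2 fun i hi ↦ by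
    obtain rfl | h0 := i.eq_zero_or_pos
    · exact hA (hp r hrL).zero_mem
    · exact hR ((hp r hrL).mem i h0 (mem_range.1 hi).le)
  obtain ⟨N, hNiff⟩ : ∃ N : V → V → Prop,
      ∀ r b, N r b ↔ conf (p r 0) b ∨ b ∈ neighborsIn G (T r) U := ⟨_, fun _ _ ↦ Iff.rfl⟩
  refine ⟨N, fun r hrL ↦ ?_, fun r hrL b hb hN ↦ ?_⟩
  · have hsub : {b ∈ B | N r b} ⊆ {b ∈ B | conf (p r 0) b} ∪ neighborsIn G (T r) U := fun b hb ↦ by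
      obtain ⟨hbB, hbN⟩ := mem_filter.1 hb
      rcases (hNiff r b).1 hbN with hc | hn
      · exact mem_union_left _ (mem_filter.2 ⟨hbB, hc⟩)
      · exact mem_union_right _ hn
    have hT : (#(T r) : ℝ) ≤ j := by exact_mod_cast card_image_le.trans (card_range j).le
    linarith [(Nat.cast_le (α := ℝ).2 (card_le_card hsub)).trans (cast_card_union_le _ _),
      hconf (p r 0) (hp r hrL).zero_mem, mul_le_mul_of_nonneg_right hT hΔ,
      card_neighborsIn_le (G := G) (T r) U fun x hx ↦ hdeg x (hTU r hrL hx)]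
  · simp only [hNiff, not_or, mem_neighborsIn, not_and, not_exists] at hN
    refine ⟨p r, (hp r hrL).insert_target (fun i hi hib ↦ ?_) fun i hi ↦
      hN.2 (hB hb) _ (mem_image_of_mem _ (mem_range.2 hi)), hpr r hrL, hN.1⟩
    obtain rfl | h0 := i.eq_zero_or_pos
    · exact hN.1 (hib ▸ hrefl _)
    · exact disjoint_left.1 hBR hb (hib ▸ (hp r hrL).mem i h0 hi)

/-- The constants of the linking construction. The graph is `(α, β)`-coherent; the ambient set is
near-regular with parameters `Δ`, `s`, `ζ`; a vertex has at most `C * Δ` conflicts; the sets to be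
linked have size at least `y`; a target conflicting with more than `K * Δ` vertices of a layer is
discarded; and links have length at most `J + 3`. -/
structure LinkConstants where
  (α β Δ s ζ C K y : ℝ)
  (J : ℕ)

/-- `U` is near-regular, `G` is coherent, and the constants fit together as the linking
construction requires. -/
structure IsLinkingSet (G : SimpleGraph V) (c : LinkConstants) (U : Finset V) : Prop where
  coherent : IsCoherent G c.α c.β
  regular : IsNearRegular G U c.Δ c.s c.ζ
  α_pos : 0 < c.α
  one_le_s : 1 ≤ c.s
  α_mul_le_β : c.α * c.s ^ 2 ≤ c.β
  one_le_Δ : 1 ≤ c.Δ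
  Δ_le_β : c.Δ ≤ c.β
  C_nonneg : 0 ≤ c.C
  K_pos : 0 < c.K
  eight_mul_β_le : 8 * c.β ≤ c.y
  four_mul_ζ_le : 4 * c.ζ ≤ c.y
  mul_card_le : 4 * (c.C + c.J + 1) * #U ≤ c.K * c.y
  K_mul_β_le : (c.K + 3) * c.β ≤ c.y
  two_mul_K_lt : 2 * (c.K + 2) < c.s

/-- `L` is reached by routes of length `j` avoiding `P`, and every not too small subset of `P` has
many neighbors in `L`. -/
structure IsLayer (G : SimpleGraph V) (c : LinkConstants) (A R U P : Finset V) (j : ℕ)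
    (L : Finset V) : Prop where
  subset : L ⊆ U
  reaches : Reaches G A R P j L
  expands : ∀ S ⊆ P, c.Δ ≤ 2 * c.s * #S → (c.K + 2) * c.Δ < #(neighborsIn G S L)

namespace IsLinkingSet

variable {c : LinkConstants}

lemma α_le_β (hU : IsLinkingSet G c U) : c.α ≤ c.β :=
  le_of_mul_le_of_one_le hU.α_pos (one_le_pow₀ hU.one_le_s) hU.α_mul_le_β

lemma β_pos (hU : IsLinkingSet G c U) : 0 < c.β := hU.α_pos.trans_le hU.α_le_β

lemma degreeIn_le_β (hU : IsLinkingSet G c U) {u : V} (hu : u ∈ U) : (degreeIn G u U : ℝ) ≤ c.β :=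
  (hU.regular.degreeIn_le u hu).trans hU.Δ_le_β

lemma exists_expanding_core (hU : IsLinkingSet G c U) (hL : c.y ≤ #L) (hdisj : Disjoint L Rest) :
    ∃ X, (#X : ℝ) < c.α ∧
      ∀ S ⊆ Rest \ X, c.Δ ≤ 2 * c.s * #S → (c.K + 2) * c.Δ < #(neighborsIn G S L) := by
  have hαβ := hU.α_le_β
  have hy := hU.eight_mul_β_le
  obtain ⟨X, -, hX, hexp⟩ := hU.coherent.exists_expanding_core hU.α_pos (sq_nonneg c.s) Rest
    (B := L) (by linarith [hU.α_mul_le_β])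
  refine ⟨X, hX, fun S hS hSΔ ↦ ?_⟩
  have hΔpos : 0 < c.Δ := one_pos.trans_le hU.one_le_Δ
  obtain hSα | hSα := le_or_gt (#S : ℝ) c.α
  · have hmono : (#(neighborsIn G S (L \ (X ∪ S))) : ℝ) ≤ #(neighborsIn G S L) := by
      exact_mod_cast card_le_card (neighborsIn_mono_right S sdiff_subset)
    have := mul_le_mul_of_nonneg_left hSΔ (zero_le_one.trans hU.one_le_s)
    have := mul_lt_mul_of_pos_right hU.two_mul_K_lt hΔpos
    linarith [hexp S hS hSα, show c.s * (2 * c.s * #S) = 2 * (c.s ^ 2 * #S) by ring]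
  · have := hU.coherent.sub_lt_card_neighborsIn
      (hdisj.symm.mono_left (hS.trans sdiff_subset)) hSα.le
    have := mul_le_mul_of_nonneg_left hU.Δ_le_β (by linarith [hU.K_pos] : 0 ≤ c.K + 2)
    linarith [hU.K_mul_β_le]

lemma exists_isLayer (hU : IsLinkingSet G c U) (hA : A ⊆ U) (hR : R ⊆ U) (hAR : Disjoint A R)
    (hyA : c.y ≤ #A) (hyR : c.y * 3 ^ (j + 1) ≤ #R) :
    ∃ P ⊆ R, c.y ≤ 2 * #P ∧ (∃ L, IsLayer G c A R U P j L) ∧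
      ∃ L, IsLayer G c A R U P (j + 1) L := by
  have hαβ := hU.α_le_β
  have hβ := hU.β_pos
  have hy := hU.eight_mul_β_le
  have hdeg (x : V) (hx : x ∈ U) := hU.degreeIn_le_β hx
  obtain ⟨L₁, Rest₁, hL₁U, hRest₁, hyL₁, hRcard, hreach₁⟩ := hU.coherent.exists_reaches hβ hαβ hA hR
    hAR hdeg (by linarith) hyA j ((mul_le_mul_of_nonneg_left
      (pow_le_pow_right₀ (by norm_num) j.le_succ) (by linarith)).trans hyR)
  have hyRest₁ : 3 * c.y ≤ #Rest₁ := le_of_mul_le_mul_left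
    (by linarith [show 3 ^ j * (3 * c.y) = c.y * 3 ^ (j + 1) by ring])
    (by positivity : (0 : ℝ) < 3 ^ j)
  obtain ⟨X, hX, hcov, hrest⟩ := hU.coherent.exists_subset_balanced_neighborsIn hβ hreach₁.disjoint
    (by linarith) (by linarith) fun x hx ↦
      (Nat.cast_le.2 (degreeIn_mono x (hRest₁.trans hR))).trans (hdeg x (hL₁U hx))
  have hreach₂ := hreach₁.succ hX hRest₁
  set L₂ := neighborsIn G X Rest₁
  have hL₂ : L₂ ⊆ Rest₁ := neighborsIn_subset _ _
  obtain ⟨X₁, hX₁, hexp₁⟩ := hU.exists_expanding_core hyL₁ (hreach₁.mono sdiff_subset).disjoint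
  obtain ⟨X₂, hX₂, hexp₂⟩ := hU.exists_expanding_core (by linarith) hreach₂.disjoint
  have hP := card_sub_card_le_card_sdiff (Rest₁ \ L₂) (X₁ ∪ X₂)
  refine ⟨(Rest₁ \ L₂) \ (X₁ ∪ X₂), sdiff_subset.trans (sdiff_subset.trans hRest₁),
    by linarith [cast_card_union_le X₁ X₂],
    ⟨L₁, hL₁U, hreach₁.mono (sdiff_subset.trans sdiff_subset), fun S hS ↦
      hexp₁ S (hS.trans (sdiff_subset_sdiff Subset.rfl subset_union_left))⟩,
    ⟨L₂, hL₂.trans (hRest₁.trans hR), hreach₂.mono sdiff_subset, fun S hS ↦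
      hexp₂ S (hS.trans (sdiff_subset_sdiff Subset.rfl subset_union_right))⟩⟩

end IsLinkingSet

lemma IsLayer.exists_routes {c : LinkConstants} (hL : IsLayer G c A R U P j L)
    (hU : IsLinkingSet G c U) (hA : A ⊆ U) (hB : B ⊆ U) (hR : R ⊆ U) (hBR : Disjoint B R)
    (hyB : c.y ≤ #B) (hj : j ≤ c.J + 1) {conf : V → V → Prop} (hrefl : ∀ a, conf a a)
    (hconf : ∀ a ∈ A, (#{b ∈ B | conf a b} : ℝ) ≤ c.C * c.Δ) :
    ∃ X : Finset V, 4 * (#X : ℝ) ≤ #B ∧ ∀ b ∈ B, b ∉ X → ∀ v ∈ U, ∀ S ⊆ P,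
      c.Δ ≤ 2 * c.s * #S → ∃ p, IsRoute G A (insert b R) (insert b P) j p ∧ ¬ conf (p 0) b ∧
        ¬ G.Adj (p j) b ∧ ¬ G.Adj (p j) v ∧ ∃ u ∈ S, G.Adj (p j) u := by
  have hΔ : 0 < c.Δ := one_pos.trans_le hU.one_le_Δ
  have hK := hU.K_pos
  obtain ⟨N, hN, hroute⟩ := hL.reaches.exists_conflict hΔ.le hA hR hB hBR hU.regular.degreeIn_le
    hrefl hconf
  have hcount : 4 * ((c.C + j) * c.Δ * #L) ≤ c.K * c.Δ * #B := by
    have hC := hU.C_nonneg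
    have hLU : (#L : ℝ) ≤ #U := by exact_mod_cast card_le_card hL.subset
    have hj' : (j : ℝ) ≤ c.J + 1 := by exact_mod_cast hj
    calc 4 * ((c.C + j) * c.Δ * #L) ≤ 4 * ((c.C + (c.J + 1)) * c.Δ * #U) := by gcongr
      _ = 4 * (c.C + c.J + 1) * #U * c.Δ := by ring
      _ ≤ c.K * #B * c.Δ := mul_le_mul_of_nonneg_right
        (hU.mul_card_le.trans (mul_le_mul_of_nonneg_left hyB hK.le)) hΔ.le
      _ = c.K * c.Δ * #B := by ring
  refine ⟨_, mul_card_filter_lt_le hN (by positivity) (by norm_num) hcount,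
    fun b hb hbX v hv S hSP hS ↦ ?_⟩
  have hfew : (#{r ∈ L | N r b} : ℝ) ≤ c.K * c.Δ := by simpa [hb] using hbX
  set avoid := {r ∈ L | N r b} ∪ (neighborsIn G {b} U ∪ neighborsIn G {v} U)
  obtain ⟨r, hrS, hr⟩ : ∃ r ∈ neighborsIn G S L, r ∉ avoid := by
    refine exists_mem_notMem_of_card_lt_card (Nat.cast_lt (α := ℝ).1 ?_)
    have hb' := hU.regular.degreeIn_le b (hB hb)
    have hv' := hU.regular.degreeIn_le v hv
    rw [← card_neighborsIn_singleton] at hb' hv'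
    linarith [hL.expands S hSP hS, cast_card_union_le (neighborsIn G {b} U) (neighborsIn G {v} U),
      cast_card_union_le {r ∈ L | N r b} (neighborsIn G {b} U ∪ neighborsIn G {v} U)]
  obtain ⟨hrL, u, hu, hur⟩ := mem_neighborsIn.1 hrS
  simp only [avoid, mem_union, mem_filter, mem_neighborsIn, mem_singleton, exists_eq_left, not_or,
    not_and] at hr
  obtain ⟨hrN, hrb, hrv⟩ := hr
  obtain ⟨p, hp, rfl, hpconf⟩ := hroute r hrL b hb (hrN hrL)
  exact ⟨p, hp, hpconf, fun h ↦ hrb (hL.subset hrL) h.symm, fun h ↦ hrv (hL.subset hrL) h.symm,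
    u, hu, hur.symm⟩

section Link

variable {b u v : V}

lemma IsRoute.exists_link_of_adj_of_adj (hp : IsRoute G A (insert b R) (insert b P) j p)
    (hPR : P ⊆ R) (hu : u ∈ P) (hpb : ¬ G.Adj (p j) b) (hpu : G.Adj (p j) u) (hub : G.Adj u b) :
    ∃ q, IsRoute G A (insert b R) ∅ (j + 2) q ∧ q 0 = p 0 ∧ q (j + 2) = b := by
  obtain ⟨q₁, hq₁, hq₁0, rfl⟩ := hp.exists_snoc (mem_insert_of_mem hu)
    (mem_insert_of_mem (hPR hu)) hpu (Rest' := {b}) (by simp) (by simpa using hub.ne) (by simpa)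
  obtain ⟨q, hq, hq0, hqb⟩ := hq₁.exists_snoc (mem_singleton_self b) (mem_insert_self b R) hub
    (empty_subset _) (notMem_empty _) (by simp)
  exact ⟨q, hq, hq0.trans hq₁0, hqb⟩

lemma IsRoute.exists_link_of_adj_of_adj_of_adj (hp : IsRoute G A (insert b R) (insert b P) j p)
    (hPR : P ⊆ R) (hbR : b ∉ R) (hu : u ∈ P) (hv : v ∈ P) (hpb : ¬ G.Adj (p j) b)
    (hpv : ¬ G.Adj (p j) v) (hpu : G.Adj (p j) u) (huv : G.Adj u v) (hub : ¬ G.Adj u b)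
    (hvb : G.Adj v b) :
    ∃ q, IsRoute G A (insert b R) ∅ (j + 3) q ∧ q 0 = p 0 ∧ q (j + 3) = b := by
  have hne : u ≠ b := fun h ↦ hbR (h ▸ hPR hu)
  obtain ⟨q₁, hq₁, hq₁0, rfl⟩ := hp.exists_snoc (mem_insert_of_mem hu)
    (mem_insert_of_mem (hPR hu)) hpu (Rest' := insert b {v})
    (insert_subset_insert b (singleton_subset_iff.2 hv)) (by simp [hne, huv.ne]) (by simp [*])
  obtain ⟨q, hq, hq0, hqb⟩ := hq₁.exists_link_of_adj_of_adj (singleton_subset_iff.2 (hPR hv))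
    (mem_singleton_self v) hub huv hvb
  exact ⟨q, hq, hq0.trans hq₁0, hqb⟩

end Link

lemma IsLinkingSet.exists_link {c : LinkConstants} (hU : IsLinkingSet G c U) (hA : A ⊆ U)
    (hB : B ⊆ U) (hR : R ⊆ U) (hAR : Disjoint A R) (hBR : Disjoint B R) {conf : V → V → Prop}
    (hrefl : ∀ a, conf a a) (hconf : ∀ a ∈ A, (#{b ∈ B | conf a b} : ℝ) ≤ c.C * c.Δ)
    (hyA : c.y ≤ #A) (hyB : c.y ≤ #B) (hj : j ≤ c.J) (hyR : c.y * 3 ^ (j + 1) ≤ #R) :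
    ∃ p, IsInducedPath G p (j + 3) ∧ p 0 ∈ A ∧ p (j + 3) ∈ B ∧ ¬ conf (p 0) (p (j + 3)) ∧
      ∀ i, 0 < i → i < j + 3 → p i ∈ R := by
  obtain ⟨P, hPR, hyP, ⟨L₁, hL₁⟩, L₂, hL₂⟩ := hU.exists_isLayer hA hR hAR hyA hyR
  obtain ⟨X₁, hX₁, hroute₁⟩ := hL₁.exists_routes hU hA hB hR hBR hyB (by omega) hrefl hconf
  obtain ⟨X₂, hX₂, hroute₂⟩ := hL₂.exists_routes hU hA hB hR hBR hyB (by omega) hrefl hconf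
  have hreg := hU.regular.card_sub_le_card_filter (zero_le_one.trans hU.one_le_s) (hPR.trans hR)
  have hy := hU.eight_mul_β_le
  obtain ⟨b, hb, hb₁, hb₂, v, hv, hvb⟩ := hU.coherent.exists_adj_notMem
    (hBR.symm.mono_left ((filter_subset _ _).trans hPR))
    (by linarith [hU.four_mul_ζ_le, hU.α_le_β, hU.β_pos]) (by linarith [hU.β_pos]) hX₁ hX₂
  obtain ⟨hvP, hvdeg⟩ := mem_filter.1 hv
  have hbR : b ∉ R := disjoint_left.1 hBR hb
  suffices ∃ q, IsRoute G A (insert b R) ∅ (j + 3) q ∧ ¬ conf (q 0) b ∧ q (j + 3) = b by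
    obtain ⟨q, hq, hqconf, rfl⟩ := this
    exact ⟨q, hq.isInducedPath, hq.zero_mem, hb, hqconf, fun i h0 hi ↦ (mem_insert.1
      (hq.mem i h0 hi.le)).resolve_left (hq.isInducedPath.ne hi.le le_rfl hi.ne)⟩
  -- Half of the neighbors of `v` in `P` are adjacent to `b`, or half of them are not. In the first
  -- case one of them is the last vertex before `b`, in the second it is the last one before `v`.
  have hsplit : (degreeIn G v P : ℝ) = #{u ∈ {u ∈ P | G.Adj v u} | G.Adj u b} +
      #{u ∈ {u ∈ P | G.Adj v u} | ¬ G.Adj u b} := by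
    exact_mod_cast (card_filter_add_card_filter_not _).symm
  rw [hsplit, mul_add] at hvdeg
  have hvU := hR (hPR hvP)
  obtain hS | hS := le_or_gt c.Δ (2 * c.s * #{u ∈ {u ∈ P | G.Adj v u} | G.Adj u b})
  · obtain ⟨p, hp, hpconf, hpb, -, u, hu, hpu⟩ := hroute₂ b hb hb₂ v hvU _
      ((filter_subset _ _).trans (filter_subset _ _)) hS
    simp only [mem_filter] at hu
    obtain ⟨q, hq, hq0, hqb⟩ := hp.exists_link_of_adj_of_adj hPR hu.1.1 hpb hpu hu.2
    exact ⟨q, hq, hq0 ▸ hpconf, hqb⟩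
  · obtain ⟨p, hp, hpconf, hpb, hpv, u, hu, hpu⟩ := hroute₁ b hb hb₁ v hvU _
      ((filter_subset _ _).trans (filter_subset _ _)) (by linarith)
    simp only [mem_filter] at hu
    obtain ⟨q, hq, hq0, hqb⟩ := hp.exists_link_of_adj_of_adj_of_adj hPR hbR hu.1.1 hvP hpb hpv hpu
      hu.1.2.symm hu.2 hvb
    exact ⟨q, hq, hq0 ▸ hpconf, hqb⟩

end

/-! ### Hubs -/

section

variable {V : Type*} {G : SimpleGraph V} {r k : ℕ} {U W R D Y Z : Finset V}
  {𝒟 : Finset (Finset V)} {u v w x z : V}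

/-- Adjacency inside `Y`; its reflexive transitive closure is connectedness by paths in `Y`. -/
def AdjIn (G : SimpleGraph V) (Y : Finset V) (u v : V) : Prop := u ∈ Y ∧ v ∈ Y ∧ G.Adj u v

lemma AdjIn.mono (h : AdjIn G Y u v) (hYZ : Y ⊆ Z) : AdjIn G Z u v := ⟨hYZ h.1, hYZ h.2.1, h.2.2⟩

instance : Std.Symm (AdjIn G Y) := ⟨fun _ _ h ↦ ⟨h.2.1, h.1, h.2.2.symm⟩⟩

lemma reflTransGen_adjIn_mono (h : Relation.ReflTransGen (AdjIn G Y) u v) (hYZ : Y ⊆ Z) :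
    Relation.ReflTransGen (AdjIn G Z) u v :=
  Relation.ReflTransGen.mono (fun _ _ huv ↦ AdjIn.mono huv hYZ) _ _ h

lemma exists_isInducedPath_of_reflTransGen_adjIn (hu : u ∈ Y)
    (h : Relation.ReflTransGen (AdjIn G Y) u v) :
    ∃ p L, IsInducedPath G p L ∧ p 0 = u ∧ p L = v ∧ ∀ i ≤ L, p i ∈ Y := by
  induction h with
  | refl => exact ⟨fun _ ↦ u, 0, .zero _, rfl, rfl, fun _ _ ↦ hu⟩
  | @tail b c _ hbc ih =>
    obtain ⟨p, L, hp, hp0, hpL, hpY⟩ := ih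
    -- Leave the path at its first vertex that equals `c` or is adjacent to it.
    have htouch : ∃ i, i ≤ L ∧ (p i = c ∨ G.Adj (p i) c) := ⟨L, le_rfl, .inr (hpL ▸ hbc.2.2)⟩
    obtain ⟨hi, hic⟩ := Nat.find_spec htouch
    have hmin (m : ℕ) (hm : m < Nat.find htouch) : p m ≠ c ∧ ¬ G.Adj (p m) c :=
      not_or.1 fun hmc ↦ Nat.find_min htouch hm ⟨hm.le.trans hi, hmc⟩
    set i := Nat.find htouch
    by_cases hc : p i = c
    · exact ⟨p, i, hp.take hi, hp0, hc, fun m hm ↦ hpY m (hm.trans hi)⟩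
    have hne (m : ℕ) (hm : m ≤ i) : p m ≠ c := by
      obtain hlt | rfl := hm.lt_or_eq
      exacts [(hmin m hlt).1, hc]
    obtain ⟨q, hq, hqp, hqc⟩ := (hp.take hi).exists_snoc hne (hic.resolve_left hc) fun m hm ↦
      (hmin m hm).2
    refine ⟨q, i + 1, hq, (hqp 0 i.zero_le).trans hp0, hqc, fun m hm ↦ ?_⟩
    obtain hmi | rfl := Nat.le_succ_iff.1 hm
    · exact hqp m hmi ▸ hpY m (hmi.trans hi)
    · exact hqc ▸ hbc.2.1

/-- The set of vertices `p 0, …, p T` of a path. -/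
noncomputable def pathSupport (p : ℕ → V) (T : ℕ) : Finset V := (range (T + 1)).image p

section Path

variable {p : ℕ → V} {L T : ℕ}

@[simp]
lemma mem_pathSupport : x ∈ pathSupport p T ↔ ∃ i ≤ T, p i = x := by
  simp [pathSupport]

lemma IsInducedPath.card_pathSupport (h : IsInducedPath G p T) : #(pathSupport p T) = T + 1 := by
  rw [pathSupport, card_image_of_injOn, card_range]
  exact h.injOn.mono fun i hi ↦ Nat.lt_succ_iff.1 (mem_range.1 hi)

lemma IsInducedPath.lt_card (h : IsInducedPath G p L) (hY : ∀ i ≤ L, p i ∈ Y) : L < #Y := by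
  have hsub : pathSupport p L ⊆ Y := fun x hx ↦ by
    obtain ⟨i, hi, rfl⟩ := mem_pathSupport.1 hx
    exact hY i hi
  have := card_le_card hsub
  rw [h.card_pathSupport] at this
  omega

end Path

lemma IsRooted.exists_root (h : IsRooted G r D) :
    ∃ w, ∀ x ∈ D, ∃ Q ⊆ D, x ∈ Q ∧ #Q ≤ r + 1 ∧ Relation.ReflTransGen (AdjIn G Q) w x := by
  obtain ⟨-, w, rank, hrank⟩ := h
  suffices ∀ m, ∀ x ∈ D, rank x = m → ∃ Q ⊆ D, x ∈ Q ∧ #Q ≤ m + 1 ∧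
      Relation.ReflTransGen (AdjIn G Q) w x by
    refine ⟨w, fun x hx ↦ ?_⟩
    obtain ⟨Q, hQD, hxQ, hcard, hconn⟩ := this _ x hx rfl
    exact ⟨Q, hQD, hxQ, hcard.trans (Nat.succ_le_succ (hrank x hx).1), hconn⟩
  intro m
  induction m using Nat.strong_induction_on with
  | _ m ih =>
    intro x hx hm
    obtain rfl | ⟨y, hy, hyx, hlt⟩ := (hrank x hx).2
    · exact ⟨{x}, by simpa using hx, by simp, by simp, .refl⟩
    · obtain ⟨Q, hQD, hyQ, hcard, hconn⟩ := ih (rank y) (by omega) y hy rfl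
      exact ⟨insert x Q, insert_subset hx hQD, mem_insert_self _ _,
        (card_insert_le _ _).trans (by omega),
        (reflTransGen_adjIn_mono hconn (subset_insert _ _)).tail
          ⟨mem_insert_of_mem hyQ, mem_insert_self _ _, hyx⟩⟩

lemma exists_isInducedPath_of_common_root {Q₁ Q₂ : Finset V} {x₁ x₂ : V} (hne : u ≠ v)
    (hnadj : ¬ G.Adj u v) (h₁ : Relation.ReflTransGen (AdjIn G Q₁) w x₁) (hx₁ : x₁ ∈ Q₁)
    (hux₁ : G.Adj x₁ u) (h₂ : Relation.ReflTransGen (AdjIn G Q₂) w x₂) (hx₂ : x₂ ∈ Q₂)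
    (hvx₂ : G.Adj x₂ v) :
    ∃ p L, IsInducedPath G p L ∧ p 0 = u ∧ p L = v ∧ 2 ≤ L ∧ L ≤ #Q₁ + #Q₂ + 1 ∧
      ∀ i, 0 < i → i < L → p i ∈ Q₁ ∪ Q₂ := by
  set Y := insert u (insert v (Q₁ ∪ Q₂)) with hY
  have hQ₁ : Q₁ ⊆ Y := fun a ha ↦ by simp [hY, ha]
  have hQ₂ : Q₂ ⊆ Y := fun a ha ↦ by simp [hY, ha]
  have huY : u ∈ Y := by simp [hY]
  have hvY : v ∈ Y := by simp [hY]
  have hwu := (reflTransGen_adjIn_mono h₁ hQ₁).tail ⟨hQ₁ hx₁, huY, hux₁⟩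
  have hwv := (reflTransGen_adjIn_mono h₂ hQ₂).tail ⟨hQ₂ hx₂, hvY, hvx₂⟩
  obtain ⟨p, L, hp, rfl, rfl, hpY⟩ := exists_isInducedPath_of_reflTransGen_adjIn huY
    ((symm hwu).trans hwv)
  have hL : 2 ≤ L := by
    by_contra! hL
    obtain rfl | rfl : L = 0 ∨ L = 1 := by omega
    exacts [hne rfl, hnadj ((hp.adj_iff 0 1 one_pos le_rfl).2 rfl)]
  refine ⟨p, L, hp, rfl, rfl, hL, ?_, fun i h0 hi ↦ ?_⟩
  · have := hp.lt_card hpY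
    have : #Y ≤ _ := card_insert_le (p 0) (insert (p L) (Q₁ ∪ Q₂))
    have := card_insert_le (p L) (Q₁ ∪ Q₂)
    have := card_union_le Q₁ Q₂
    omega
  · simpa [hY, hp.ne hi.le L.zero_le h0.ne', hp.ne hi.le le_rfl hi.ne] using hpY i hi.le

/-- The data of a hub: a set `W` of possible centers and a set `R` of possible link vertices inside
`U`, a family `𝒟` of sets covering `W`, and for `D ∈ 𝒟` and `z ∈ W` the set `Q D z` of vertices of a
path in `D` from the root of `D` to a neighbor of `z`. -/
structure Hub (V : Type*) where
  (U W R : Finset V)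
  (𝒟 : Finset (Finset V))
  (Q : Finset V → V → Finset V)

/-- `H` is a hub whose root paths have at most `k` vertices. Instead of the paths themselves, it is
recorded that two centers are joined through the union of their root paths in `D`. -/
structure IsHub (G : SimpleGraph V) (k : ℕ) (H : Hub V) : Prop where
  W_subset : H.W ⊆ H.U
  R_subset : H.R ⊆ H.U
  disjoint_W_R : Disjoint H.W H.R
  subset : ∀ D ∈ H.𝒟, D ⊆ H.U
  disjoint : ∀ D ∈ H.𝒟, Disjoint D H.W
  anticomplete_R : ∀ D ∈ H.𝒟, IsAnticompletePair G D H.R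
  anticomplete : (H.𝒟 : Set (Finset V)).Pairwise (IsAnticompletePair G)
  Q_subset : ∀ D ∈ H.𝒟, ∀ z ∈ H.W, H.Q D z ⊆ D
  card_Q_le : ∀ D ∈ H.𝒟, ∀ z ∈ H.W, #(H.Q D z) ≤ k
  exists_path : ∀ D ∈ H.𝒟, ∀ v ∈ H.W, ∀ z ∈ H.W, v ≠ z → ¬ G.Adj v z →
    ∃ p L, IsInducedPath G p L ∧ p 0 = v ∧ p L = z ∧ 2 ≤ L ∧ L ≤ 2 * k + 1 ∧
      ∀ i, 0 < i → i < L → p i ∈ H.Q D v ∪ H.Q D z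

lemma IsRootedCover.exists_isHub (h𝒟 : IsRootedCover G r U W 𝒟) (hW : W ⊆ U) (hR : R ⊆ U)
    (hWR : Disjoint W R) (h𝒟R : ∀ D ∈ 𝒟, IsAnticompletePair G D R) :
    ∃ Q, IsHub G (r + 1) ⟨U, W, R, 𝒟, Q⟩ := by
  have hpaths : ∀ D ∈ 𝒟, ∃ (w : V) (Q : V → Finset V), ∀ z ∈ W, Q z ⊆ D ∧ #(Q z) ≤ r + 1 ∧
      ∃ x ∈ Q z, G.Adj x z ∧ Relation.ReflTransGen (AdjIn G (Q z)) w x := by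
    intro D hD
    obtain ⟨w, hw⟩ := (h𝒟.rooted D hD).exists_root
    have hpath : ∀ z ∈ W, ∃ Q ⊆ D, #Q ≤ r + 1 ∧
        ∃ x ∈ Q, G.Adj x z ∧ Relation.ReflTransGen (AdjIn G Q) w x := by
      intro z hz
      obtain ⟨x, hx, hxz⟩ := h𝒟.covers D hD z hz
      obtain ⟨Q, hQD, hxQ, hcard, hconn⟩ := hw x hx
      exact ⟨Q, hQD, hcard, x, hxQ, hxz, hconn⟩
    choose! Q hQ using hpath
    exact ⟨w, Q, hQ⟩
  choose! w Q hQ using hpaths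
  refine ⟨Q, hW, hR, hWR, h𝒟.subset, h𝒟.disjoint, h𝒟R, h𝒟.anticomplete,
    fun D hD z hz ↦ (hQ D hD z hz).1, fun D hD z hz ↦ (hQ D hD z hz).2.1,
    fun D hD v hv z hz hvz hnadj ↦ ?_⟩
  obtain ⟨-, hcard_v, x, hx, hxv, hwx⟩ := hQ D hD v hv
  obtain ⟨-, hcard_z, y, hy, hyz, hwy⟩ := hQ D hD z hz
  obtain ⟨p, L, hp, hp0, hpL, hL2, hL, hpQ⟩ :=
    exists_isInducedPath_of_common_root hvz hnadj hwx hx hxv hwy hy hyz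
  exact ⟨p, L, hp, hp0, hpL, hL2, hL.trans (by omega), hpQ⟩

namespace Hub

variable {H : Hub V}

/-- Two centers conflict if they coincide, are adjacent, or one is adjacent to a root path of the
other. -/
def Conflict (G : SimpleGraph V) (H : Hub V) (u z : V) : Prop :=
  u = z ∨ G.Adj u z ∨ ∃ D ∈ H.𝒟, (∃ q ∈ H.Q D z, G.Adj u q) ∨ ∃ q ∈ H.Q D u, G.Adj z q

lemma Conflict.refl (G : SimpleGraph V) (H : Hub V) (u : V) : H.Conflict G u u := .inl rfl

lemma Conflict.symm (h : H.Conflict G u z) : H.Conflict G z u := by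
  obtain h | h | ⟨D, hD, h⟩ := h
  exacts [.inl h.symm, .inr (.inl h.symm), .inr (.inr ⟨D, hD, h.symm⟩)]

lemma Conflict.of_adj_left {q : V} (hD : D ∈ H.𝒟) (hq : q ∈ H.Q D z) (h : G.Adj u q) :
    H.Conflict G u z := .inr (.inr ⟨D, hD, .inl ⟨q, hq, h⟩⟩)

/-- The union of the root paths of `z`. -/
noncomputable def rootPaths (H : Hub V) (z : V) : Finset V := H.𝒟.biUnion fun D ↦ H.Q D z

lemma Conflict.mem_union (h : H.Conflict G u z) (hu : u ∈ U) (hz : z ∈ U) :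
    u = z ∨ z ∈ neighborsIn G {u} U ∨ u ∈ neighborsIn G (H.rootPaths z) U ∨
      z ∈ neighborsIn G (H.rootPaths u) U := by
  simp only [mem_neighborsIn, rootPaths, mem_biUnion]
  obtain h | h | ⟨D, hD, ⟨q, hq, h⟩ | ⟨q, hq, h⟩⟩ := h
  · exact .inl h
  · exact .inr (.inl ⟨hz, u, by simp, h⟩)
  · exact .inr (.inr (.inl ⟨hu, q, ⟨D, hD, hq⟩, h.symm⟩))
  · exact .inr (.inr (.inr ⟨hz, q, ⟨D, hD, hq⟩, h.symm⟩))

end Hub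

namespace IsHub

variable {H : Hub V}

lemma restrict (h : IsHub G k H) {W' : Finset V} (hW' : W' ⊆ H.W) :
    IsHub G k { H with W := W' } where
  W_subset := hW'.trans h.W_subset
  R_subset := h.R_subset
  disjoint_W_R := h.disjoint_W_R.mono_left hW'
  subset := h.subset
  disjoint D hD := (h.disjoint D hD).mono_right hW'
  anticomplete_R := h.anticomplete_R
  anticomplete := h.anticomplete
  Q_subset D hD z hz := h.Q_subset D hD z (hW' hz)
  card_Q_le D hD z hz := h.card_Q_le D hD z (hW' hz)
  exists_path D hD v hv z hz := h.exists_path D hD v (hW' hv) z (hW' hz)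

lemma card_neighborsIn_rootPaths_le (h : IsHub G k H) {Δ : ℝ} (hΔ : 0 ≤ Δ)
    (hdeg : ∀ u ∈ H.U, (degreeIn G u H.U : ℝ) ≤ Δ) (hz : z ∈ H.W) :
    (#(neighborsIn G (H.rootPaths z) H.U) : ℝ) ≤ #H.𝒟 * k * Δ := by
  have hsub : H.rootPaths z ⊆ H.U :=
    biUnion_subset.2 fun D hD ↦ (h.Q_subset D hD z hz).trans (h.subset D hD)
  have hcard : (#(H.rootPaths z) : ℝ) ≤ #H.𝒟 * k := by
    exact_mod_cast card_biUnion_le_card_mul _ _ k fun D hD ↦ h.card_Q_le D hD z hz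
  exact (card_neighborsIn_le _ _ fun x hx ↦ hdeg x (hsub hx)).trans
    (mul_le_mul_of_nonneg_right hcard hΔ)

lemma exists_restrict_card_conflict_le (h : IsHub G k H) {Δ : ℝ} (hΔ : 1 ≤ Δ)
    (hdeg : ∀ u ∈ H.U, (degreeIn G u H.U : ℝ) ≤ Δ) (h𝒟 : 1 ≤ #H.𝒟) (hk : 1 ≤ k) :
    ∃ W' ⊆ H.W, (#H.W : ℝ) ≤ 2 * #W' ∧
      ∀ u ∈ W', (#{z ∈ W' | H.Conflict G u z} : ℝ) ≤ (3 * (#H.𝒟 * k) + 2) * Δ := by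
  set c : ℝ := #H.𝒟 * k * Δ with hc
  have hcpos : 0 < c :=
    mul_pos (mul_pos (Nat.cast_pos.2 h𝒟) (Nat.cast_pos.2 hk)) (one_pos.trans_le hΔ)
  have hroot (z : V) (hz : z ∈ H.W) : (#(neighborsIn G (H.rootPaths z) H.U) : ℝ) ≤ c :=
    h.card_neighborsIn_rootPaths_le (zero_le_one.trans hΔ) hdeg hz
  obtain ⟨near, hnear⟩ : ∃ near : V → V → Prop,
      ∀ z u, near z u ↔ u ∈ neighborsIn G (H.rootPaths z) H.U := ⟨_, fun _ _ ↦ Iff.rfl⟩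
  -- Discard the centers adjacent to the root paths of many others: on average there are `c`.
  set crowded := {u ∈ H.W | 2 * c < #{z ∈ H.W | near z u}} with hcrowded
  have hcrowded_card : 2 * (#crowded : ℝ) ≤ #H.W :=
    mul_card_filter_lt_le (N := near) (c := c) (fun z hz ↦ le_trans
      (by exact_mod_cast card_le_card fun u hu ↦ (hnear z u).1 (mem_filter.1 hu).2) (hroot z hz))
      (by linarith) (by norm_num) (by linarith)
  refine ⟨H.W \ crowded, sdiff_subset, by linarith [card_sub_card_le_card_sdiff H.W crowded],
    fun u hu ↦ ?_⟩
  obtain ⟨huW, hu⟩ := mem_sdiff.1 hu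
  have hfew : (#{z ∈ H.W | near z u} : ℝ) ≤ 2 * c := by simpa [hcrowded, huW] using hu
  have hcover : {z ∈ H.W \ crowded | H.Conflict G u z} ⊆ ({u} ∪ neighborsIn G {u} H.U) ∪
      ({z ∈ H.W | near z u} ∪ neighborsIn G (H.rootPaths u) H.U) := fun z hz ↦ by
    obtain ⟨hz, hconf⟩ := mem_filter.1 hz
    have hzW := (mem_sdiff.1 hz).1
    have := hconf.mem_union (h.W_subset huW) (h.W_subset hzW)
    simp only [mem_union, mem_singleton, mem_filter, hzW, true_and, hnear]
    tauto
  have hdeg_u := hdeg u (h.W_subset huW)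
  rw [← card_neighborsIn_singleton] at hdeg_u
  have hcard := (Nat.cast_le (α := ℝ).2 (card_le_card hcover)).trans (cast_card_union_le _ _)
  have := cast_card_union_le {u} (neighborsIn G {u} H.U)
  rw [card_singleton, Nat.cast_one] at this
  linarith [cast_card_union_le {z ∈ H.W | near z u} (neighborsIn G (H.rootPaths u) H.U),
    hroot u huW, show (3 * (#H.𝒟 * k) + 2) * Δ = 3 * c + 2 * Δ by rw [hc]; ring]

end IsHub

end

/-! ### Threads through a hub -/

section

variable {V : Type*} {G : SimpleGraph V}

lemma IsAnticompletePair.compl_adj {A B : Finset V} (h : IsAnticompletePair G A B) {a b : V}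
    (ha : a ∈ A) (hb : b ∈ B) : Gᶜ.Adj a b :=
  (G.compl_adj a b).2 ⟨fun hab ↦ disjoint_left.1 h.1 ha (hab ▸ hb), h.2 a ha b hb⟩

lemma IsAnticompletePair.union_left {A A' B : Finset V} (h : IsAnticompletePair G A B)
    (h' : IsAnticompletePair G A' B) : IsAnticompletePair G (A ∪ A') B :=
  ⟨disjoint_union_left.2 ⟨h.1, h'.1⟩, fun x hx ↦ (mem_union.1 hx).elim (h.2 x) (h'.2 x)⟩

/-- `p` is an induced path of length `T` outside `S`, and `att u i` says whether `u ∈ S` is adjacent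
to its `i`-th vertex. -/
structure IsAttachedPath (G : SimpleGraph V) (S : Finset V) (att : V → ℕ → Prop) (p : ℕ → V)
    (T : ℕ) : Prop where
  isInducedPath : IsInducedPath G p T
  notMem : ∀ i ≤ T, p i ∉ S
  adj_iff : ∀ u ∈ S, ∀ i ≤ T, (G.Adj u (p i) ↔ att u i)

/-- The path `p` has no neighbor in `S` except that its two ends are joined to `v` and `v'`. Note
that `p` starts at a neighbor of `v`, not at `v`. -/
abbrev IsThread (G : SimpleGraph V) (S : Finset V) (v v' : V) (p : ℕ → V) (T : ℕ) : Prop :=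
  IsAttachedPath G S (fun u i ↦ u = v ∧ i = 0 ∨ u = v' ∧ i = T) p T

/-- The path `p` has no neighbor in `S` except that its first vertex is joined to `v`. -/
abbrev IsPendant (G : SimpleGraph V) (S : Finset V) (v : V) (p : ℕ → V) (T : ℕ) : Prop :=
  IsAttachedPath G S (fun u i ↦ u = v ∧ i = 0) p T

section Glue

variable {S : Finset V} {att att₁ att₂ : V → ℕ → Prop} {p q l : ℕ → V} {a b m T T' : ℕ} {v v' : V}

lemma pathSupport_gluePath_subset (h : p a = q 0) :
    pathSupport (gluePath p q a) (a + b) ⊆ pathSupport p a ∪ pathSupport q b := fun x hx ↦ by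
  obtain ⟨i, hi, rfl⟩ := mem_pathSupport.1 hx
  obtain hia | hai := le_total i a
  · exact mem_union_left _ (mem_pathSupport.2 ⟨i, hia, (gluePath_of_le hia).symm⟩)
  · exact mem_union_right _
      (mem_pathSupport.2 ⟨i - a, by omega, (gluePath_of_ge h hai).symm⟩)

lemma pathSupport_reverse : pathSupport (fun i ↦ p (T - i)) T = pathSupport p T := by
  ext x
  simp only [mem_pathSupport]
  refine ⟨fun ⟨i, _, hx⟩ ↦ ⟨T - i, T.sub_le i, hx⟩, fun ⟨i, hi, hx⟩ ↦ ⟨T - i, T.sub_le i, ?_⟩⟩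
  rwa [Nat.sub_sub_self hi]

namespace IsAttachedPath

lemma reverse (h : IsAttachedPath G S att p T) :
    IsAttachedPath G S (fun u i ↦ att u (T - i)) (fun i ↦ p (T - i)) T :=
  ⟨h.isInducedPath.reverse, fun i _ ↦ h.notMem _ (T.sub_le i),
    fun u hu i _ ↦ h.adj_iff u hu _ (T.sub_le i)⟩

lemma glue (hp : IsAttachedPath G S att₁ p a) (hq : IsAttachedPath G S att₂ q b) (hpq : p a = q 0)
    (hfar : ∀ i j, i < a → 0 < j → j ≤ b → Gᶜ.Adj (p i) (q j))
    (h₁ : ∀ u, ∀ i ≤ a, (att u i ↔ att₁ u i))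
    (h₂ : ∀ u i, a < i → i ≤ a + b → (att u i ↔ att₂ u (i - a))) :
    IsAttachedPath G S att (gluePath p q a) (a + b) where
  isInducedPath := hp.isInducedPath.glue hq.isInducedPath hpq hfar
  notMem i hi := by
    obtain hia | hai := le_total i a
    · exact gluePath_of_le hia ▸ hp.notMem i hia
    · exact gluePath_of_ge hpq hai ▸ hq.notMem (i - a) (by omega)
  adj_iff u hu i hi := by
    obtain hia | hai := le_or_gt i a
    · rw [gluePath_of_le hia, h₁ u i hia, hp.adj_iff u hu i hia]
    · rw [gluePath_of_ge hpq hai.le, h₂ u i hai hi, hq.adj_iff u hu (i - a) (by omega)]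

end IsAttachedPath

lemma IsPendant.exists_isThread (hp : IsPendant G S v p a) (hq : IsPendant G S v' q b)
    (hl : IsAttachedPath G S (fun _ _ ↦ False) l m) (hb : 0 < b) (hpl : p a = l 0)
    (hql : q b = l m) (hpl_far : ∀ i < a, ∀ j, 0 < j → j ≤ m → Gᶜ.Adj (p i) (l j))
    (hql_far : ∀ i < b, ∀ j < m, Gᶜ.Adj (q i) (l j))
    (hpq_far : ∀ i < a, ∀ j < b, Gᶜ.Adj (p i) (q j)) :
    ∃ g, IsThread G S v v' g (a + m + b) ∧
      pathSupport g (a + m + b) ⊆ pathSupport p a ∪ pathSupport l m ∪ pathSupport q b := by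
  have hleft : IsPendant G S v (gluePath p l a) (a + m) :=
    hp.glue hl hpl (fun i j hi ↦ hpl_far i hi j) (fun _ _ _ ↦ Iff.rfl) fun _ _ _ _ ↦ by
      simp only [iff_false, not_and]
      omega
  have hlast : gluePath p l a (a + m) = q (b - 0) := by
    rw [gluePath_of_ge hpl (a.le_add_right m), Nat.add_sub_cancel_left, Nat.sub_zero, hql]
  refine ⟨gluePath (gluePath p l a) (fun i ↦ q (b - i)) (a + m),
    hleft.glue hq.reverse hlast (fun i j hi hj hjb ↦ ?_) (fun u i hi ↦ ?_) fun u i hi hib ↦ ?_, ?_⟩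
  · obtain hia | hai := lt_or_ge i a
    · exact gluePath_of_le (p := p) hia.le ▸ hpq_far i hia (b - j) (by omega)
    · exact gluePath_of_ge hpl hai ▸ (hql_far (b - j) (by omega) (i - a) (by omega)).symm
  · simp only [or_iff_left_iff_imp]
    omega
  · simp only [show i ≠ 0 by omega, show b - (i - (a + m)) = 0 ↔ i = a + m + b by omega,
      and_false, false_or]
  · exact (pathSupport_gluePath_subset hlast).trans
      (union_subset_union (pathSupport_gluePath_subset hpl) pathSupport_reverse.subset)

end Glue

/-- A hub in a linking set with room for embedding a graph with at most `f` vertices. -/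
structure IsRichHub (G : SimpleGraph V) (c : LinkConstants) (k f : ℕ) (H : Hub V) : Prop where
  isHub : IsHub G k H
  linking : IsLinkingSet G c H.U
  card_conflict_le : ∀ u ∈ H.W, (#{z ∈ H.W | H.Conflict G u z} : ℝ) ≤ c.C * c.Δ
  two_mul_mul_y_le_card_W : 2 * ((2 * k + 1) * c.y) ≤ #H.W
  two_mul_mul_β_le_card_W : 2 * (f * ((c.C + 1) * c.β)) ≤ #H.W
  two_mul_mul_y_le_card_R : 2 * (c.y * 3 ^ (c.J + 1)) ≤ #H.R
  four_mul_mul_β_le_card_R : 4 * (f * c.β) ≤ #H.R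

/-- The invariant of the embedding process: `F` is the set of vertices used so far, and `𝒰` consists
of members of `𝒟` that are still unused. -/
structure IsEmbeddingState (G : SimpleGraph V) (H : Hub V) (F : Finset V) (𝒰 : Finset (Finset V)) :
    Prop where
  subset_U : F ⊆ H.U
  subset_𝒟 : 𝒰 ⊆ H.𝒟
  anticomplete : ∀ D ∈ 𝒰, IsAnticompletePair G (F \ H.W) D
  not_conflict : ∀ u ∈ F, u ∈ H.W → ∀ z ∈ F, z ∈ H.W → u ≠ z → ¬ H.Conflict G u z

/-- The members of `W` that may become new centers when the vertices in `F` are in use. -/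
noncomputable def Hub.candidates (G : SimpleGraph V) (H : Hub V) (F : Finset V) : Finset V :=
  {z ∈ H.W | ∀ u ∈ F, Gᶜ.Adj u z ∧ (u ∈ H.W → ¬ H.Conflict G u z)}

/-- `p` leads from a neighbor of the center `v` through `D` to the candidate `z`, along the root
paths of `v` and `z` in `D`. -/
structure IsLeg (G : SimpleGraph V) (H : Hub V) (F D : Finset V) (v z : V) (p : ℕ → V) (L : ℕ) :
    Prop where
  isPendant : IsPendant G F v p L
  pos : 0 < L
  last : p L = z
  mem_rootPath : ∀ i < L, p i ∈ H.Q D v ∪ H.Q D z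

variable {c : LinkConstants} {k f : ℕ} {H : Hub V} {F F' D D' A B : Finset V}
  {𝒰 𝒰' : Finset (Finset V)} {v v' z z' : V} {p q l : ℕ → V} {L a b m : ℕ}

lemma Hub.mem_candidates : z ∈ H.candidates G F ↔
    z ∈ H.W ∧ ∀ u ∈ F, Gᶜ.Adj u z ∧ (u ∈ H.W → ¬ H.Conflict G u z) := mem_filter

lemma Hub.candidates_subset : H.candidates G F ⊆ H.W := filter_subset _ _

lemma Hub.compl_adj_of_mem_candidates (hz : z ∈ H.candidates G F) (hv : v ∈ F) : Gᶜ.Adj v z :=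
  ((Hub.mem_candidates.1 hz).2 v hv).1

lemma Hub.not_conflict_of_mem_candidates (hz : z ∈ H.candidates G F) (hv : v ∈ F) (hvW : v ∈ H.W) :
    ¬ H.Conflict G v z :=
  ((Hub.mem_candidates.1 hz).2 v hv).2 hvW

lemma Hub.notMem_of_mem_candidates (hz : z ∈ H.candidates G F) : z ∉ F := fun hzF ↦
  (Hub.compl_adj_of_mem_candidates hz hzF).ne rfl

lemma Hub.Conflict.compl_adj_of_not (h : ¬ H.Conflict G v z) : Gᶜ.Adj v z :=
  (G.compl_adj v z).2 ⟨fun hvz ↦ h (.inl hvz), fun hvz ↦ h (.inr (.inl hvz))⟩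

namespace IsEmbeddingState

lemma mono (h : IsEmbeddingState G H F 𝒰) (hF : F' ⊆ F) (h𝒰 : 𝒰' ⊆ 𝒰) :
    IsEmbeddingState G H F' 𝒰' where
  subset_U := hF.trans h.subset_U
  subset_𝒟 := h𝒰.trans h.subset_𝒟
  anticomplete D hD := (h.anticomplete D (h𝒰 hD)).mono (sdiff_subset_sdiff hF subset_rfl) subset_rfl
  not_conflict u hu huW z hz := h.not_conflict u (hF hu) huW z (hF hz)

lemma insert_center (h : IsEmbeddingState G H F 𝒰) (hWU : H.W ⊆ H.U)
    (hz : z ∈ H.candidates G F) : IsEmbeddingState G H (insert z F) 𝒰 where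
  subset_U := insert_subset (hWU (Hub.candidates_subset hz)) h.subset_U
  subset_𝒟 := h.subset_𝒟
  anticomplete D hD := by
    rw [insert_sdiff_of_mem _ (Hub.candidates_subset hz)]
    exact h.anticomplete D hD
  not_conflict u hu huW x hx hxW hux := by
    obtain rfl | huF := mem_insert.1 hu
    · exact fun hc ↦ Hub.not_conflict_of_mem_candidates hz (mem_of_mem_insert_of_ne hx hux.symm) hxW
        hc.symm
    obtain rfl | hxF := mem_insert.1 hx
    · exact Hub.not_conflict_of_mem_candidates hz huF huW
    · exact h.not_conflict u huF huW x hxF hxW hux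

lemma union_of_disjoint_W (h : IsEmbeddingState G H F 𝒰) {S : Finset V} (hSU : S ⊆ H.U)
    (hSW : Disjoint S H.W) (hS𝒰 : ∀ D ∈ 𝒰, IsAnticompletePair G S D) :
    IsEmbeddingState G H (F ∪ S) 𝒰 where
  subset_U := union_subset h.subset_U hSU
  subset_𝒟 := h.subset_𝒟
  anticomplete D hD := by
    rw [union_sdiff_distrib, sdiff_eq_self_of_disjoint hSW]
    exact (h.anticomplete D hD).union_left (hS𝒰 D hD)
  not_conflict u hu huW x hx hxW := by
    have hmem {y : V} (hy : y ∈ F ∪ S) (hyW : y ∈ H.W) : y ∈ F :=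
      (mem_union.1 hy).resolve_right fun hyS ↦ disjoint_left.1 hSW hyS hyW
    exact h.not_conflict u (hmem hu huW) huW x (hmem hx hxW) hxW

lemma eq_center_of_adj (h : IsEmbeddingState G H F 𝒰) (hH : IsHub G k H) (hD : D ∈ 𝒰)
    (hv : v ∈ F) (hvW : v ∈ H.W) (hz : z ∈ H.candidates G F) {x u : V}
    (hx : x ∈ H.Q D v ∪ H.Q D z) (hu : u ∈ F) (hadj : G.Adj u x) : u = v := by
  have hD𝒟 := h.subset_𝒟 hD
  have hzW := Hub.candidates_subset hz
  by_contra huv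
  by_cases huW : u ∈ H.W
  · obtain hx | hx := mem_union.1 hx
    · exact h.not_conflict u hu huW v hv hvW huv (.of_adj_left hD𝒟 hx hadj)
    · exact Hub.not_conflict_of_mem_candidates hz hu huW (.of_adj_left hD𝒟 hx hadj)
  · exact (h.anticomplete D hD).2 u (mem_sdiff.2 ⟨hu, huW⟩) x
      (union_subset (hH.Q_subset D hD𝒟 v hvW) (hH.Q_subset D hD𝒟 z hzW) hx) hadj

end IsEmbeddingState

namespace IsLeg

variable {x : V} {i : ℕ}

lemma mem (h : IsLeg G H F D v z p L) (hH : IsHub G k H) (hD : D ∈ H.𝒟) (hv : v ∈ H.W)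
    (hz : z ∈ H.W) (hi : i < L) : p i ∈ D :=
  union_subset (hH.Q_subset D hD v hv) (hH.Q_subset D hD z hz) (h.mem_rootPath i hi)

lemma pathSupport_subset (h : IsLeg G H F D v z p L) (hH : IsHub G k H) (hD : D ∈ H.𝒟)
    (hv : v ∈ H.W) (hz : z ∈ H.W) : pathSupport p L ⊆ insert z D := fun x hx ↦ by
  obtain ⟨i, hi, rfl⟩ := mem_pathSupport.1 hx
  obtain hi | rfl := hi.lt_or_eq
  · exact mem_insert_of_mem (h.mem hH hD hv hz hi)
  · exact h.last ▸ mem_insert_self _ _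

lemma compl_adj_of_mem_W (h : IsLeg G H F D v z p L) (hH : IsHub G k H) (hD : D ∈ H.𝒟)
    (hv : v ∈ H.W) (hz : z ∈ H.W) (hx : x ∈ H.W) (hxv : ¬ H.Conflict G x v)
    (hxz : ¬ H.Conflict G x z) (hi : i < L) : Gᶜ.Adj (p i) x := by
  refine (G.compl_adj _ _).2 ⟨fun hpx ↦ ?_, fun hadj ↦ ?_⟩
  · exact disjoint_left.1 (hH.disjoint D hD) (h.mem hH hD hv hz hi) (hpx ▸ hx)
  · obtain hq | hq := mem_union.1 (h.mem_rootPath i hi)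
    exacts [hxv (.of_adj_left hD hq hadj.symm), hxz (.of_adj_left hD hq hadj.symm)]

end IsLeg

lemma IsEmbeddingState.exists_isLeg (h : IsEmbeddingState G H F 𝒰) (hH : IsHub G k H)
    (hD : D ∈ 𝒰) (hv : v ∈ F) (hvW : v ∈ H.W) (hz : z ∈ H.candidates G F) :
    ∃ L ≤ 2 * k, ∃ p, IsLeg G H F D v z p L := by
  have hD𝒟 := h.subset_𝒟 hD
  have hzW := Hub.candidates_subset hz
  obtain ⟨hvz, hnadj⟩ := (G.compl_adj _ _).1 (Hub.compl_adj_of_mem_candidates hz hv)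
  obtain ⟨p, L, hp, rfl, rfl, hL2, hL, hpQ⟩ := hH.exists_path D hD𝒟 v hvW z hzW hvz hnadj
  obtain ⟨L, rfl⟩ : ∃ L', L = 1 + L' := ⟨L - 1, by omega⟩
  refine ⟨L, by omega, fun i ↦ p (1 + i), ⟨hp.shift, fun i hi hpF ↦ ?_, fun u hu i hi ↦ ?_⟩,
    by omega, rfl, fun i hi ↦ hpQ (1 + i) (by omega) (by omega)⟩
  all_goals obtain hi | rfl := hi.lt_or_eq
  · have hpD : p (1 + i) ∈ D := union_subset (hH.Q_subset D hD𝒟 _ hvW) (hH.Q_subset D hD𝒟 _ hzW)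
      (hpQ (1 + i) (by omega) (by omega))
    have hpW : p (1 + i) ∉ H.W := disjoint_left.1 (hH.disjoint D hD𝒟) hpD
    exact disjoint_left.1 (h.anticomplete D hD).1 (mem_sdiff.2 ⟨hpF, hpW⟩) hpD
  · exact Hub.notMem_of_mem_candidates hz hpF
  · refine ⟨fun hadj ↦ ?_, ?_⟩
    · obtain rfl := h.eq_center_of_adj hH hD hv hvW hz (hpQ (1 + i) (by omega) (by omega)) hu hadj
      exact ⟨rfl, by simpa using (hp.adj_iff 0 (1 + i) (by omega) (by omega)).1 hadj⟩
    · rintro ⟨rfl, rfl⟩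
      exact (hp.adj_iff 0 1 one_pos (by omega)).2 rfl
  · exact iff_of_false ((G.compl_adj _ _).1 (Hub.compl_adj_of_mem_candidates hz hu)).2 (by omega)

lemma IsEmbeddingState.union_of_subset (h : IsEmbeddingState G H F 𝒰) (hH : IsHub G k H)
    (hD : D ∈ 𝒰) (hD' : D' ∈ 𝒰) (hz : z ∈ H.candidates G F) (hz' : z' ∈ H.candidates G F)
    (hzz' : ¬ H.Conflict G z z') {S : Finset V} (hS : S ⊆ {z', z} ∪ (D ∪ H.R ∪ D')) :
    IsEmbeddingState G H (F ∪ S) ((𝒰.erase D).erase D') := by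
  have hD𝒟 := h.subset_𝒟 hD
  have hD'𝒟 := h.subset_𝒟 hD'
  have hz'_insert : z' ∈ H.candidates G (insert z F) :=
    Hub.mem_candidates.2 ⟨Hub.candidates_subset hz', fun u hu ↦ by
      obtain rfl | hu := mem_insert.1 hu
      · exact ⟨Hub.Conflict.compl_adj_of_not hzz', fun _ ↦ hzz'⟩
      · exact (Hub.mem_candidates.1 hz').2 u hu⟩
  have hcenters := (h.insert_center hH.W_subset hz).insert_center hH.W_subset hz'_insert
  have hunion := (hcenters.mono (𝒰' := (𝒰.erase D).erase D') subset_rfl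
    ((erase_subset _ _).trans (erase_subset _ _))).union_of_disjoint_W (S := D ∪ H.R ∪ D')
    (union_subset (union_subset (hH.subset D hD𝒟) hH.R_subset) (hH.subset D' hD'𝒟))
    (disjoint_union_left.2 ⟨disjoint_union_left.2 ⟨hH.disjoint D hD𝒟, hH.disjoint_W_R.symm⟩,
      hH.disjoint D' hD'𝒟⟩) ?_
  · refine hunion.mono (union_subset (fun x hx ↦ ?_) (hS.trans fun x hx ↦ ?_)) subset_rfl
    all_goals simp only [mem_union, mem_insert, mem_singleton] at hx ⊢; tauto
  · intro E hE
    obtain ⟨hED', hED, hE⟩ : E ≠ D' ∧ E ≠ D ∧ E ∈ 𝒰 := by simpa using hE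
    have hE𝒟 := h.subset_𝒟 hE
    exact ((hH.anticomplete hD𝒟 hE𝒟 hED.symm).union_left (hH.anticomplete_R E hE𝒟).symm).union_left
      (hH.anticomplete hD'𝒟 hE𝒟 hED'.symm)

lemma IsLeg.exists_isThread (hp : IsLeg G H F D v z p a) (hq : IsLeg G H F D' v' z' q b)
    (hH : IsHub G k H) (hD : D ∈ H.𝒟) (hD' : D' ∈ H.𝒟) (hDD' : D ≠ D')
    (hv : v ∈ F) (hvW : v ∈ H.W) (hv' : v' ∈ F) (hv'W : v' ∈ H.W) (hz : z ∈ H.candidates G F)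
    (hz' : z' ∈ H.candidates G F) (hzz' : ¬ H.Conflict G z z')
    (hl : IsAttachedPath G F (fun _ _ ↦ False) l m) (hl0 : l 0 = z) (hlm : l m = z')
    (hlR : ∀ i, 0 < i → i < m → l i ∈ H.R) :
    ∃ g, IsThread G F v v' g (a + m + b) ∧
      pathSupport g (a + m + b) ⊆ {z', z} ∪ (D ∪ H.R ∪ D') := by
  have hzW := Hub.candidates_subset hz
  have hz'W := Hub.candidates_subset hz'
  have hpl : ∀ i < a, ∀ j, 0 < j → j ≤ m → Gᶜ.Adj (p i) (l j) := fun i hi j hj hjm ↦ by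
    obtain hjm | rfl := hjm.lt_or_eq
    · exact (hH.anticomplete_R D hD).compl_adj (hp.mem hH hD hvW hzW hi) (hlR j hj hjm)
    · exact hlm ▸ hp.compl_adj_of_mem_W hH hD hvW hzW hz'W
        (fun hc ↦ Hub.not_conflict_of_mem_candidates hz' hv hvW hc.symm)
        (fun hc ↦ hzz' hc.symm) hi
  have hql : ∀ i < b, ∀ j < m, Gᶜ.Adj (q i) (l j) := fun i hi j hj ↦ by
    obtain rfl | h0 := j.eq_zero_or_pos
    · exact hl0 ▸ hq.compl_adj_of_mem_W hH hD' hv'W hz'W hzW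
        (fun hc ↦ Hub.not_conflict_of_mem_candidates hz hv' hv'W hc.symm) hzz' hi
    · exact (hH.anticomplete_R D' hD').compl_adj (hq.mem hH hD' hv'W hz'W hi) (hlR j h0 hj)
  obtain ⟨g, hg, hsupp⟩ := hp.isPendant.exists_isThread hq.isPendant hl hq.pos
    (hp.last.trans hl0.symm) (hq.last.trans hlm.symm) hpl hql fun i hi j hj ↦
      (hH.anticomplete hD hD' hDD').compl_adj (hp.mem hH hD hvW hzW hi) (hq.mem hH hD' hv'W hz'W hj)
  refine ⟨g, hg, hsupp.trans (union_subset (union_subset ?_ fun x hx ↦ ?_) ?_)⟩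
  · exact (hp.pathSupport_subset hH hD hvW hzW).trans (by grind)
  · obtain ⟨i, hi, rfl⟩ := mem_pathSupport.1 hx
    obtain rfl | h0 := i.eq_zero_or_pos
    · simp [hl0]
    obtain rfl | hi := hi.eq_or_lt
    · simp [hlm]
    · simp [hlR i h0 hi]
  · exact (hq.pathSupport_subset hH hD' hv'W hz'W).trans (by grind)

namespace IsRichHub

lemma card_W_le_two_mul_card_candidates (hH : IsRichHub G c k f H) (hF : F ⊆ H.U) (hf : #F ≤ f) :
    (#H.W : ℝ) ≤ 2 * #(H.candidates G F) := by
  have hβ := hH.linking.β_pos.le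
  have hC := hH.linking.C_nonneg
  have hcover : H.W ⊆ H.candidates G F ∪
      ((F ∩ H.W).biUnion (fun u ↦ {z ∈ H.W | H.Conflict G u z}) ∪ neighborsIn G F H.W) := by
    intro z hz
    simp only [mem_union, Hub.mem_candidates, mem_biUnion, mem_inter, mem_filter, mem_neighborsIn,
      G.compl_adj, hz, true_and]
    by_contra! hzF
    obtain ⟨⟨u, hu, huz⟩, hconf, hnadj⟩ := hzF
    obtain ⟨huW, hc⟩ := huz
      ⟨fun huz ↦ hconf u ⟨hu, huz ▸ hz⟩ (huz ▸ .refl G H u), hnadj u hu⟩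
    exact hconf u ⟨hu, huW⟩ hc
  have hconf : (#((F ∩ H.W).biUnion fun u ↦ {z ∈ H.W | H.Conflict G u z}) : ℝ) ≤
      #F * (c.C * c.β) := by
    calc (#((F ∩ H.W).biUnion fun u ↦ {z ∈ H.W | H.Conflict G u z}) : ℝ)
        ≤ ∑ u ∈ F ∩ H.W, (#{z ∈ H.W | H.Conflict G u z} : ℝ) := by exact_mod_cast card_biUnion_le
      _ ≤ ∑ _ ∈ F ∩ H.W, c.C * c.β := sum_le_sum fun u hu ↦ (hH.card_conflict_le u
          (mem_inter.1 hu).2).trans (mul_le_mul_of_nonneg_left hH.linking.Δ_le_β hC)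
      _ = #(F ∩ H.W) * (c.C * c.β) := by rw [sum_const, nsmul_eq_mul]
      _ ≤ #F * (c.C * c.β) := by gcongr; exact inter_subset_left
  have hnbrs : (#(neighborsIn G F H.W) : ℝ) ≤ #F * c.β := card_neighborsIn_le F H.W fun u hu ↦
    le_trans (by exact_mod_cast degreeIn_mono u hH.isHub.W_subset)
      (hH.linking.degreeIn_le_β (hF hu))
  have hFf : (#F : ℝ) * ((c.C + 1) * c.β) ≤ f * ((c.C + 1) * c.β) := by gcongr
  have hcard := (Nat.cast_le (α := ℝ).2 (card_le_card hcover)).trans (cast_card_union_le _ _)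
  have hunion := cast_card_union_le ((F ∩ H.W).biUnion fun u ↦ {z ∈ H.W | H.Conflict G u z})
    (neighborsIn G F H.W)
  linarith [hH.two_mul_mul_β_le_card_W]

lemma y_pos (hH : IsRichHub G c k f H) : 0 < c.y := by
  linarith [hH.linking.eight_mul_β_le, hH.linking.β_pos]

lemma mul_y_le_card_candidates (hH : IsRichHub G c k f H) (hF : F ⊆ H.U) (hf : #F ≤ f) :
    (2 * k + 1) * c.y ≤ #(H.candidates G F) := by
  linarith [hH.card_W_le_two_mul_card_candidates hF hf, hH.two_mul_mul_y_le_card_W]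

lemma exists_center (hH : IsRichHub G c k f H) (h : IsEmbeddingState G H F 𝒰) (hf : #F ≤ f) :
    ∃ z ∈ H.W, (∀ u ∈ F, Gᶜ.Adj u z) ∧ IsEmbeddingState G H (insert z F) 𝒰 := by
  have hpos : (0 : ℝ) < #(H.candidates G F) :=
    (mul_pos (by positivity) hH.y_pos).trans_le (hH.mul_y_le_card_candidates h.subset_U hf)
  obtain ⟨z, hz⟩ := card_pos.1 (Nat.cast_pos.1 hpos)
  exact ⟨z, Hub.candidates_subset hz, fun u ↦ Hub.compl_adj_of_mem_candidates hz,
    h.insert_center hH.isHub.W_subset hz⟩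

lemma exists_legs (hH : IsRichHub G c k f H) (h : IsEmbeddingState G H F 𝒰) (hf : #F ≤ f)
    (hD : D ∈ 𝒰) (hv : v ∈ F) (hvW : v ∈ H.W) :
    ∃ L ≤ 2 * k, ∃ A ⊆ H.candidates G F, c.y ≤ #A ∧ ∀ z ∈ A, ∃ p, IsLeg G H F D v z p L := by
  have hleg := fun z ↦ h.exists_isLeg hH.isHub hD hv hvW (z := z)
  choose! len hlen hleg using hleg
  obtain ⟨L, hL, hcard⟩ := exists_le_card_fiber_of_nsmul_le_card_of_maps_to (b := c.y)
    (s := H.candidates G F) (t := range (2 * k + 1)) (f := len)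
    (fun z hz ↦ mem_range.2 (Nat.lt_succ_of_le (hlen z hz))) ⟨0, by simp⟩
    (by simpa using hH.mul_y_le_card_candidates h.subset_U hf)
  refine ⟨L, Nat.lt_succ_iff.1 (mem_range.1 hL), _, filter_subset _ _, hcard, fun z hz ↦ ?_⟩
  obtain ⟨hzF, rfl⟩ := mem_filter.1 hz
  exact hleg z hzF

lemma mul_y_le_card_sdiff (hH : IsRichHub G c k f H) (hF : F ⊆ H.U) (hf : #F ≤ f) {j : ℕ}
    (hj : j ≤ c.J) : c.y * 3 ^ (j + 1) ≤ #(H.R \ (F ∪ neighborsIn G F H.R)) := by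
  have hnbrs : (#(neighborsIn G F H.R) : ℝ) ≤ #F * c.β := card_neighborsIn_le F H.R fun u hu ↦
    le_trans (by exact_mod_cast degreeIn_mono u hH.isHub.R_subset)
      (hH.linking.degreeIn_le_β (hF hu))
  have hFf : (#F : ℝ) * c.β ≤ f * c.β := by
    have := hH.linking.β_pos
    gcongr
  have hFβ : (#F : ℝ) ≤ #F * c.β := le_mul_of_one_le_right (Nat.cast_nonneg _)
    (hH.linking.one_le_Δ.trans hH.linking.Δ_le_β)
  have hpow : c.y * 3 ^ (j + 1) ≤ c.y * 3 ^ (c.J + 1) := by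
    have := hH.y_pos
    gcongr
    norm_num
  linarith [card_sub_card_le_card_sdiff H.R (F ∪ neighborsIn G F H.R),
    cast_card_union_le F (neighborsIn G F H.R), hH.two_mul_mul_y_le_card_R,
    hH.four_mul_mul_β_le_card_R]

lemma exists_link (hH : IsRichHub G c k f H) (hF : F ⊆ H.U) (hf : #F ≤ f)
    (hA : A ⊆ H.candidates G F) (hB : B ⊆ H.candidates G F) (hyA : c.y ≤ #A) (hyB : c.y ≤ #B)
    {j : ℕ} (hj : j ≤ c.J) :
    ∃ l, IsAttachedPath G F (fun _ _ ↦ False) l (j + 3) ∧ l 0 ∈ A ∧ l (j + 3) ∈ B ∧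
      ¬ H.Conflict G (l 0) (l (j + 3)) ∧ ∀ i, 0 < i → i < j + 3 → l i ∈ H.R := by
  set R := H.R \ (F ∪ neighborsIn G F H.R)
  have hAW := hA.trans Hub.candidates_subset
  have hBW := hB.trans Hub.candidates_subset
  have hWU := hH.isHub.W_subset
  have hWR : Disjoint H.W R := hH.isHub.disjoint_W_R.mono_right sdiff_subset
  obtain ⟨l, hl, hl0, hlj, hconf, hlR⟩ := hH.linking.exists_link (hAW.trans hWU) (hBW.trans hWU)
    (sdiff_subset.trans hH.isHub.R_subset) (hWR.mono_left hAW) (hWR.mono_left hBW)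
    (Hub.Conflict.refl G H) (fun a ha ↦ le_trans
      (by exact_mod_cast card_le_card (filter_subset_filter _ hBW))
      (hH.card_conflict_le a (hAW ha)))
    hyA hyB hj (hH.mul_y_le_card_sdiff hF hf hj)
  have hfar : ∀ i ≤ j + 3, ∀ u ∈ F, Gᶜ.Adj u (l i) := by
    intro i hi u hu
    obtain rfl | h0 := i.eq_zero_or_pos
    · exact Hub.compl_adj_of_mem_candidates (hA hl0) hu
    obtain hi | rfl := hi.lt_or_eq
    · have hli := hlR i h0 hi
      simp only [mem_sdiff, mem_union, mem_neighborsIn] at hli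
      exact (G.compl_adj _ _).2 ⟨fun hul ↦ hli.2 (.inl (hul ▸ hu)),
        fun hadj ↦ hli.2 (.inr ⟨hli.1, u, hu, hadj⟩)⟩
    · exact Hub.compl_adj_of_mem_candidates (hB hlj) hu
  exact ⟨l, ⟨hl, fun i hi hlF ↦ (hfar i hi _ hlF).ne rfl,
    fun u hu i hi ↦ iff_false_intro ((G.compl_adj _ _).1 (hfar i hi u hu)).2⟩, hl0, hlj, hconf,
    fun i h0 hi ↦ sdiff_subset (hlR i h0 hi)⟩

lemma exists_thread (hH : IsRichHub G c k f H) (h : IsEmbeddingState G H F 𝒰) (hf : #F ≤ f)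
    (hv : v ∈ F) (hvW : v ∈ H.W) (hv' : v' ∈ F) (hv'W : v' ∈ H.W) (hD : D ∈ 𝒰) (hD' : D' ∈ 𝒰)
    (hDD' : D ≠ D') {T : ℕ} (hT : 4 * k + 3 ≤ T) (hTJ : T ≤ c.J) :
    ∃ p, IsThread G F v v' p T ∧
      IsEmbeddingState G H (F ∪ pathSupport p T) ((𝒰.erase D).erase D') := by
  obtain ⟨a, ha, A, hA, hyA, hlegA⟩ := hH.exists_legs h hf hD hv hvW
  obtain ⟨b, hb, B, hB, hyB, hlegB⟩ := hH.exists_legs h hf hD' hv' hv'W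
  obtain ⟨j, rfl⟩ : ∃ j, T = a + (j + 3) + b := ⟨T - a - b - 3, by omega⟩
  obtain ⟨l, hl, hlA, hlB, hconf, hlR⟩ :=
    hH.exists_link h.subset_U hf hA hB hyA hyB (j := j) (by omega)
  obtain ⟨p, hp⟩ := hlegA _ hlA
  obtain ⟨q, hq⟩ := hlegB _ hlB
  obtain ⟨g, hg, hsupp⟩ := hp.exists_isThread hq hH.isHub (h.subset_𝒟 hD) (h.subset_𝒟 hD') hDD' hv
    hvW hv' hv'W (hA hlA) (hB hlB) hconf hl rfl rfl hlR
  exact ⟨g, hg, h.union_of_subset hH.isHub hD hD' (hA hlA) (hB hlB) hconf hsupp⟩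

end IsRichHub

end

/-! ### Building graphs of large branch-length -/

section

variable {X : Type*} {H : SimpleGraph X} {p : ℕ → X} {L : ℕ}

/-- `Buildable H m S C` says that `S` can be built from the empty set by adding isolated vertices
(the centers, collected in `C`), threads of length at least `m` between centers, and paths attached
to a center by one end. The length of a thread does not count the two edges to its centers. -/
inductive Buildable (H : SimpleGraph X) (m : ℕ) : Finset X → Finset X → Prop
  | empty : Buildable H m ∅ ∅
  | center {S C : Finset X} {x : X} (h : Buildable H m S C) (hx : ∀ u ∈ S, Hᶜ.Adj u x) :
      Buildable H m (insert x S) (insert x C)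
  | thread {S C : Finset X} {c c' : X} {p : ℕ → X} {T : ℕ} (h : Buildable H m S C) (hc : c ∈ C)
      (hc' : c' ∈ C) (hT : m ≤ T) (hp : IsThread H S c c' p T) :
      Buildable H m (S ∪ pathSupport p T) C
  | pendant {S C : Finset X} {c : X} {p : ℕ → X} {T : ℕ} (h : Buildable H m S C) (hc : c ∈ C)
      (hp : IsPendant H S c p T) : Buildable H m (S ∪ pathSupport p T) C

lemma Buildable.subset {m : ℕ} {S C : Finset X} (h : Buildable H m S C) : C ⊆ S := by
  induction h with
  | empty => exact Subset.rfl
  | center _ _ ih => exact insert_subset_insert _ ih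
  | thread _ _ _ _ _ ih => exact ih.trans subset_union_left
  | pendant _ _ _ ih => exact ih.trans subset_union_left

lemma buildable_of_isAnticlique {m : ℕ} (B : Finset X) (hB : (B : Set X).Pairwise Hᶜ.Adj) :
    Buildable H m B B := by
  induction B using Finset.induction_on with
  | empty => exact .empty
  | insert x B hx ih =>
    refine .center (ih (hB.mono (mod_cast subset_insert x B))) fun u hu ↦ ?_
    exact hB (mem_insert_of_mem hu) (mem_insert_self x B) fun hux ↦ hx (hux ▸ hu)

lemma exists_walk_of_adj (f : ℕ → X) (n : ℕ) (hf : ∀ i < n, H.Adj (f i) (f (i + 1))) :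
    ∃ q : H.Walk (f 0) (f n), q.length = n ∧ q.support = (List.range (n + 1)).map f ∧
      ∀ e ∈ q.edges, ∃ i < n, e = s(f i, f (i + 1)) := by
  induction n generalizing f with
  | zero => exact ⟨.nil, rfl, by simp, by simp⟩
  | succ n ih =>
    obtain ⟨q, hlength, hsupport, hedges⟩ :=
      ih (fun i ↦ f (i + 1)) fun i hi ↦ hf (i + 1) (by omega)
    refine ⟨.cons (hf 0 n.succ_pos) q, by simp [hlength], ?_, fun e he ↦ ?_⟩
    · rw [SimpleGraph.Walk.support_cons, hsupport, List.range_succ_eq_map (n := n + 1)]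
      simp [List.map_map, Function.comp_def]
    · obtain rfl | he := List.mem_cons.1 (SimpleGraph.Walk.edges_cons _ q ▸ he)
      · exact ⟨0, n.succ_pos, rfl⟩
      · obtain ⟨i, hi, rfl⟩ := hedges e he
        exact ⟨i + 1, by omega, rfl⟩

lemma exists_isCycle_of_injOn {f : ℕ → X} {n : ℕ} (hn : 2 ≤ n) (hinj : Set.InjOn f (Set.Iic n))
    (hf : ∀ i < n, H.Adj (f i) (f (i + 1))) (hclose : H.Adj (f n) (f 0)) :
    ∃ q : H.Walk (f n) (f n), q.IsCycle ∧ q.length = n + 1 := by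
  obtain ⟨q, hlength, hsupport, hedges⟩ := exists_walk_of_adj f n hf
  refine ⟨.cons hclose q, SimpleGraph.Walk.cons_isCycle_iff _ _ |>.2 ⟨?_, fun he ↦ ?_⟩,
    by simp [hlength]⟩
  · rw [SimpleGraph.Walk.isPath_def, hsupport]
    refine List.Nodup.map_on (fun i hi j hj ↦ hinj ?_ ?_) List.nodup_range
    · exact Nat.lt_succ_iff.1 (List.mem_range.1 hi)
    · exact Nat.lt_succ_iff.1 (List.mem_range.1 hj)
  · obtain ⟨i, hi, he⟩ := hedges _ he
    obtain ⟨hni, -⟩ | ⟨hni, h0i⟩ := Sym2.eq_iff.1 he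
    · exact hi.ne' (hinj (Set.mem_Iic.2 le_rfl) (Set.mem_Iic.2 hi.le) hni)
    · have := hinj (Set.mem_Iic.2 le_rfl) (Set.mem_Iic.2 hi) hni
      have := hinj (Set.mem_Iic.2 n.zero_le) (Set.mem_Iic.2 hi.le) h0i
      omega

lemma IsInducedPath.adj_succ (hp : IsInducedPath H p L) {i : ℕ} (hi : i < L) :
    H.Adj (p i) (p (i + 1)) :=
  (hp.adj_iff i (i + 1) i.lt_succ_self hi).2 rfl

lemma IsInducedPath.adj_pred (hp : IsInducedPath H p L) {i : ℕ} (hi₀ : 0 < i) (hi : i ≤ L) :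
    H.Adj (p i) (p (i - 1)) := by
  have := hp.adj_succ (i := i - 1) (by omega)
  rwa [Nat.sub_add_cancel hi₀, H.adj_comm] at this

lemma IsInducedPath.exists_isCycle (hp : IsInducedPath H p L) (hL : 0 < L) {v : X}
    (hv : ∀ i ≤ L, p i ≠ v) (h0 : H.Adj v (p 0)) (hLv : H.Adj v (p L)) :
    ∃ (w : X) (q : H.Walk w w), q.IsCycle ∧ q.length = L + 2 := by
  let f : ℕ → X := fun i ↦ if i ≤ L then p i else v
  have hfp {i : ℕ} (hi : i ≤ L) : f i = p i := if_pos hi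
  have hfv : f (L + 1) = v := if_neg (by omega)
  have hinj : Set.InjOn f (Set.Iic (L + 1)) := by
    rw [← Order.succ_eq_add_one, Order.Iic_succ, Set.injOn_insert (by simp)]
    refine ⟨fun i hi j hj hij ↦ hp.injOn hi hj ?_, ?_⟩
    · rwa [hfp hi, hfp hj] at hij
    · rintro ⟨i, hi, hiv⟩
      exact hv i hi (by rw [← hfp hi, hiv, Order.succ_eq_add_one, hfv])
  obtain ⟨q, hq, hlength⟩ := exists_isCycle_of_injOn (H := H) (by omega) hinj
    (fun i hi ↦ by
      obtain hiL | rfl := (Nat.lt_succ_iff.1 hi).lt_or_eq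
      · exact hfp hiL.le ▸ hfp hiL ▸ hp.adj_succ hiL
      · exact hfp le_rfl ▸ hfv ▸ hLv.symm)
    (hfv ▸ hfp L.zero_le ▸ h0)
  exact ⟨_, q, hq, hlength⟩

/-- `B` contains all vertices with three distinct neighbors, its members are pairwise at distance
at least `ℓ`, and all cycles have length at least `ℓ`. -/
structure IsBranchSet (H : SimpleGraph X) (ℓ : ℕ) (B : Finset X) : Prop where
  eq_or_eq : ∀ x ∉ B, ∀ a b d, H.Adj x a → H.Adj x b → a ≠ b → H.Adj x d → d = a ∨ d = b
  le_dist : ∀ u ∈ B, ∀ v ∈ B, u ≠ v → H.Reachable u v → ℓ ≤ H.dist u v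
  le_length : ∀ (w : X) (q : H.Walk w w), q.IsCycle → ℓ ≤ q.length

namespace IsBranchSet

variable {m : ℕ} {B S : Finset X} {c c' x : X}

lemma pairwise_compl_adj (hB : IsBranchSet H (m + 2) B) : (B : Set X).Pairwise Hᶜ.Adj := by
  refine fun u hu v hv hne ↦ (H.compl_adj u v).2 ⟨hne, fun hadj ↦ ?_⟩
  have := hB.le_dist u hu v hv hne hadj.reachable
  rw [SimpleGraph.dist_eq_one_iff_adj.2 hadj] at this
  omega

lemma le_of_adj_of_adj (hB : IsBranchSet H (m + 2) B) (hp : IsInducedPath H p L) (hc : c ∈ B)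
    (hc' : c' ∈ B) (hne : c ≠ c') (h0 : H.Adj c (p 0)) (hL : H.Adj c' (p L)) : m ≤ L := by
  obtain ⟨q, hq, -⟩ := exists_walk_of_adj p L fun i ↦ hp.adj_succ
  have hle := hB.le_dist c hc c' hc' hne
    (SimpleGraph.Walk.cons h0 (q.concat hL.symm)).reachable
  have hdist := SimpleGraph.dist_le (SimpleGraph.Walk.cons h0 (q.concat hL.symm))
  rw [SimpleGraph.Walk.length_cons, SimpleGraph.Walk.length_concat] at hdist
  omega

lemma le_of_adj_ends (hB : IsBranchSet H (m + 2) B) (hp : IsInducedPath H p L) (hL : 0 < L)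
    (hc : ∀ i ≤ L, p i ≠ c) (h0 : H.Adj c (p 0)) (hLc : H.Adj c (p L)) : m ≤ L := by
  obtain ⟨w, q, hq, hlength⟩ := hp.exists_isCycle hL hc h0 hLc
  have := hB.le_length w q hq
  omega

lemma mem_pathSupport_of_adj_of_lt (hB : IsBranchSet H m B) (hp : IsInducedPath H p L) {i : ℕ}
    (hpB : p i ∉ B) (hi₀ : 0 < i) (hi : i < L) (hx : H.Adj (p i) x) : x ∈ pathSupport p L := by
  obtain rfl | rfl := hB.eq_or_eq (p i) hpB _ _ x (hp.adj_pred hi₀ hi.le) (hp.adj_succ hi)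
    (hp.ne (by omega) hi (by omega)) hx
  · exact mem_pathSupport.2 ⟨i - 1, by omega, rfl⟩
  · exact mem_pathSupport.2 ⟨i + 1, hi, rfl⟩

lemma eq_or_mem_pathSupport_of_adj_zero (hB : IsBranchSet H m B) (hp : IsInducedPath H p L)
    (hL : 0 < L) (hpB : p 0 ∉ B) (hc : ∀ i ≤ L, p i ≠ c) (h0 : H.Adj c (p 0))
    (hx : H.Adj (p 0) x) : x = c ∨ x ∈ pathSupport p L :=
  (hB.eq_or_eq (p 0) hpB c (p 1) x h0.symm (hp.adj_succ hL) (hc 1 hL).symm hx).imp_right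
    fun h ↦ mem_pathSupport.2 ⟨1, hL, h.symm⟩

lemma eq_or_mem_pathSupport_of_adj_last (hB : IsBranchSet H m B) (hp : IsInducedPath H p L)
    (hL : 0 < L) (hpB : p L ∉ B) (hc : ∀ i ≤ L, p i ≠ c) (hLc : H.Adj c (p L))
    (hx : H.Adj (p L) x) : x = c ∨ x ∈ pathSupport p L :=
  (hB.eq_or_mem_pathSupport_of_adj_zero hp.reverse hL (by simpa using hpB)
    (fun i _ ↦ hc _ (L.sub_le i)) (by simpa using hLc) (by simpa using hx)).imp_right
    (pathSupport_reverse ▸ ·)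

lemma eq_or_mem_pathSupport_of_adj_ends (hB : IsBranchSet H m B) (hp : IsInducedPath H p L)
    (hL : 0 < L) (hpB : ∀ i ≤ L, p i ∉ B) (hc : ∀ i ≤ L, p i ≠ c) (hc' : ∀ i ≤ L, p i ≠ c')
    (h0 : H.Adj c (p 0)) (hLc : H.Adj c' (p L)) {i : ℕ} (hi : i ≤ L) (hx : H.Adj (p i) x) :
    (x = c ∧ i = 0 ∨ x = c' ∧ i = L) ∨ x ∈ pathSupport p L := by
  obtain rfl | hi₀ := i.eq_zero_or_pos
  · exact (hB.eq_or_mem_pathSupport_of_adj_zero hp hL (hpB 0 hi) hc h0 hx).imp_left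
      fun h ↦ .inl ⟨h, rfl⟩
  obtain hi | rfl := hi.lt_or_eq
  · exact .inr (hB.mem_pathSupport_of_adj_of_lt hp (hpB i hi.le) hi₀ hi hx)
  · exact (hB.eq_or_mem_pathSupport_of_adj_last hp hL (hpB i hi) hc' hLc hx).imp_left
      fun h ↦ .inr ⟨h, rfl⟩

end IsBranchSet

lemma isAttachedPath_of_forall_adj {S : Finset X} {att : X → ℕ → Prop} (hp : IsInducedPath H p L)
    (hpS : ∀ i ≤ L, p i ∉ S)
    (hatt : ∀ i ≤ L, ∀ x, H.Adj (p i) x → att x i ∨ x ∈ pathSupport p L)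
    (hadj : ∀ i ≤ L, ∀ u, att u i → H.Adj u (p i)) : IsAttachedPath H S att p L where
  isInducedPath := hp
  notMem := hpS
  adj_iff u hu i hi := by
    refine ⟨fun hui ↦ (hatt i hi u hui.symm).resolve_right fun hup ↦ ?_, hadj i hi u⟩
    obtain ⟨j, hj, rfl⟩ := mem_pathSupport.1 hup
    exact hpS j hj hu

/-- The invariant of the decomposition process: `S` has been built with centers `C`, the branch
vertices `B` are among the centers, and the other vertices of `S` have all their neighbors in
`S`. -/
structure IsPartiallyBuilt (H : SimpleGraph X) (m : ℕ) (B S C : Finset X) : Prop where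
  buildable : Buildable H m S C
  subset : B ⊆ C
  mem_of_adj : ∀ u ∈ S, u ∉ B → ∀ x, H.Adj u x → x ∈ S

/-- `p` is an induced path of length `L` outside `S` which is as long as possible. -/
structure IsLongestPathOutside (H : SimpleGraph X) (S : Finset X) (p : ℕ → X) (L : ℕ) : Prop where
  isInducedPath : IsInducedPath H p L
  notMem : ∀ i ≤ L, p i ∉ S
  not_exists_longer : ∀ q, IsInducedPath H q (L + 1) → ∃ i ≤ L + 1, q i ∈ S

lemma exists_isLongestPathOutside [Fintype X] {S : Finset X} (hS : S ≠ univ) :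
    ∃ p L, IsLongestPathOutside H S p L := by
  let P : ℕ → Prop := fun L ↦ ∃ p, IsInducedPath H p L ∧ ∀ i ≤ L, p i ∉ S
  obtain ⟨x, hx⟩ : ∃ x, x ∉ S := by simpa [eq_univ_iff_forall] using hS
  have hbound {L : ℕ} (hL : P L) : L ≤ Fintype.card X := by
    obtain ⟨p, hp, -⟩ := hL
    exact (hp.lt_card (Y := univ) fun _ _ ↦ mem_univ _).le
  obtain ⟨p, hp, hpS⟩ : P (Nat.findGreatest P (Fintype.card X)) :=
    Nat.findGreatest_spec (Nat.zero_le _) ⟨fun _ ↦ x, .zero _, fun _ _ ↦ hx⟩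
  refine ⟨p, _, hp, hpS, fun q hq ↦ ?_⟩
  by_contra! hqS
  exact Nat.findGreatest_is_greatest (Nat.lt_succ_self _) (hbound ⟨q, hq, hqS⟩) ⟨q, hq, hqS⟩

namespace IsLongestPathOutside

variable {m : ℕ} {B S C : Finset X} {c c' v : X}

lemma reverse (hp : IsLongestPathOutside H S p L) :
    IsLongestPathOutside H S (fun i ↦ p (L - i)) L :=
  ⟨hp.isInducedPath.reverse, fun i _ ↦ hp.notMem _ (L.sub_le i), hp.not_exists_longer⟩

lemma ne_of_mem (hp : IsLongestPathOutside H S p L) (hc : c ∈ S) : ∀ i ≤ L, p i ≠ c :=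
  fun i hi h ↦ hp.notMem i hi (h ▸ hc)

lemma adj_zero_of_adj_last (hp : IsLongestPathOutside H S p L) (hB : IsBranchSet H m B)
    (hBS : B ⊆ S) (hvS : v ∉ S) (hv : ∀ i ≤ L, p i ≠ v) (hLv : H.Adj (p L) v) :
    0 < L ∧ H.Adj (p 0) v := by
  by_cases hex : ∃ i < L, H.Adj (p i) v
  · obtain ⟨i, hi, hiv⟩ := hex
    obtain rfl | hi₀ := i.eq_zero_or_pos
    · exact ⟨hi, hiv⟩
    · obtain ⟨j, hj, hjv⟩ := mem_pathSupport.1 (hB.mem_pathSupport_of_adj_of_lt hp.isInducedPath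
        (fun h ↦ hp.notMem i hi.le (hBS h)) hi₀ hi hiv)
      exact absurd hjv (hv j hj)
  · push Not at hex
    obtain ⟨q, hq, hqp, hqv⟩ := hp.isInducedPath.exists_snoc hv hLv hex
    obtain ⟨i, hi, hqS⟩ := hp.not_exists_longer q hq
    obtain hi | rfl := hi.lt_or_eq
    · exact absurd (hqp i (by omega) ▸ hqS) (hp.notMem i (by omega))
    · exact absurd (hqv ▸ hqS) hvS

end IsLongestPathOutside

namespace IsPartiallyBuilt

variable {m : ℕ} {B S C : Finset X} {c c' v : X}

lemma subset_set (h : IsPartiallyBuilt H m B S C) : B ⊆ S := h.subset.trans h.buildable.subset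

lemma mem_branchSet (h : IsPartiallyBuilt H m B S C) {u x : X} (hu : u ∈ S) (hx : x ∉ S)
    (hux : H.Adj u x) : u ∈ B :=
  by_contra fun huB ↦ hx (h.mem_of_adj u hu huB x hux)

lemma extend (h : IsPartiallyBuilt H m B S C) {S' C' : Finset X} (hS : S ⊆ S') (hC : C ⊆ C')
    (hbuild : Buildable H m S' C') (hclosed : ∀ u ∈ S', u ∉ S → ∀ x, H.Adj u x → x ∈ S') :
    IsPartiallyBuilt H m B S' C' where
  buildable := hbuild
  subset := h.subset.trans hC
  mem_of_adj u hu huB x hux := by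
    by_cases huS : u ∈ S
    · exact hS (h.mem_of_adj u huS huB x hux)
    · exact hclosed u hu huS x hux

lemma exists_ssuperset_of_path (h : IsPartiallyBuilt H m B S C) (hp₀ : p 0 ∉ S)
    (hbuild : Buildable H m (S ∪ pathSupport p L) C)
    (hclosed : ∀ i ≤ L, ∀ x, H.Adj (p i) x → x ∈ S ∪ pathSupport p L) :
    ∃ S' C', S ⊂ S' ∧ IsPartiallyBuilt H m B S' C' := by
  refine ⟨_, C, ?_, h.extend subset_union_left Subset.rfl hbuild fun u hu huS x hux ↦ ?_⟩
  · exact (ssubset_iff_of_subset subset_union_left).2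
      ⟨p 0, mem_union_right _ (mem_pathSupport.2 ⟨0, L.zero_le, rfl⟩), hp₀⟩
  · obtain ⟨i, hi, rfl⟩ := mem_pathSupport.1 ((mem_union.1 hu).resolve_left huS)
    exact hclosed i hi x hux

lemma exists_ssuperset_of_center_of_path (h : IsPartiallyBuilt H m B S C) (hv : v ∉ S)
    (hbuild : Buildable H m (insert v S ∪ pathSupport p L) (insert v C))
    (hv_closed : ∀ x, H.Adj v x → x ∈ pathSupport p L)
    (hp_closed : ∀ i ≤ L, ∀ x, H.Adj (p i) x → x = v ∨ x ∈ pathSupport p L) :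
    ∃ S' C', S ⊂ S' ∧ IsPartiallyBuilt H m B S' C' := by
  have hsub : S ⊆ insert v S ∪ pathSupport p L := (subset_insert v S).trans subset_union_left
  refine ⟨_, _, (ssubset_iff_of_subset hsub).2 ⟨v, by simp, hv⟩,
    h.extend hsub (subset_insert v C) hbuild fun u hu huS x hux ↦ ?_⟩
  obtain huv | hup := mem_union.1 hu
  · obtain rfl := (mem_insert.1 huv).resolve_right huS
    exact mem_union_right _ (hv_closed x hux)
  · obtain ⟨i, hi, rfl⟩ := mem_pathSupport.1 hup
    obtain rfl | hx := hp_closed i hi x hux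
    · simp
    · exact mem_union_right _ hx

lemma exists_ssuperset_of_thread (h : IsPartiallyBuilt H m B S C) (hB : IsBranchSet H (m + 2) B)
    (hp : IsLongestPathOutside H S p L) (hL : 0 < L) (hc : c ∈ S) (hc' : c' ∈ S)
    (h0 : H.Adj c (p 0)) (hLc : H.Adj c' (p L)) :
    ∃ S' C', S ⊂ S' ∧ IsPartiallyBuilt H m B S' C' := by
  have hcB : c ∈ B := h.mem_branchSet hc (hp.notMem 0 L.zero_le) h0
  have hcB' : c' ∈ B := h.mem_branchSet hc' (hp.notMem L le_rfl) hLc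
  have hm : m ≤ L := by
    obtain rfl | hne := eq_or_ne c c'
    · exact hB.le_of_adj_ends hp.isInducedPath hL (hp.ne_of_mem hc) h0 hLc
    · exact hB.le_of_adj_of_adj hp.isInducedPath hcB hcB' hne h0 hLc
  have hatt (i) (hi : i ≤ L) (x) (hx : H.Adj (p i) x) :=
    hB.eq_or_mem_pathSupport_of_adj_ends hp.isInducedPath hL
      (fun i hi hpB ↦ hp.notMem i hi (h.subset_set hpB)) (hp.ne_of_mem hc) (hp.ne_of_mem hc') h0
      hLc hi hx
  have hthread : IsThread H S c c' p L :=
    isAttachedPath_of_forall_adj hp.isInducedPath hp.notMem hatt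
      (by rintro i - u (⟨rfl, rfl⟩ | ⟨rfl, rfl⟩) <;> assumption)
  refine h.exists_ssuperset_of_path (hp.notMem 0 L.zero_le)
    (h.buildable.thread (h.subset hcB) (h.subset hcB') hm hthread) fun i hi x hx ↦ ?_
  obtain (⟨rfl, -⟩ | ⟨rfl, -⟩) | hx := hatt i hi x hx
  · exact mem_union_left _ hc
  · exact mem_union_left _ hc'
  · exact mem_union_right _ hx

lemma exists_ssuperset_of_pendant (h : IsPartiallyBuilt H m B S C)
    (hB : IsBranchSet H (m + 2) B) (hm : 0 < m) (hp : IsLongestPathOutside H S p L) (hc : c ∈ S)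
    (h0 : H.Adj c (p 0)) (hclosed : ∀ x, H.Adj (p L) x → x ∈ S ∪ pathSupport p L)
    (hfree : 0 < L → ∀ u ∈ S, ¬ H.Adj u (p L)) :
    ∃ S' C', S ⊂ S' ∧ IsPartiallyBuilt H m B S' C' := by
  have hpB (i) (hi : i ≤ L) : p i ∉ B := fun hpB ↦ hp.notMem i hi (h.subset_set hpB)
  have hcB : c ∈ B := h.mem_branchSet hc (hp.notMem 0 L.zero_le) h0
  have hatt (i) (hi : i ≤ L) (x) (hx : H.Adj (p i) x) :
      x = c ∧ i = 0 ∨ x ∈ pathSupport p L := by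
    obtain rfl | hi₀ := i.eq_zero_or_pos
    · obtain rfl | hL := L.eq_zero_or_pos
      · refine (mem_union.1 (hclosed x hx)).imp_left fun hxS ↦ ⟨by_contra fun hne ↦ ?_, rfl⟩
        exact hm.not_ge (hB.le_of_adj_of_adj hp.isInducedPath
          (h.mem_branchSet hxS (hp.notMem 0 hi) hx.symm) hcB hne hx.symm h0)
      · exact (hB.eq_or_mem_pathSupport_of_adj_zero hp.isInducedPath hL (hpB 0 hi)
          (hp.ne_of_mem hc) h0 hx).imp_left fun hxc ↦ ⟨hxc, rfl⟩
    obtain hi | rfl := hi.lt_or_eq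
    · exact .inr (hB.mem_pathSupport_of_adj_of_lt hp.isInducedPath (hpB i hi.le) hi₀ hi hx)
    · exact .inr ((mem_union.1 (hclosed x hx)).resolve_left fun hxS ↦ hfree hi₀ x hxS hx.symm)
  have hpendant : IsPendant H S c p L :=
    isAttachedPath_of_forall_adj hp.isInducedPath hp.notMem hatt
      (by rintro i - u ⟨rfl, rfl⟩; exact h0)
  refine h.exists_ssuperset_of_path (hp.notMem 0 L.zero_le)
    (h.buildable.pendant (h.subset hcB) hpendant) fun i hi x hx ↦ ?_
  obtain ⟨rfl, -⟩ | hx := hatt i hi x hx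
  · exact mem_union_left _ hc
  · exact mem_union_right _ hx

lemma exists_ssuperset_of_isolated_path (h : IsPartiallyBuilt H m B S C)
    (hp : IsInducedPath H p L) (hpS : ∀ i ≤ L, p i ∉ S)
    (hclosed : ∀ i ≤ L, ∀ x, H.Adj (p i) x → x ∈ pathSupport p L) :
    ∃ S' C', S ⊂ S' ∧ IsPartiallyBuilt H m B S' C' := by
  have hcenter : Buildable H m (insert (p 0) S) (insert (p 0) C) := by
    refine h.buildable.center fun u hu ↦ (H.compl_adj _ _).2 ⟨?_, fun hadj ↦ ?_⟩
    · exact fun hup ↦ hpS 0 L.zero_le (hup ▸ hu)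
    · obtain ⟨j, hj, rfl⟩ := mem_pathSupport.1 (hclosed 0 L.zero_le u hadj.symm)
      exact hpS j hj hu
  obtain rfl | hL := L.eq_zero_or_pos
  · refine ⟨_, _, ssubset_insert (hpS 0 le_rfl),
      h.extend (subset_insert _ S) (subset_insert _ C) hcenter fun u hu huS x hux ↦ ?_⟩
    obtain rfl := (mem_insert.1 hu).resolve_right huS
    obtain ⟨j, hj, rfl⟩ := mem_pathSupport.1 (hclosed 0 le_rfl x hux)
    exact mem_insert.2 (.inl (by rw [Nat.le_zero.1 hj]))
  obtain ⟨M, rfl⟩ : ∃ M, L = 1 + M := ⟨L - 1, by omega⟩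
  have hsplit (x) (hx : x ∈ pathSupport p (1 + M)) :
      x = p 0 ∨ x ∈ pathSupport (fun i ↦ p (1 + i)) M := by
    obtain ⟨j, hj, rfl⟩ := mem_pathSupport.1 hx
    obtain rfl | hj₀ := j.eq_zero_or_pos
    · exact .inl rfl
    · exact .inr (mem_pathSupport.2 ⟨j - 1, by omega, by rw [Nat.add_sub_cancel' hj₀]⟩)
  have hpendant : IsPendant H (insert (p 0) S) (p 0) (fun i ↦ p (1 + i)) M := by
    refine isAttachedPath_of_forall_adj hp.shift (fun i hi hmem ↦ ?_) (fun i hi x hx ↦ ?_) ?_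
    · exact (mem_insert.1 hmem).elim (hp.ne (by omega) (by omega) (by omega)) (hpS _ (by omega))
    · refine (hsplit x (hclosed _ (by omega) x hx)).imp_left fun hx0 ↦ ⟨hx0, ?_⟩
      have := (hp.adj_iff 0 (1 + i) (by omega) (by omega)).1 (hx0 ▸ hx.symm)
      omega
    · rintro i - u ⟨rfl, rfl⟩
      exact hp.adj_succ hL
  refine h.exists_ssuperset_of_center_of_path (hpS 0 (by omega))
    (hcenter.pendant (mem_insert_self _ _) hpendant) (fun x hx ↦ ?_)
    fun i hi x hx ↦ hsplit x (hclosed _ (by omega) x hx)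
  exact (hsplit x (hclosed 0 (by omega) x hx)).resolve_left hx.ne'

lemma exists_ssuperset_of_closing_vertex (h : IsPartiallyBuilt H m B S C)
    (hB : IsBranchSet H (m + 2) B) (hp : IsLongestPathOutside H S p L) (hvS : v ∉ S)
    (hv : ∀ i ≤ L, p i ≠ v) (hLv : H.Adj (p L) v) :
    ∃ S' C', S ⊂ S' ∧ IsPartiallyBuilt H m B S' C' := by
  obtain ⟨hL, h0v⟩ := hp.adj_zero_of_adj_last hB h.subset_set hvS hv hLv
  have hnbr (x) (hx : H.Adj v x) : x ∈ pathSupport p L := by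
    obtain rfl | rfl := hB.eq_or_eq v (fun hvB ↦ hvS (h.subset_set hvB)) (p 0) (p L) x h0v.symm
      hLv.symm (hp.isInducedPath.ne L.zero_le le_rfl hL.ne) hx
    · exact mem_pathSupport.2 ⟨0, L.zero_le, rfl⟩
    · exact mem_pathSupport.2 ⟨L, le_rfl, rfl⟩
  have hcenter : Buildable H m (insert v S) (insert v C) := by
    refine h.buildable.center fun u hu ↦ (H.compl_adj _ _).2 ⟨fun huv ↦ hvS (huv ▸ hu), ?_⟩
    intro hadj
    obtain ⟨j, hj, rfl⟩ := mem_pathSupport.1 (hnbr u hadj.symm)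
    exact hp.notMem j hj hu
  have hatt (i) (hi : i ≤ L) (x) (hx : H.Adj (p i) x) :=
    hB.eq_or_mem_pathSupport_of_adj_ends hp.isInducedPath hL
      (fun i hi hpB ↦ hp.notMem i hi (h.subset_set hpB)) hv hv h0v.symm hLv.symm hi hx
  have hthread : IsThread H (insert v S) v v p L := by
    refine isAttachedPath_of_forall_adj hp.isInducedPath (fun i hi hmem ↦ ?_) hatt ?_
    · exact (mem_insert.1 hmem).elim (hv i hi) (hp.notMem i hi)
    · rintro i - u (⟨rfl, rfl⟩ | ⟨rfl, rfl⟩)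
      exacts [h0v.symm, hLv.symm]
  refine h.exists_ssuperset_of_center_of_path hvS
    (hcenter.thread (mem_insert_self _ _) (mem_insert_self _ _)
      (hB.le_of_adj_ends hp.isInducedPath hL hv h0v.symm hLv.symm) hthread) hnbr fun i hi x hx ↦ ?_
  exact (hatt i hi x hx).imp_left fun hxv ↦ hxv.elim And.left And.left

lemma exists_ssuperset_of_closed_ends (h : IsPartiallyBuilt H m B S C)
    (hB : IsBranchSet H (m + 2) B) (hm : 0 < m) (hp : IsLongestPathOutside H S p L)
    (hfirst : ∀ x, H.Adj (p 0) x → x ∈ S ∪ pathSupport p L)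
    (hlast : ∀ x, H.Adj (p L) x → x ∈ S ∪ pathSupport p L) :
    ∃ S' C', S ⊂ S' ∧ IsPartiallyBuilt H m B S' C' := by
  by_cases hfirst' : ∃ c ∈ S, H.Adj c (p 0) <;> by_cases hlast' : ∃ c ∈ S, H.Adj c (p L)
  · obtain ⟨c, hc, h0⟩ := hfirst'
    obtain ⟨c', hc', hLc⟩ := hlast'
    obtain hL | hL := Nat.eq_zero_or_pos L
    · exact h.exists_ssuperset_of_pendant hB hm hp hc h0 hlast fun hL' ↦ absurd hL hL'.ne'
    · exact h.exists_ssuperset_of_thread hB hp hL hc hc' h0 hLc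
  · obtain ⟨c, hc, h0⟩ := hfirst'
    push Not at hlast'
    exact h.exists_ssuperset_of_pendant hB hm hp hc h0 hlast fun _ ↦ hlast'
  · obtain ⟨c, hc, hLc⟩ := hlast'
    push Not at hfirst'
    refine h.exists_ssuperset_of_pendant hB hm hp.reverse hc (by simpa using hLc) (fun x hx ↦ ?_)
      fun _ u hu ↦ by simpa using hfirst' u hu
    exact pathSupport_reverse (p := p) ▸ hfirst x (by simpa using hx)
  · push Not at hfirst' hlast'
    refine h.exists_ssuperset_of_isolated_path hp.isInducedPath hp.notMem fun i hi x hx ↦ ?_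
    obtain rfl | hi₀ := i.eq_zero_or_pos
    · exact (mem_union.1 (hfirst x hx)).resolve_left fun hxS ↦ hfirst' x hxS hx.symm
    obtain hi | rfl := hi.lt_or_eq
    · exact hB.mem_pathSupport_of_adj_of_lt hp.isInducedPath
        (fun hpB ↦ hp.notMem i hi.le (h.subset_set hpB)) hi₀ hi hx
    · exact (mem_union.1 (hlast x hx)).resolve_left fun hxS ↦ hlast' x hxS hx.symm

lemma exists_ssuperset [Fintype X] (h : IsPartiallyBuilt H m B S C)
    (hB : IsBranchSet H (m + 2) B) (hm : 0 < m) (hS : S ≠ univ) :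
    ∃ S' C', S ⊂ S' ∧ IsPartiallyBuilt H m B S' C' := by
  obtain ⟨p, L, hp⟩ := exists_isLongestPathOutside (H := H) hS
  by_cases hlast : ∀ x, H.Adj (p L) x → x ∈ S ∪ pathSupport p L
  · by_cases hfirst : ∀ x, H.Adj (p 0) x → x ∈ S ∪ pathSupport p L
    · exact h.exists_ssuperset_of_closed_ends hB hm hp hfirst hlast
    · simp only [mem_union, mem_pathSupport, not_forall, not_or, not_exists, not_and] at hfirst
      obtain ⟨v, h0v, hvS, hv⟩ := hfirst
      exact h.exists_ssuperset_of_closing_vertex hB hp.reverse hvS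
        (fun i _ ↦ hv _ (L.sub_le i)) (by simpa using h0v)
  · simp only [mem_union, mem_pathSupport, not_forall, not_or, not_exists, not_and] at hlast
    obtain ⟨v, hLv, hvS, hv⟩ := hlast
    exact h.exists_ssuperset_of_closing_vertex hB hp hvS hv hLv

end IsPartiallyBuilt

lemma IsBranchSet.exists_buildable [Fintype X] {m : ℕ} {B : Finset X}
    (hB : IsBranchSet H (m + 2) B) (hm : 0 < m) : ∃ C, Buildable H m univ C := by
  have hstart : IsPartiallyBuilt H m B B B :=
    ⟨buildable_of_isAnticlique B hB.pairwise_compl_adj, Subset.rfl, fun u hu huB ↦ absurd hu huB⟩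
  obtain ⟨S, ⟨C, hSC⟩, hmax⟩ :=
    (Set.toFinite {S | ∃ C, IsPartiallyBuilt H m B S C}).exists_maximal ⟨B, B, hstart⟩
  obtain rfl | hS := eq_or_ne S univ
  · exact ⟨C, hSC.buildable⟩
  · obtain ⟨S', C', hlt, hS'⟩ := hSC.exists_ssuperset hB hm hS
    exact absurd (hmax ⟨C', hS'⟩ hlt.le) hlt.not_ge

end

/-! ### Embedding buildable graphs -/

section

variable {V X : Type*} {G : SimpleGraph V} {H : SimpleGraph X} {A Z : Finset X} {φ : X → V}

/-- `φ` maps `H[A]` isomorphically onto an induced subgraph of `G`. Its values outside `A` are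
irrelevant. -/
structure IsInducedEmbeddingOn (H : SimpleGraph X) (G : SimpleGraph V) (φ : X → V) (A : Finset X) :
    Prop where
  injOn : Set.InjOn φ A
  adj_iff : ∀ x ∈ A, ∀ x' ∈ A, (G.Adj (φ x) (φ x') ↔ H.Adj x x')

lemma exists_eq_on_path {u : ℕ → X} {T : ℕ} (hu : Set.InjOn u (Set.Iic T))
    (huA : ∀ i ≤ T, u i ∉ A) (φ : X → V) (p : ℕ → V) :
    ∃ ψ : X → V, (∀ x ∈ A, ψ x = φ x) ∧ ∀ i ≤ T, ψ (u i) = p i := by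
  refine ⟨fun x ↦ if h : ∃ i ≤ T, u i = x then p h.choose else φ x, fun x hx ↦ ?_, fun i hi ↦ ?_⟩
  · refine dif_neg ?_
    rintro ⟨i, hi, rfl⟩
    exact huA i hi hx
  · have h : ∃ j ≤ T, u j = u i := ⟨i, hi, rfl⟩
    exact (dif_pos h).trans (congrArg p (hu h.choose_spec.1 hi h.choose_spec.2))

lemma IsInducedPath.adj_iff_adj {u : ℕ → X} {p : ℕ → V} {T i j : ℕ} (hu : IsInducedPath H u T)
    (hp : IsInducedPath G p T) (hi : i ≤ T) (hj : j ≤ T) :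
    G.Adj (p i) (p j) ↔ H.Adj (u i) (u j) := by
  obtain hij | rfl | hji := lt_trichotomy i j
  · rw [hp.adj_iff i j hij hj, hu.adj_iff i j hij hj]
  · exact iff_of_false G.irrefl H.irrefl
  · rw [G.adj_comm, H.adj_comm, hp.adj_iff j i hji hi, hu.adj_iff j i hji hi]

lemma IsInducedEmbeddingOn.exists_extend_path (h : IsInducedEmbeddingOn H G φ A)
    {att : X → ℕ → Prop} {att' : V → ℕ → Prop} {u : ℕ → X} {p : ℕ → V} {T : ℕ}
    (hu : IsAttachedPath H A att u T) (hp : IsAttachedPath G (A.image φ) att' p T)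
    (hatt : ∀ x ∈ A, ∀ i ≤ T, (att' (φ x) i ↔ att x i)) :
    ∃ ψ : X → V, (∀ x ∈ A, ψ x = φ x) ∧ (∀ i ≤ T, ψ (u i) = p i) ∧
      IsInducedEmbeddingOn H G ψ (A ∪ pathSupport u T) := by
  obtain ⟨ψ, hψA, hψu⟩ := exists_eq_on_path hu.isInducedPath.injOn hu.notMem φ p
  have hnotMem : ∀ x ∈ A, ∀ i ≤ T, φ x ≠ p i := fun x hx i hi hxi ↦
    hp.notMem i hi (hxi ▸ mem_image_of_mem φ hx)
  have hadj : ∀ x ∈ A, ∀ i ≤ T, (G.Adj (φ x) (p i) ↔ H.Adj x (u i)) := fun x hx i hi ↦ by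
    rw [hp.adj_iff _ (mem_image_of_mem φ hx) i hi, hu.adj_iff x hx i hi, hatt x hx i hi]
  have hmem : ∀ x ∈ A ∪ pathSupport u T, x ∈ A ∨ ∃ i ≤ T, u i = x := fun x hx ↦
    (mem_union.1 hx).imp_right mem_pathSupport.1
  refine ⟨ψ, hψA, hψu, fun x hx x' hx' hxx' ↦ ?_, fun x hx x' hx' ↦ ?_⟩
  all_goals
    obtain hx | ⟨i, hi, rfl⟩ := hmem x hx <;> obtain hx' | ⟨j, hj, rfl⟩ := hmem x' hx'
  · exact h.injOn hx hx' (by rwa [hψA x hx, hψA x' hx'] at hxx')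
  · exact absurd (by rwa [hψA x hx, hψu j hj] at hxx') (hnotMem x hx j hj)
  · exact absurd (by rwa [hψA x' hx', hψu i hi, eq_comm] at hxx') (hnotMem x' hx' i hi)
  · rw [hψu i hi, hψu j hj] at hxx'
    exact congrArg u (hp.isInducedPath.injOn hi hj hxx')
  · rw [hψA x hx, hψA x' hx', h.adj_iff x hx x' hx']
  · rw [hψA x hx, hψu j hj, hadj x hx j hj]
  · rw [hψA x' hx', hψu i hi, G.adj_comm, hadj x' hx' i hi, H.adj_comm]
  · rw [hψu i hi, hψu j hj, hu.isInducedPath.adj_iff_adj hp.isInducedPath hi hj]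

/-- A stage of the embedding of a buildable graph into a graph `G` with hub `K`: the subgraph on `A`
has been embedded with its centers in `W`, using up at most two members of `𝒟` per vertex. -/
structure IsPartialEmbedding (H : SimpleGraph X) (G : SimpleGraph V) (K : Hub V) (A Z : Finset X)
    (φ : X → V) (𝒰 : Finset (Finset V)) : Prop where
  isInducedEmbeddingOn : IsInducedEmbeddingOn H G φ A
  isEmbeddingState : IsEmbeddingState G K (A.image φ) 𝒰
  mem_W : ∀ x ∈ Z, φ x ∈ K.W
  card_le : #K.𝒟 ≤ #𝒰 + 2 * #A

lemma IsAttachedPath.card_union_pathSupport {S : Finset V} {att : V → ℕ → Prop} {p : ℕ → V} {T : ℕ}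
    (hp : IsAttachedPath G S att p T) : #(S ∪ pathSupport p T) = #S + (T + 1) := by
  rw [card_union_of_disjoint, hp.isInducedPath.card_pathSupport]
  refine disjoint_right.2 fun x hx ↦ ?_
  obtain ⟨i, hi, rfl⟩ := mem_pathSupport.1 hx
  exact hp.notMem i hi

lemma isAttachedPath_zero {S : Finset V} {x : V} (hx : ∀ u ∈ S, Gᶜ.Adj u x) :
    IsAttachedPath G S (fun _ _ ↦ False) (fun _ ↦ x) 0 where
  isInducedPath := .zero _
  notMem _ _ hxS := (hx x hxS).ne rfl
  adj_iff u hu _ _ := iff_false_intro ((G.compl_adj _ _).1 (hx u hu)).2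

lemma pathSupport_zero (p : ℕ → V) : pathSupport p 0 = {p 0} := by
  ext x
  simp [mem_pathSupport, eq_comm]

lemma pathSupport_mono (p : ℕ → V) {T T' : ℕ} (hT : T ≤ T') : pathSupport p T ⊆ pathSupport p T' :=
  image_subset_image (range_subset_range.2 (by omega))

lemma exists_ne_card_erase_erase {ι : Type*} [DecidableEq ι] {s : Finset ι} (hs : 1 < #s) :
    ∃ a ∈ s, ∃ b ∈ s, a ≠ b ∧ #s = #((s.erase a).erase b) + 2 := by
  obtain ⟨a, ha, b, hb, hab⟩ := one_lt_card.1 hs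
  refine ⟨a, ha, b, hb, hab, ?_⟩
  rw [card_erase_of_mem (mem_erase.2 ⟨hab.symm, hb⟩), card_erase_of_mem ha]
  omega

section Extension

variable {K : Hub V} {c : LinkConstants} {k f T : ℕ} {𝒰 𝒰' : Finset (Finset V)} {x v v' : X}
  {u : ℕ → X}

namespace IsPartialEmbedding

lemma exists_extend_path (h : IsPartialEmbedding H G K A Z φ 𝒰) (hZ : Z ⊆ A) {att : X → ℕ → Prop}
    {att' : V → ℕ → Prop} {p : ℕ → V} (hu : IsAttachedPath H A att u T)
    (hp : IsAttachedPath G (A.image φ) att' p T)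
    (hatt : ∀ x ∈ A, ∀ i ≤ T, (att' (φ x) i ↔ att x i))
    (hstate : IsEmbeddingState G K (A.image φ ∪ pathSupport p T) 𝒰') (h𝒰 : #𝒰 ≤ #𝒰' + 2) :
    ∃ ψ, IsPartialEmbedding H G K (A ∪ pathSupport u T) Z ψ 𝒰' ∧ ∀ i ≤ T, ψ (u i) = p i := by
  obtain ⟨ψ, hψA, hψu, hψ⟩ := h.isInducedEmbeddingOn.exists_extend_path hu hp hatt
  refine ⟨ψ, ⟨hψ, hstate.mono (fun z hz ↦ ?_) subset_rfl,
    fun x hx ↦ hψA x (hZ hx) ▸ h.mem_W x hx, ?_⟩, hψu⟩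
  · obtain ⟨x, hx, rfl⟩ := mem_image.1 hz
    obtain hx | hx := mem_union.1 hx
    · exact mem_union_left _ (hψA x hx ▸ mem_image_of_mem φ hx)
    · obtain ⟨i, hi, rfl⟩ := mem_pathSupport.1 hx
      exact mem_union_right _ (mem_pathSupport.2 ⟨i, hi, (hψu i hi).symm⟩)
  · have := h.card_le
    have := hu.card_union_pathSupport
    omega

lemma eq_iff (h : IsPartialEmbedding H G K A Z φ 𝒰) (hx : x ∈ A) (hv : v ∈ A) :
    φ x = φ v ↔ x = v :=
  h.isInducedEmbeddingOn.injOn.eq_iff hx hv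

lemma exists_extend_center (h : IsPartialEmbedding H G K A Z φ 𝒰) (hK : IsRichHub G c k f K)
    (hZ : Z ⊆ A) (hf : #A ≤ f) (hx : ∀ u ∈ A, Hᶜ.Adj u x) :
    ∃ ψ, IsPartialEmbedding H G K (insert x A) (insert x Z) ψ 𝒰 := by
  obtain ⟨z, hzW, hzA, hstate⟩ := hK.exists_center h.isEmbeddingState (card_image_le.trans hf)
  obtain ⟨ψ, hψ, hψx⟩ := h.exists_extend_path hZ (isAttachedPath_zero hx) (isAttachedPath_zero hzA)
    (fun _ _ _ _ ↦ Iff.rfl) (by rwa [pathSupport_zero, union_singleton]) (by omega)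
  rw [pathSupport_zero, union_singleton] at hψ
  exact ⟨ψ, { hψ with mem_W := forall_mem_insert _ _ _ |>.2 ⟨hψx 0 le_rfl ▸ hzW, hψ.mem_W⟩ }⟩

lemma exists_extend_thread (h : IsPartialEmbedding H G K A Z φ 𝒰) (hK : IsRichHub G c k f K)
    (hZ : Z ⊆ A) (hf : #A ≤ f) (h𝒰 : 1 < #𝒰) (hv : v ∈ Z) (hv' : v' ∈ Z) (hT : 4 * k + 3 ≤ T)
    (hTJ : T ≤ c.J) (hu : IsThread H A v v' u T) :
    ∃ ψ 𝒰', IsPartialEmbedding H G K (A ∪ pathSupport u T) Z ψ 𝒰' := by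
  obtain ⟨D, hD, D', hD', hDD', hcard⟩ := exists_ne_card_erase_erase h𝒰
  obtain ⟨p, hp, hstate⟩ := hK.exists_thread h.isEmbeddingState (card_image_le.trans hf)
    (mem_image_of_mem φ (hZ hv)) (h.mem_W v hv) (mem_image_of_mem φ (hZ hv')) (h.mem_W v' hv')
    hD hD' hDD' hT hTJ
  obtain ⟨ψ, hψ, -⟩ := h.exists_extend_path hZ hu hp
    (fun x hx i _ ↦ by rw [h.eq_iff hx (hZ hv), h.eq_iff hx (hZ hv')]) hstate hcard.le
  exact ⟨ψ, _, hψ⟩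

lemma exists_extend_pendant (h : IsPartialEmbedding H G K A Z φ 𝒰) (hK : IsRichHub G c k f K)
    (hZ : Z ⊆ A) (hf : #A ≤ f) (h𝒰 : 1 < #𝒰) (hv : v ∈ Z) (hTJ : T + 4 * k + 4 ≤ c.J)
    (hu : IsPendant H A v u T) :
    ∃ ψ 𝒰', IsPartialEmbedding H G K (A ∪ pathSupport u T) Z ψ 𝒰' := by
  -- A pendant path is an initial segment of a longer thread from its center back to itself.
  obtain ⟨D, hD, D', hD', hDD', hcard⟩ := exists_ne_card_erase_erase h𝒰
  obtain ⟨p, hp, hstate⟩ := hK.exists_thread h.isEmbeddingState (card_image_le.trans hf)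
    (mem_image_of_mem φ (hZ hv)) (h.mem_W v hv) (mem_image_of_mem φ (hZ hv)) (h.mem_W v hv)
    hD hD' hDD' (by omega) hTJ
  have hp' : IsPendant G (A.image φ) (φ v) p T :=
    ⟨hp.isInducedPath.take (by omega), fun i hi ↦ hp.notMem i (by omega), fun w hw i hi ↦ by
      rw [hp.adj_iff w hw i (by omega), or_iff_left (by omega)]⟩
  obtain ⟨ψ, hψ, -⟩ := h.exists_extend_path hZ hu hp'
    (fun x hx i _ ↦ by rw [h.eq_iff hx (hZ hv)])
    (hstate.mono (union_subset_union_right (pathSupport_mono p (by omega))) subset_rfl) hcard.le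
  exact ⟨ψ, _, hψ⟩

end IsPartialEmbedding

lemma Buildable.exists_isPartialEmbedding [Fintype X] (hA : Buildable H (4 * k + 3) A Z)
    (hK : IsRichHub G c k f K) (hf : Fintype.card X ≤ f) (hJ : Fintype.card X + 4 * k + 3 ≤ c.J)
    (h𝒟 : 2 * Fintype.card X ≤ #K.𝒟) : ∃ φ 𝒰, IsPartialEmbedding H G K A Z φ 𝒰 := by
  have hAf (A : Finset X) : #A ≤ f := (card_le_univ A).trans hf
  induction hA with
  | empty =>
    have hstate : IsEmbeddingState G K ∅ K.𝒟 :=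
      ⟨by simp, subset_rfl, fun _ _ ↦ ⟨by simp, by simp⟩, by simp⟩
    obtain ⟨z, -⟩ := hK.exists_center hstate (by simp)
    exact ⟨fun _ ↦ z, K.𝒟, ⟨by simp, by simp⟩, by simpa using hstate, by simp, by simp⟩
  | center hA hx ih =>
    obtain ⟨φ, 𝒰, h⟩ := ih
    obtain ⟨ψ, hψ⟩ := h.exists_extend_center hK hA.subset (hAf _) hx
    exact ⟨ψ, 𝒰, hψ⟩
  | @thread A _ _ _ u T hA hv hv' hT hu ih =>
    obtain ⟨φ, 𝒰, h⟩ := ih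
    have hcard := hu.card_union_pathSupport ▸ card_le_univ (A ∪ pathSupport u T)
    have := h.card_le
    exact h.exists_extend_thread hK hA.subset (hAf _) (by omega) hv hv' hT (by omega) hu
  | @pendant A _ _ u T hA hv hu ih =>
    obtain ⟨φ, 𝒰, h⟩ := ih
    have hcard := hu.card_union_pathSupport ▸ card_le_univ (A ∪ pathSupport u T)
    have := h.card_le
    exact h.exists_extend_pendant hK hA.subset (hAf _) (by omega) hv (by omega) hu

theorem IsRichHub.isIndContained [Fintype X] (hK : IsRichHub G c k f K)
    (hf : Fintype.card X ≤ f) (hJ : Fintype.card X + 4 * k + 3 ≤ c.J)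
    (h𝒟 : 2 * Fintype.card X ≤ #K.𝒟) (hH : Buildable H (4 * k + 3) univ Z) :
    H.IsIndContained G := by
  obtain ⟨φ, -, ⟨hφ, hadj⟩, -⟩ := hH.exists_isPartialEmbedding hK hf hJ h𝒟
  exact ⟨⟨⟨φ, fun x x' ↦ hφ (mem_univ x) (mem_univ x')⟩, hadj _ (mem_univ _) _ (mem_univ _)⟩⟩

end Extension

end

/-! ### Choice of constants -/

section

variable {V : Type*} {G : SimpleGraph V} {α β Δ s t : ℝ} {U : Finset V}

/-- The proportion of `U` that the sets `W` and `R` of a hub with `N` covering sets are guaranteed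
to contain. -/
noncomputable def hubDensity (N : ℕ) : ℝ := 1 / (4 * 2 ^ (N + 1) * 4 ^ 2 ^ (N + 1))

lemma hubDensity_pos (N : ℕ) : 0 < hubDensity N := by
  rw [hubDensity]
  positivity

lemma exists_block_size (N : ℕ) (hβ : 1 ≤ β) (hU : 3 * β ≤ hubDensity N * #U) :
    ∃ q : ℕ, 2 ^ (N + 1) * q ≤ #U ∧ 5 * β * 4 ^ 2 ^ (N + 1) ≤ q ∧
      2 * (hubDensity N * #U) ≤ q / 4 ^ 2 ^ (N + 1) := by
  have hM1 : 1 ≤ 2 ^ (N + 1) := Nat.one_le_two_pow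
  have hdensity : hubDensity N = 1 / (4 * (2 ^ (N + 1) : ℕ) * 4 ^ 2 ^ (N + 1)) := by
    rw [hubDensity, Nat.cast_pow, Nat.cast_two]
  generalize 2 ^ (N + 1) = M at hM1 hdensity ⊢
  have hMpos : (0 : ℝ) < M := Nat.cast_pos.2 hM1
  have hE1 : (1 : ℝ) ≤ 4 ^ M := one_le_pow₀ (by norm_num)
  generalize (4 : ℝ) ^ M = E at hE1 hdensity ⊢
  replace hdensity : hubDensity N * #U * (4 * M * E) = #U := by
    rw [hdensity]
    field_simp
  have hlt : (#U : ℝ) < M * ((#U / M : ℕ) + 1) := by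
    exact_mod_cast Nat.lt_mul_div_succ #U hM1
  have hME : 12 * (M * E) ≤ #U := by
    rw [← hdensity]
    nlinarith [mul_pos hMpos (one_pos.trans_le hE1)]
  have hU2 : (#U : ℝ) ≤ 2 * M * (#U / M : ℕ) := by
    nlinarith
  have hquot : 2 * (hubDensity N * #U) * E ≤ (#U / M : ℕ) := by
    rw [← hdensity] at hU2
    refine le_of_mul_le_mul_left ?_ (mul_pos two_pos hMpos)
    linarith
  refine ⟨#U / M, Nat.mul_div_le _ _, ?_, ?_⟩
  · nlinarith
  · rwa [le_div_iff₀ (by positivity)]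

theorem IsCoherent.exists_large_isHub (h : IsCoherent G α β) (hα : 0 < α) (hβ : 1 ≤ β) (ht : 1 ≤ t)
    (hαβ : α * t ≤ β) {r N : ℕ} (hr : α ≤ t ^ r) (hN : 1 ≤ N)
    (hβdeg : ∀ v, (degreeIn G v U : ℝ) ≤ β) (hΔ : 1 ≤ Δ)
    (hΔdeg : ∀ u ∈ U, (degreeIn G u U : ℝ) ≤ Δ) (hU : 3 * β ≤ hubDensity N * #U) :
    ∃ K : Hub V, IsHub G (r + 1) K ∧ K.U = U ∧ #K.𝒟 = N ∧
      (∀ u ∈ K.W, (#{z ∈ K.W | K.Conflict G u z} : ℝ) ≤ (3 * (N * (r + 1 : ℕ)) + 2) * Δ) ∧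
      hubDensity N * #U ≤ #K.W ∧ hubDensity N * #U ≤ #K.R := by
  obtain ⟨q, hqU, hq, hqdensity⟩ := exists_block_size N hβ hU
  obtain ⟨W, R, 𝒟, hWU, hRU, hWR, hW, hR, h𝒟, hcover, h𝒟R⟩ :=
    h.exists_isRootedCover hα ht hαβ hr hβdeg N hqU hq
  obtain ⟨Q, hhub⟩ := hcover.exists_isHub hWU hRU hWR h𝒟R
  obtain ⟨W', hW', hWW', hconf⟩ := hhub.exists_restrict_card_conflict_le hΔ hΔdeg (h𝒟 ▸ hN)
    r.succ_pos
  refine ⟨⟨U, W', R, 𝒟, Q⟩, hhub.restrict hW', rfl, h𝒟, h𝒟 ▸ hconf, ?_, ?_⟩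
  · exact le_of_mul_le_mul_left (hqdensity.trans (hW.trans hWW')) two_pos
  · have : 0 ≤ hubDensity N * #U := by linarith
    linarith

lemma eventually_mul_le (a : ℝ) {b : ℝ} (hb : 0 < b) :
    ∀ᶠ x in nhdsWithin (0 : ℝ) (Set.Ioi 0), a * x ≤ b := by
  have htendsto : Filter.Tendsto (a * ·) (nhdsWithin 0 (Set.Ioi 0)) (nhds (a * 0)) :=
    (continuous_const_mul a).continuousWithinAt
  exact htendsto.eventually_le_const (by rwa [mul_zero])

/-- Constants for embedding a graph on `f` vertices, relative to a hub in a set `U` whose sets `W`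
and `R` have density `b` in `U`, and in which every vertex conflicts with at most `C * Δ` others:
`w * |U|` is the size of the sets to be linked, and `δ * |U|` an upper bound for `β`. -/
structure IsScale (b C : ℝ) (f k J : ℕ) (w K δ : ℝ) : Prop where
  w_pos : 0 < w
  w_le_one : w ≤ 1
  K_pos : 0 < K
  δ_pos : 0 < δ
  mul_w_le : 2 * (2 * k + 1) * w ≤ b
  pow_mul_w_le : 2 * 3 ^ (J + 1) * w ≤ b
  le_K_mul_w : 4 * (C + J + 1) ≤ K * w
  eight_mul_δ_le : 8 * δ ≤ w
  K_mul_δ_le : (K + 3) * δ ≤ w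
  three_mul_δ_le : 3 * δ ≤ b
  C_mul_δ_le : 2 * f * (C + 1) * δ ≤ b
  four_mul_δ_le : 4 * f * δ ≤ b

lemma exists_isScale {b C : ℝ} (hb : 0 < b) (hC : 0 ≤ C) (f k J : ℕ) :
    ∃ w K δ, IsScale b C f k J w K δ := by
  obtain ⟨w, hw₁, hw₂, hw₃, hw : 0 < w⟩ := ((eventually_mul_le 1 one_pos).and
    ((eventually_mul_le (2 * (2 * k + 1)) hb).and
    ((eventually_mul_le (2 * 3 ^ (J + 1)) hb).and self_mem_nhdsWithin))).exists
  obtain ⟨K, hK⟩ : ∃ K, K = 4 * (C + J + 1) / w := ⟨_, rfl⟩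
  obtain ⟨δ, hδ₁, hδ₂, hδ₃, hδ₄, hδ₅, hδ : 0 < δ⟩ := ((eventually_mul_le 8 hw).and
    ((eventually_mul_le (K + 3) hw).and ((eventually_mul_le 3 hb).and
    ((eventually_mul_le (2 * f * (C + 1)) hb).and ((eventually_mul_le (4 * f) hb).and
    self_mem_nhdsWithin))))).exists
  refine ⟨w, K, δ, hw, by linarith, ?_, hδ, hw₂, hw₃, ?_, hδ₁, hδ₂, hδ₃, hδ₄, hδ₅⟩
  · rw [hK]
    positivity
  · rw [hK, div_mul_cancel₀ _ hw.ne']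

lemma IsScale.exists_pos {b C w K δ : ℝ} {f k J : ℕ} (h : IsScale b C f k J w K δ) (I : ℕ) :
    ∃ ε > 0, ε < 1 ∧ 3 * ε ≤ (w / 4) ^ I ∧ ε ≤ δ * (w / 4) ^ I ∧ (2 * (K + 2)) ^ I * ε < 1 := by
  have hpow : 0 < (w / 4) ^ I := pow_pos (div_pos h.w_pos four_pos) I
  obtain ⟨ε, hε₁, hε₂, hε₃, hε₄, hε : 0 < ε⟩ := ((eventually_mul_le 1 one_half_pos).and
    ((eventually_mul_le 3 hpow).and ((eventually_mul_le 1 (mul_pos h.δ_pos hpow)).and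
    ((eventually_mul_le ((2 * (K + 2)) ^ I) one_half_pos).and self_mem_nhdsWithin)))).exists
  exact ⟨ε, hε, by linarith, hε₂, by linarith, by linarith⟩

theorem IsHub.isRichHub {b C w κ δ : ℝ} {f k J : ℕ} {K : Hub V} (hK : IsHub G k K)
    (hscale : IsScale b C f k J w κ δ) (hC : 0 ≤ C) (hcoh : IsCoherent G α β)
    (hreg : IsNearRegular G K.U Δ s (w / 4 * #K.U)) (hα : 0 < α) (hs : 2 * (κ + 2) < s)
    (hαβ : α * s ^ 2 ≤ β) (hΔ : 1 ≤ Δ) (hΔβ : Δ ≤ β) (hβ : β ≤ δ * #K.U)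
    (hconf : ∀ u ∈ K.W, (#{z ∈ K.W | K.Conflict G u z} : ℝ) ≤ C * Δ)
    (hW : b * #K.U ≤ #K.W) (hR : b * #K.U ≤ #K.R) :
    IsRichHub G ⟨α, β, Δ, s, w / 4 * #K.U, C, κ, w * #K.U, J⟩ k f K := by
  have hκ := hscale.K_pos
  have hmul {a a' : ℝ} (ha : a ≤ a') : a * (#K.U : ℝ) ≤ a' * #K.U :=
    mul_le_mul_of_nonneg_right ha (Nat.cast_nonneg _)
  have hmulβ {a a' : ℝ} (ha : 0 ≤ a) (haa' : a * δ ≤ a') : a * β ≤ a' * #K.U :=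
    (mul_le_mul_of_nonneg_left hβ ha).trans (by rw [← mul_assoc]; exact hmul haa')
  refine ⟨hK, ⟨hcoh, hreg, hα, by linarith, hαβ, hΔ, hΔβ, hC, hκ, ?_, ?_, ?_, ?_, hs⟩, hconf,
    ?_, ?_, ?_, ?_⟩
  · exact hmulβ (by norm_num) hscale.eight_mul_δ_le
  · exact le_of_eq (by ring)
  · exact (hmul hscale.le_K_mul_w).trans_eq (mul_assoc _ _ _)
  · exact hmulβ (by linarith) hscale.K_mul_δ_le
  · linarith [hmul hscale.mul_w_le]
  · linarith [hmulβ (by positivity) hscale.C_mul_δ_le]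
  · linarith [hmul hscale.pow_mul_w_le]
  · linarith [hmulβ (by positivity) hscale.four_mul_δ_le]

end

/-! ### Hubs in coherent sparse graphs -/

section RichHub

variable {V : Type*} [Fintype V] {G : SimpleGraph V} {α s : ℝ}

theorem IsScale.exists_isRichHub {N f r J : ℕ} {w κ δ ε : ℝ}
    (hscale : IsScale (hubDensity N) (3 * (N * (r + 1 : ℕ)) + 2) f (r + 1) J w κ δ) (hN : 1 ≤ N)
    (hε1 : ε < 1) (hεw : 3 * ε ≤ (w / 4) ^ (2 * (r + 1))) (hεδ : ε ≤ δ * (w / 4) ^ (2 * (r + 1)))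
    (hεκ : (2 * (κ + 2)) ^ (2 * (r + 1)) * ε < 1) (hs : 1 ≤ s)
    (hsV : s ^ (2 * (r + 1)) = Fintype.card V) (hβ : 1 ≤ ε * Fintype.card V) (hα : 0 < α)
    (hαβ : α * s ^ 2 ≤ ε * Fintype.card V) (hcoh : IsCoherent G α (ε * Fintype.card V))
    (hdeg : ∀ v, (degreeIn G v univ : ℝ) ≤ ε * Fintype.card V) :
    ∃ c K, IsRichHub G c (r + 1) f K ∧ c.J = J ∧ #K.𝒟 = N := by
  have hs2 : 1 ≤ s ^ 2 := one_le_pow₀ hs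
  have hVpos : (0 : ℝ) < Fintype.card V := hsV ▸ pow_pos (one_pos.trans_le hs) _
  have hβV : ε * Fintype.card V < s ^ (2 * (r + 1)) :=
    (mul_lt_of_lt_one_left hVpos hε1).trans_eq hsV.symm
  have hw := hscale.w_pos
  obtain ⟨U, -, Δ, hU, hΔ, hΔβ, hreg⟩ := hcoh.exists_isNearRegular (κ := w / 4) hα
    (le_of_mul_le_of_one_le hα hs2 hαβ) hβ hs (by positivity) (by linarith [hscale.w_le_one]) _ hβV
    (U₀ := univ) (fun v _ ↦ hdeg v)
    (by rw [← mul_assoc, card_univ]; exact mul_le_mul_of_nonneg_right hεw hVpos.le)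
  have hβU : ε * Fintype.card V ≤ δ * #U :=
    calc ε * Fintype.card V ≤ δ * (w / 4) ^ (2 * (r + 1)) * Fintype.card V := by gcongr
      _ = δ * ((w / 4) ^ (2 * (r + 1)) * #(univ : Finset V)) := by rw [card_univ, mul_assoc]
      _ ≤ δ * #U := mul_le_mul_of_nonneg_left hU hscale.δ_pos.le
  have hr : α ≤ (s ^ 2) ^ r := by
    refine le_of_mul_le_mul_right (hαβ.trans ?_) (one_pos.trans_le hs2)
    rw [← pow_succ, ← pow_mul]
    exact hβV.le
  obtain ⟨K, hK, rfl, h𝒟, hconf, hW, hR⟩ := hcoh.exists_large_isHub (N := N) hα hβ hs2 hαβ hr hN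
    (fun v ↦ le_trans (by exact_mod_cast degreeIn_mono v (subset_univ U)) (hdeg v)) hΔ
    hreg.degreeIn_le (by
      linarith [mul_le_mul_of_nonneg_right hscale.three_mul_δ_le (Nat.cast_nonneg (α := ℝ) #U)])
  have hκs : 2 * (κ + 2) < s := by
    refine lt_of_pow_lt_pow_left₀ (2 * (r + 1)) (by linarith) (hsV ▸ ?_)
    refine lt_of_mul_lt_mul_right (hεκ.trans_le (mul_comm ε _ ▸ hβ)) ?_
    exact (pos_of_mul_pos_left (one_pos.trans_le hβ) hVpos.le).le
  exact ⟨_, K, hK.isRichHub hscale (by positivity) hcoh hreg hα hκs hαβ hΔ hΔβ hβU hconf hW hR, rfl,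
    h𝒟⟩

end RichHub

universe v

theorem Buildable.exists_isIndContained {X : Type*} [Fintype X] {H : SimpleGraph X} {k : ℕ}
    (hk : 1 ≤ k) {Z : Finset X} (hH : Buildable H (4 * k + 3) univ Z) :
    ∃ ε : ℝ, 0 < ε ∧ ∀ (V : Type v) [Fintype V] (G : SimpleGraph V) (s α : ℝ), 1 ≤ s →
      s ^ (2 * k) = Fintype.card V → 1 ≤ ε * Fintype.card V → 0 < α →
      α * s ^ 2 ≤ ε * Fintype.card V → IsCoherent G α (ε * Fintype.card V) →
      (∀ v, (degreeIn G v univ : ℝ) ≤ ε * Fintype.card V) → H.IsIndContained G := by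
  obtain ⟨r, rfl⟩ := Nat.exists_eq_add_of_le' hk
  obtain ⟨w, κ, δ, hscale⟩ := exists_isScale (hubDensity_pos (2 * Fintype.card X + 1))
    (C := 3 * ((2 * Fintype.card X + 1 : ℕ) * (r + 1 : ℕ)) + 2) (by positivity) (Fintype.card X)
    (r + 1) (Fintype.card X + 4 * (r + 1) + 3)
  obtain ⟨ε, hε, hε1, hεw, hεδ, hεκ⟩ := hscale.exists_pos (2 * (r + 1))
  refine ⟨ε, hε, fun V _ G s α hs hsV hβ hα hαβ hcoh hdeg ↦ ?_⟩
  obtain ⟨c, K, hK, hJ, h𝒟⟩ := hscale.exists_isRichHub (by omega) hε1 hεw hεδ hεκ hs hsV hβ hα hαβ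
    hcoh hdeg
  exact hK.isIndContained le_rfl hJ.ge (by omega) hH

section Hypotheses

lemma HasBranchLengthAtLeast.isBranchSet {X : Type*} [Fintype X] {H : SimpleGraph X}
    [DecidableRel H.Adj] {ℓ : ℕ} (hH : HasBranchLengthAtLeast H ℓ) :
    IsBranchSet H ℓ ({x | 3 ≤ H.degree x} : Finset X) where
  eq_or_eq x hx a b d ha hb hab hd := by
    by_contra! hne
    refine hx (mem_filter.2 ⟨mem_univ x, ?_⟩)
    rw [← H.card_neighborFinset_eq_degree,
      ← card_eq_three.2 ⟨a, b, d, hab, hne.1.symm, hne.2.symm, rfl⟩]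
    exact card_le_card (by simp [insert_subset_iff, ha, hb, hd])
  le_dist u hu v hv huv huv' := by
    exact_mod_cast hH.2 u v huv (mem_filter.1 hu).2 (mem_filter.1 hv).2 huv'
  le_length w q hq := by exact_mod_cast hH.1 w q hq

variable {V : Type*} [Fintype V] {G : SimpleGraph V} [DecidableRel G.Adj] {ε : ℝ}

lemma IsSparse.degreeIn_le (h : IsSparse G ε) (v : V) :
    (degreeIn G v univ : ℝ) ≤ ε * Fintype.card V := by
  have heq : degreeIn G v univ = G.degree v := by
    rw [← G.card_neighborFinset_eq_degree, degreeIn]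
    congr 1
    ext
    simp
  exact heq ▸ (h v).le

lemma IsSparse.one_le_mul_card (h : IsSparse G ε) {α : ℝ} (hV : 1 < Fintype.card V)
    (hα : α ≤ ε * Fintype.card V) (hcoh : IsCoherent G α (ε * Fintype.card V)) :
    1 ≤ ε * Fintype.card V := by
  by_contra! hlt
  obtain ⟨a, b, hab⟩ := Fintype.exists_pair_of_one_lt_card hV
  have hnot_adj : ¬ G.Adj a b := fun hadj ↦ by
    have hdeg : (1 : ℝ) ≤ G.degree a :=
      Nat.one_le_cast.2 ((G.degree_pos_iff_exists_adj a).2 ⟨b, hadj⟩)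
    linarith [h a]
  refine hcoh ⟨{a}, {b}, ⟨by simpa using hab, by simpa using hnot_adj⟩, ?_, ?_⟩
  · simpa using hα.trans hlt.le
  · simpa using hlt.le

end Hypotheses

lemma rpow_half_pow {n c : ℝ} (hn : 0 ≤ n) {k : ℕ} (hck : c * k = 1) :
    (n ^ (c / 2)) ^ (2 * k) = n := by
  rw [← Real.rpow_natCast, ← Real.rpow_mul hn, Nat.cast_mul, Nat.cast_two, ← mul_assoc,
    div_mul_cancel₀ c two_ne_zero, hck, Real.rpow_one]

lemma rpow_one_sub_mul_sq {n : ℝ} (hn : 0 < n) (c : ℝ) : n ^ (1 - c) * (n ^ (c / 2)) ^ 2 = n := by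
  rw [← Real.rpow_natCast, ← Real.rpow_mul hn.le, ← Real.rpow_add hn, Nat.cast_two,
    div_mul_cancel₀ c two_ne_zero, sub_add_cancel, Real.rpow_one]

lemma exists_nat_mul_eq_one {c : ℝ} (hc : 0 < c) (hcint : ∃ k : ℤ, 1 / c = k) :
    ∃ k : ℕ, 1 ≤ k ∧ c * k = 1 := by
  obtain ⟨m, hm⟩ := hcint
  have hmpos : 0 < m := Int.cast_pos (R := ℝ).1 (hm ▸ one_div_pos.2 hc)
  lift m to ℕ using hmpos.le
  exact ⟨m, by omega, by rw [← Int.cast_natCast, ← hm, mul_one_div_cancel hc.ne']⟩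

end PurePairs

theorem mainTheorem2 (c : ℝ) (hc : 0 < c) (hcint : ∃ k : ℤ, 1 / c = (k : ℝ))
    {W : Type*} [Fintype W] (H : SimpleGraph W) [DecidableRel H.Adj]
    (hH : PurePairs.HasBranchLengthAtLeast H (4 / c + 5)) :
    ∃ ε : ℝ, 0 < ε ∧
      ∀ (V : Type*) [Fintype V] (G : SimpleGraph V) [DecidableRel G.Adj],
        1 < Fintype.card V →
        PurePairs.IsSparse G ε →
        PurePairs.IsCoherent G (ε * (Fintype.card V : ℝ) ^ (1 - c)) (ε * (Fintype.card V : ℝ)) →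
        H.IsIndContained G := by
  obtain ⟨k, hk, hck⟩ := PurePairs.exists_nat_mul_eq_one hc hcint
  have hbranch : 4 / c + 5 = ((4 * k + 3 + 2 : ℕ) : ℝ) := by
    rw [(div_eq_iff hc.ne').2 (show 4 = 4 * k * c by linarith)]
    push_cast
    ring
  obtain ⟨Z, hZ⟩ := (hbranch ▸ hH).isBranchSet.exists_buildable (by omega)
  obtain ⟨ε, hε, hcontained⟩ := hZ.exists_isIndContained hk
  refine ⟨ε, hε, fun V _ G _ hV hsparse hcoh ↦ ?_⟩
  have hn : (1 : ℝ) < Fintype.card V := by exact_mod_cast hV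
  have hnpos := one_pos.trans hn
  have hα : ε * (Fintype.card V : ℝ) ^ (1 - c) ≤ ε * Fintype.card V := by
    gcongr
    exact Real.rpow_le_self_of_one_le hn.le (by linarith)
  exact hcontained V G ((Fintype.card V : ℝ) ^ (c / 2)) _ (Real.one_le_rpow hn.le (by positivity))
    (PurePairs.rpow_half_pow hnpos.le hck) (hsparse.one_le_mul_card hV hα hcoh) (by positivity)
    (by rw [mul_assoc, PurePairs.rpow_one_sub_mul_sq hnpos]) hcoh hsparse.degreeIn_le
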